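/- Let $N,n\ge 1$, and for $j=1,\dots,n$ let $f_j=\sum_{m\ge 0}a^{(j)}_m q^m\in M_{k_j}(\Gamma_0(N),\chi_j)$ ($q=e^{2\pi i z}$, $k_j\in\mathbb Z$, $\chi_j$ a Dirichlet character mod $N$), not necessarily cusp forms. Let $\alpha_2,\dots,\alpha_n$ be positive integers and $s\in\mathbb C$. Complex powers are principal. *Modular iterated integrals.* For $a,b$ on the closed imaginary axis put $$I_a^b\binom{f_1,\dots,f_r}{s_1,\dots,s_r}=\int_a^b f_1(z_1)z_1^{s_1}\frac{dz_1}{z_1}\int_a^{z_1}f_2(z_2)z_2^{s_2}\frac{dz_2}{z_2}\cdots\int_a^{z_{r-1}}f_r(z_r)z_r^{s_r}\frac{dz_r}{z_r}$$ (equal to $1$ if $r=0$). The integral $I_{i\infty}^{i/\sqrt N}$ converges absolutely if $\mathrm{Re}(s_i+\dots+s_r)<0$ for all $i$, and $I_{i/\sqrt N}^0$ converges absolutely if $\mathrm{Re}(s_1+\dots+s_i)>k_1+\dots+k_i$ for all $i$ ($k_i$ the weight of $f_i$). Both have meromorphic continuations to $\mathbb C^r$. The modular iterated integral is the meromorphic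 function $$I_{i\infty}^0\binom{f_1,\dots,f_n}{s_1,\dots,s_n}=\sum_{j=0}^n I_{i\infty}^{i/\sqrt N}\binom{f_{j+1},\dots,f_n}{s_{j+1},\dots,s_n}\,I_{i/\sqrt N}^0\binom{f_1,\dots,f_j}{s_1,\dots,s_j}.$$ *Multiple modular $L$-functions.* Let $$L\binom{f_1,\dots,f_l}{t_1,\dots,t_l}=(-2\pi i)^{-(t_1+\dots+t_l)}\sum_{m_1,\dots,m_l>0}\frac{a^{(1)}_{m_1}\cdots a^{(l)}_{m_l}}{(m_1+\dots+m_l)^{t_1}(m_2+\dots+m_l)^{t_2}\cdots m_l^{t_l}},$$ which converges absolutely for $\mathrm{Re}(t_1)$ large, and is meromorphically continued in $t_1\in\mathbb C$. *Notation.* For non-negative integers $n_1,\dots,n_{l+1}$ put $n_i'=n_1+\dots+n_i+i$. With $\alpha_1:=s$ where it occurs, put $\alpha_{p,r}=\alpha_p+\dots+\alpha_r$ (so $\alpha_{1,n}=s+\alpha_2+\dots+\alpha_n$, and $\alpha_{2,1}=0$), $\Gamma^{(s_1,\dots,s_r)}=(-1)^r\Gamma(s_1)\cdots\Gamma(s_r)$,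 and $$A_{n_1,\dots,n_l}=\prod_{\substack{1\le i\le n\\ i\notin\{n_1',\dots,n_l'\}}}a_0^{(i)},\qquad B_m(s_1,\dots,s_n)=\prod_{k=1}^m\frac1{s_n+s_{n-1}+\dots+s_{n-k+1}} .$$ **Theorem.** For all but finitely many $s\in\mathbb C$, the continuations of all the integrals in the definition of $I_{i\infty}^0\binom{f_1,\dots,f_n}{s,\alpha_2,\dots,\alpha_n}$ are regular at the point in question; all the $L$-functions below have meromorphic continuations to $s\in\mathbb C$; and, as an identity of meromorphic functions of $s$, $$\begin{aligned}I_{i\infty}^0\binom{f_1,\dots,f_n}{s,\alpha_2,\dots,\alpha_n}=\sum_{l=1}^n\ \sum_{\substack{n_1,\dots,n_{l+1}\ge 0\\ n_{l+1}'=n+1}}&\Gamma^{(s,\alpha_2,\dots,\alpha_{n_l'-1},\alpha_{n_l',n})}A_{n_1,\dots,n_l}B_{n_{l+1}}(s,\alpha_2,\dots,\alpha_n)\\ &\times\sum_{(j_2,\dots,j_{n_l'})}\binom{s+j_2-1}{j_2}\prod_{k=3}^{n_l'}\binom{\alpha_{k-1}+j_k-1}{j_k}\;L\binom{f_{n_1'},\dots,f_{n_l'}}{t_1,\dots,t_l}.\end{aligned}$$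 Here for $n_l'=1$ the Gamma factor is $\Gamma^{(\alpha_{1,n})}$ and the inner sum has the single empty tuple, with binomial factor $1$. In general the inner sum is over all integer tuples with $0\le j_r<\alpha_r+j_{r+1}$ for $2\le r<n_l'$ and $0\le j_{n_l'}<\alpha_{n_l',n}$, where $j_{n_l'+1}:=0$. The arguments are $t_1=s+\alpha_{2,n}$ if $l=1$, and if $l\ge 2$ $$t_1=s+\alpha_{2,n_1'}+j_{n_1'+1},\qquad t_i=\alpha_{n_{i-1}'+1,n_i'}-j_{n_{i-1}'+1}+j_{n_i'+1}\ (1<i<l),\qquad t_l=\alpha_{n_{l-1}'+1,n}-j_{n_{l-1}'+1}.$$ The identity holds at every $s\in\mathbb C\setminus\{0,-1,-2,\dots\}$ at which the integrals on the left and all the $L$-functions on the right are regular. -/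

import Mathlib

open UpperHalfPlane hiding I
open Complex Set MeasureTheory
open scoped ModularForm MatrixGroups Manifold

noncomputable section

namespace ModIter

/-! ### Modular forms with character -/

/-- `f ∈ M_k(Γ₀(N), χ)`: `f` is holomorphic on the upper half-plane, satisfies
`f|[γ]_k = χ(d) f` for all `γ = (a b; c d) ∈ Γ₀(N)`, and is holomorphic at all cusps (every
translate `f|[γ]_k`, `γ ∈ SL₂(ℤ)`, is bounded at `i∞`). -/
structure IsModularForm (N : ℕ) (k : ℤ) (χ : DirichletCharacter ℂ N) (f : ℍ → ℂ) : Prop where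
  holo : MDiff f
  slash_eq : ∀ γ ∈ CongruenceSubgroup.Gamma0 N, f ∣[k] γ = χ ((γ 1 1 : ℤ) : ZMod N) • f
  bdd_at_cusps : ∀ γ : SL(2, ℤ), IsBoundedAtImInfty (f ∣[k] γ)

/-- The `m`-th coefficient of the expansion `f = ∑ aₘ qᵐ`, `q = exp (2πiz)`. -/
def qCoeff (f : ℍ → ℂ) (m : ℕ) : ℂ := (qExpansion 1 f).coeff m

/-! ### Iterated integrals along the imaginary axis -/

/-- The integrand `∏ᵢ fᵢ(zᵢ) zᵢ^{sᵢ} dzᵢ/zᵢ` at `zᵢ = i yᵢ` (so that `dzᵢ/zᵢ = dyᵢ/yᵢ`). -/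
def integrand {r : ℕ} (f : Fin r → ℍ → ℂ) (s : Fin r → ℂ) (y : Fin r → ℝ) : ℂ :=
  ∏ i, f i (ofComplex (I * (y i : ℂ))) * (I * (y i : ℂ)) ^ s i / (y i : ℂ)

/-- The simplex `y₁ < y₂ < ⋯ < y_r` in `S`. -/
def simplex (r : ℕ) (S : Set ℝ) : Set (Fin r → ℝ) :=
  {y | StrictMono y ∧ ∀ i, y i ∈ S}

/-- The iterated integral `∫ f₁(z₁) z₁^{s₁} dz₁/z₁ ∫ f₂(z₂) z₂^{s₂} dz₂/z₂ ⋯ ∫ f_r(z_r) z_r^{s_r} dz_r/z_r`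
along the downward oriented segment `i S` of the imaginary axis: `f_r` is innermost, and `z_r` lies
nearest to the starting point of the path. The sign is due to the orientation. With `S = (c, ∞)` it
is `I_{i∞}^{ic}`, with `S = (0, c)` it is `I_{ic}^0`. -/
def iterInt {r : ℕ} (S : Set ℝ) (f : Fin r → ℍ → ℂ) (s : Fin r → ℂ) : ℂ :=
  (-1) ^ r * ∫ y in simplex r S, integrand f s y

/-- `v` is the value at `p` of the meromorphic continuation to `ℂ^r` of the iterated integral, which
converges absolutely for `s ∈ D`: the continuation is a quotient `P / Q` of entire
functions with `Q p ≠ 0`, and `v = P p / Q p`. -/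
def IsContinuedValue {r : ℕ} (S : Set ℝ) (D : Set (Fin r → ℂ)) (f : Fin r → ℍ → ℂ)
    (p : Fin r → ℂ) (v : ℂ) : Prop :=
  ∃ P Q : (Fin r → ℂ) → ℂ, Differentiable ℂ P ∧ Differentiable ℂ Q ∧
    (∀ s ∈ D, IntegrableOn (integrand f s) (simplex r S) ∧ P s = Q s * iterInt S f s) ∧
    Q p ≠ 0 ∧ v = P p / Q p

open Classical in
/-- The value at `p` of the meromorphic continuation of the iterated integral
(`0` if it is not regular at `p`). -/
def continuedInt {r : ℕ} (S : Set ℝ) (D : Set (Fin r → ℂ)) (f : Fin r → ℍ → ℂ)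
    (p : Fin r → ℂ) : ℂ :=
  if h : ∃ v, IsContinuedValue S D f p v then h.choose else 0

/-- The domain `Re (sᵢ + ⋯ + s_r) < 0` for all `i`, where integrals from `i∞` converge. -/
def domInfty (r : ℕ) : Set (Fin r → ℂ) :=
  {s | ∀ i, (∑ t ∈ Finset.Ici i, s t).re < 0}

/-- The domain `Re (s₁ + ⋯ + sᵢ) > k₁ + ⋯ + kᵢ` for all `i`, where integrals to `0` of forms of
weights `k₁, …, k_r` converge. -/
def domZero {r : ℕ} (k : Fin r → ℤ) : Set (Fin r → ℂ) :=
  {s | ∀ i, (∑ t ∈ Finset.Iic i, (k t : ℝ)) < (∑ t ∈ Finset.Iic i, s t).re}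

/-! Sequences `f₁, f₂, …`, `s₁, s₂, …`, `k₁, k₂, …` are written as functions on `ℕ` of which only
the entries with the indices `1, …, n` are used. -/

/-- The entries `x_{p+1}, …, x_{p+r}` of a sequence. -/
def block {X : Type} (x : ℕ → X) (p r : ℕ) : Fin r → X := fun i => x (p + 1 + i)

/-- The point `1/√N`: the paths are divided at `i/√N`. -/
def basePt (N : ℕ) : ℝ := 1 / Real.sqrt N

/-- `(s₁, …, sₙ)` is a regular point of the continuations of all the integrals
`I_{i∞}^{i/√N}(f_{j+1}, …, fₙ; s_{j+1}, …, sₙ)` and `I_{i/√N}^0(f₁, …, f_j; s₁, …, s_j)`. -/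
def IsRegularAt (N n : ℕ) (k : ℕ → ℤ) (f : ℕ → ℍ → ℂ) (s : ℕ → ℂ) : Prop :=
  ∀ j ≤ n,
    (∃ v, IsContinuedValue (Ioi (basePt N)) (domInfty (n - j)) (block f j (n - j))
      (block s j (n - j)) v) ∧
    (∃ v, IsContinuedValue (Ioo 0 (basePt N)) (domZero (block k 0 j)) (block f 0 j)
      (block s 0 j) v)

/-- The modular iterated integral `I_{i∞}^0(f₁, …, fₙ; s₁, …, sₙ)`, meromorphically continued in
`(s₁, …, sₙ)` by composition of paths at `i/√N`:
`∑_{j=0}^n I_{i∞}^{i/√N}(f_{j+1}, …, fₙ; s_{j+1}, …, sₙ) · I_{i/√N}^0(f₁, …, f_j; s₁, …, s_j)`. -/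
def modIterInt (N n : ℕ) (k : ℕ → ℤ) (f : ℕ → ℍ → ℂ) (s : ℕ → ℂ) : ℂ :=
  ∑ j ∈ Finset.range (n + 1),
    continuedInt (Ioi (basePt N)) (domInfty (n - j)) (block f j (n - j)) (block s j (n - j)) *
    continuedInt (Ioo 0 (basePt N)) (domZero (block k 0 j)) (block f 0 j) (block s 0 j)

/-! ### Multiple modular `L`-functions -/

/-- The sequence `(z, β₂, β₃, …)`. -/
def consArg (z : ℂ) (β : ℕ → ℂ) : ℕ → ℂ := fun i => if i = 1 then z else β i

/-- The term of the multiple modular `L`-series of length `l` that belongs to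
`m₁, …, m_l > 0`, for the coefficients `a i m = a_m^{(i)}`. -/
def multLTerm (l : ℕ) (a : ℕ → ℕ → ℂ) (t : ℕ → ℂ) (m : Fin l → ℕ+) : ℂ :=
  ∏ i : Fin l, a (i + 1) (m i) / (∑ r ∈ Finset.Ici i, ((m r : ℕ) : ℂ)) ^ t (i + 1)

/-- The multiple modular `L`-series with arguments `t₁, …, t_l`. -/
def multLSeries (l : ℕ) (a : ℕ → ℕ → ℂ) (t : ℕ → ℂ) : ℂ :=
  (-2 * (Real.pi : ℂ) * I) ^ (-∑ i ∈ Finset.Icc 1 l, t i) * ∑' m : Fin l → ℕ+, multLTerm l a t m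

/-- `g` is the meromorphic continuation to `ℂ` of `z ↦ L(f₁, …, f_l; z, β₂, …, β_l)`, which is given
by the absolutely convergent series for `Re z` large. At its poles `g` takes the value `0`
(normal form), so it is unique. -/
def IsContinuedL (l : ℕ) (a : ℕ → ℕ → ℂ) (β : ℕ → ℂ) (g : ℂ → ℂ) : Prop :=
  MeromorphicNFOn g univ ∧ ∃ σ : ℝ, ∀ z : ℂ, σ < z.re →
    Summable (multLTerm l a (consArg z β)) ∧ g z = multLSeries l a (consArg z β)

/-- `L(f₁, …, f_l; z, β₂, …, β_l)` is regular at `z`. -/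
def IsRegularL (l : ℕ) (a : ℕ → ℕ → ℂ) (β : ℕ → ℂ) (z : ℂ) : Prop :=
  ∃ g, IsContinuedL l a β g ∧ AnalyticAt ℂ g z

open Classical in
/-- The multiple modular `L`-function `L(f₁, …, f_l; z, β₂, …, β_l)`, as a meromorphic function of
`z`. -/
def multL (l : ℕ) (a : ℕ → ℕ → ℂ) (β : ℕ → ℂ) (z : ℂ) : ℂ :=
  if h : ∃ g, IsContinuedL l a β g then h.choose z else 0

/-! ### The ingredients of the formula

`ν = (n₁, …, n_{l+1})`, with `n₁ = ν 0`, and `α₂, …, αₙ` are positive integers. -/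

/-- `n_i' = n₁ + ⋯ + n_i + i`. -/
def idx {l : ℕ} (ν : Fin (l + 1) → ℕ) (i : ℕ) : ℕ :=
  (∑ r ∈ Finset.univ.filter (fun r : Fin (l + 1) => (r : ℕ) < i), ν r) + i

/-- The sequence `(s, α₂, …, αₙ)`. -/
def args (s : ℂ) (α : ℕ → ℕ) : ℕ → ℂ := consArg s (fun r => (α r : ℂ))

/-- `Γ^{(s, α₂, …, α_{M-1}, α_{M,n})}`, i.e. `(-1)^M` times the product of the Gamma values; here
`α_{M,n} = α_M + ⋯ + αₙ`, with `s` in place of `α₁` (so that it is `Γ^{(s + α₂ + ⋯ + αₙ)}` for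
`M = 1`). -/
def gammaFactor (n M : ℕ) (s : ℂ) (α : ℕ → ℕ) : ℂ :=
  (-1) ^ M * (∏ r ∈ Finset.Icc 1 (M - 1), Gamma (args s α r)) *
    Gamma (∑ r ∈ Finset.Icc M n, args s α r)

/-- `A_{n₁,…,n_l}`: the product of the constant terms of the `f_i`, `1 ≤ i ≤ n`, with `i` not among
`n₁', …, n_l'`. -/
def coeffA (n : ℕ) {l : ℕ} (f : ℕ → ℍ → ℂ) (ν : Fin (l + 1) → ℕ) : ℂ :=
  ∏ i ∈ Finset.Icc 1 n \ (Finset.Icc 1 l).image (idx ν), qCoeff (f i) 0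

/-- `B_m(s₁, …, sₙ) = 1 / (sₙ (sₙ + s_{n-1}) ⋯ (sₙ + ⋯ + s_{n-m+1}))`. -/
def coeffB (n m : ℕ) (s : ℕ → ℂ) : ℂ :=
  ∏ k ∈ Finset.Icc 1 m, (∑ r ∈ Finset.Icc (n - k + 1) n, s r)⁻¹

/-- The sequence `(α₂, …, α_{M-1}, α_{M,n})`, indexed by `2, …, M`. -/
def alphaTail (n M : ℕ) (α : ℕ → ℕ) (r : ℕ) : ℕ :=
  if r = M then ∑ t ∈ Finset.Icc M n, α t else α r

/-- The tuples `(j₂, …, j_M)` with `0 ≤ j_r < b_r + j_{r+1}` and `j_{M+1} = 0`, extended by zero. -/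
def jSet (M : ℕ) (b : ℕ → ℕ) : Set (ℕ →₀ ℕ) :=
  {j | (∀ r, ¬ (2 ≤ r ∧ r ≤ M) → j r = 0) ∧ ∀ r, 2 ≤ r → r ≤ M → j r < b r + j (r + 1)}

theorem jSet_finite (M : ℕ) (b : ℕ → ℕ) : (jSet M b).Finite := by
  classical
  have key : ∀ j ∈ jSet M b, ∀ r, j r ≤ ∑ t ∈ Finset.Icc r M, b t := by
    rintro j ⟨h0, h1⟩
    have : ∀ d r, M + 1 ≤ r + d → j r ≤ ∑ t ∈ Finset.Icc r M, b t := by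
      intro d
      induction d with
      | zero =>
        intro r hr
        rw [h0 r (by omega)]
        exact Nat.zero_le _
      | succ d ih =>
        intro r hr
        by_cases hrM : 2 ≤ r ∧ r ≤ M
        · have h2 := h1 r hrM.1 hrM.2
          have h3 := ih (r + 1) (by omega)
          have h4 : ∑ t ∈ Finset.Icc r M, b t = b r + ∑ t ∈ Finset.Icc (r + 1) M, b t := by
            rw [← Finset.insert_Icc_add_one_left_eq_Icc hrM.2, Finset.sum_insert (by simp)]
          omega
        · rw [h0 r hrM]
          exact Nat.zero_le _
    intro r
    exact this (M + 1) r (by omega)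
  let B : ℕ →₀ ℕ := Finsupp.onFinset (Finset.range (M + 1))
    (fun r => if r ≤ M then ∑ t ∈ Finset.Icc r M, b t else 0)
    (by intro r hr; simp only [ne_eq, ite_eq_right_iff, Classical.not_imp] at hr
        simp; omega)
  refine (Set.finite_Iic B).subset ?_
  intro j hj r
  by_cases hr : r ≤ M
  · simpa [B, hr] using key j hj r
  · rw [hj.1 r (by omega)]
    exact Nat.zero_le _

/-- The tuples `(j₂, …, j_M)` of the inner sum, `M = n_l'`:
`0 ≤ j_r < α_r + j_{r+1}` for `2 ≤ r < M` and `0 ≤ j_M < α_{M,n}`. -/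
def jTuples (n M : ℕ) (α : ℕ → ℕ) : Finset (ℕ →₀ ℕ) :=
  (jSet_finite M (alphaTail n M α)).toFinset

/-- `binom(s + j₂ - 1, j₂) ∏_{k=3}^{M} binom(α_{k-1} + j_k - 1, j_k)`. -/
def binomFactor (M : ℕ) (s : ℂ) (α : ℕ → ℕ) (j : ℕ → ℕ) : ℂ :=
  Ring.choose (s + (j 2 : ℂ) - 1) (j 2) *
    ∏ k ∈ Finset.Icc 3 M, ((α (k - 1) + j k - 1).choose (j k) : ℂ)

/-- The last index that enters the `i`-th argument of the `L`-function: `n_i'` for `i < l` and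
`n` for `i = l`. -/
def upper (n : ℕ) {l : ℕ} (ν : Fin (l + 1) → ℕ) (i : ℕ) : ℕ :=
  if i = l then n else idx ν i

/-- The first argument of the `L`-function: `s + α_{2,n₁'} + j_{n₁'+1}` if `l ≥ 2`, and
`s + α_{2,n}` if `l = 1`. -/
def firstArg (n : ℕ) {l : ℕ} (ν : Fin (l + 1) → ℕ) (s : ℂ) (α : ℕ → ℕ) (j : ℕ → ℕ) : ℂ :=
  s + (∑ r ∈ Finset.Icc 2 (upper n ν 1), (α r : ℂ)) + (j (idx ν 1 + 1) : ℂ)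

/-- The `i`-th argument of the `L`-function for `i ≥ 2`:
`α_{n_{i-1}'+1,n_i'} - j_{n_{i-1}'+1} + j_{n_i'+1}` if `i < l`, and
`α_{n_{l-1}'+1,n} - j_{n_{l-1}'+1}` if `i = l` (as `j_{n_l'+1} = 0`). -/
def otherArg (n : ℕ) {l : ℕ} (ν : Fin (l + 1) → ℕ) (α : ℕ → ℕ) (j : ℕ → ℕ) (i : ℕ) : ℂ :=
  (∑ r ∈ Finset.Icc (idx ν (i - 1) + 1) (upper n ν i), (α r : ℂ))
    - (j (idx ν (i - 1) + 1) : ℂ) + (j (idx ν i + 1) : ℂ)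

/-- The coefficients `a_m^{(n_i')}` of the forms `f_{n₁'}, …, f_{n_l'}`. -/
def subCoeff {l : ℕ} (f : ℕ → ℍ → ℂ) (ν : Fin (l + 1) → ℕ) : ℕ → ℕ → ℂ :=
  fun i => qCoeff (f (idx ν i))

/-- The tuples `(n₁, …, n_{l+1})` of non-negative integers with `n_{l+1}' = n + 1`. -/
def nuTuples (n l : ℕ) : Finset (Fin (l + 1) → ℕ) :=
  Finset.Nat.antidiagonalTuple (l + 1) (n - l)

/-- The explicit linear combination of multiple modular `L`-values. -/
def lCombination (n : ℕ) (f : ℕ → ℍ → ℂ) (s : ℂ) (α : ℕ → ℕ) : ℂ :=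
  ∑ l ∈ Finset.Icc 1 n, ∑ ν ∈ nuTuples n l,
    gammaFactor n (idx ν l) s α * coeffA n f ν * coeffB n (ν (Fin.last l)) (args s α) *
      ∑ j ∈ jTuples n (idx ν l) α, binomFactor (idx ν l) s α j *
        multL l (subCoeff f ν) (otherArg n ν α j) (firstArg n ν s α j)

end ModIter

end

/-! Write `E_j(x)` for the regularised iterated integral from `i∞` to `ix` of the forms with index
above `j`, and `G_j(x)` for the integral from `ix` to `0` of the first `j` forms (`regE`, `regG`).
Differentiating `E_j` peels off the form with index `j + 1`, and differentiating `G_{j+1}` peels off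
the same form with the opposite sign, so `∑ E_j G_j` does not depend on `x` (`hasDerivAt_pathSum`).
The base point `1/√N` may therefore be moved to `0`. For `j ≥ 1` the exponent `s` does not occur in
`E_j`, which grows at most polynomially, while `G_j` vanishes to any prescribed order once `Re s` is
large. Only the limit of `E_0` survives (`eventually_pathSum_eq`).

That limit comes from an explicit expansion of `E_1` (`expandE`). Split every form into its constant
term and the rest. A constant term is just a factor; the rest opens one more summation variable in a
multiple exponential sum (`expSum_succ`, `mul_expandE`). Integrating a power of `z` times such a sum
is repeated partial integration, which raises the first argument of the sum; the indices `j_r`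
record the powers of `z` that remain (`hasDerivAt_sum_pow_mul_expSum`, `termD_bump_eq`). The
expansion has the same derivative and the same behaviour at infinity as the regularised integral, so
the two agree (`regE_eq_expandE`). In the outermost integral the pure power of `z` disappears in the
limit, and Mellin transforms turn the exponential sums into Gamma values times `L`-series
(`exists_mellin_expSum`, `tendsto_regE_zero`). This proves the identity for large `Re s`.

The continuation of the iterated integrals uses only that a form tends exponentially fast to a
constant `c`. If the inner integral is `R + A u^S` up to its denominator, with `R` exponentially
small, then `φ (R + A u^S) = (φ R + (φ - c) A u^S) + c A u^S`. The bracket is integrable for all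
exponents, and the last term has an elementary primitive, whose denominator is a factor of `regDen`.
Thus the integral is a quotient of entire functions (`regNum_eq_regDen_mul_integral`). Integrals to
`0` are reduced to this case by `z ↦ -1/(Nz)` (`isContinuedValue_zero`).

For the `L`-functions, a multiple exponential sum with natural arguments arises from forms by
products and primitives. After `x ↦ 1/(Nx)` a form is a constant times `x^k` up to an exponentially
small error. Allowing Laurent polynomials in `x` with powers of `log x` gives a class closed under
both operations (`isLogExp_expSum`), and Mellin transforms of such functions are meromorphic
(`exists_meromorphic_mellin`).

The identity theorem then carries the formula from a half-plane to the whole plane, up to isolated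
points, and continuity gives it at each regular point (`modIterInt_eq_lCombination`). -/

noncomputable section

namespace ModIter

open Filter Topology Asymptotics

/-! ### Modular forms on the imaginary axis -/

/-- The restriction `y ↦ f (iy)` to the imaginary axis. -/
def onAxis (f : ℍ → ℂ) (y : ℝ) : ℂ := f (ofComplex (I * (y : ℂ)))

/-- The properties of the restriction `F` of a modular form of weight `k` and level `N` with
Fourier coefficients `a` to the imaginary axis which matter for iterated integrals. -/
structure IsAxisForm (N : ℕ) (k : ℤ) (a : ℕ → ℂ) (F : ℝ → ℂ) : Prop where
  continuousOn : ContinuousOn F (Ioi 0)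
  hasSum : ∀ y : ℝ, 0 < y → HasSum (fun m : ℕ => a m * (Real.exp (-(2 * Real.pi * m * y)) : ℂ)) (F y)
  coeff_le : ∃ (C : ℝ) (K : ℕ), 0 ≤ C ∧ ∀ m : ℕ, 0 < m → ‖a m‖ ≤ C * (m : ℝ) ^ K
  decay : ∃ δ > 0, (fun y => F y - a 0) =O[atTop] fun y => Real.exp (-δ * y)
  decay_inv : ∃ b : ℂ, ∃ δ > 0,
    (fun x : ℝ => F (1 / (N * x)) * (x : ℂ) ^ (-k) - b) =O[atTop] fun x => Real.exp (-δ * x)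

lemma periodic_of_slash_T_pow {f : ℍ → ℂ} {k : ℤ} (n : ℕ)
    (h : f ∣[k] (ModularGroup.T ^ (n : ℤ)) = f) :
    Function.Periodic (f ∘ ofComplex) ((n : ℝ) : ℂ) := by
  intro w
  by_cases hw : 0 < w.im
  · have h2 : 0 < (w + ((n : ℝ) : ℂ)).im := by simpa using hw
    simp only [Function.comp_apply, ofComplex_apply_of_im_pos h2, ofComplex_apply_of_im_pos hw]
    have h3 := congrFun h ⟨w, hw⟩
    rw [ModularForm.SL_slash_apply] at h3
    have h4 : denom (ModularGroup.T ^ (n : ℤ) : SL(2, ℤ)) (⟨w, hw⟩ : ℍ) = 1 := by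
      rw [ModularGroup.denom_apply, ModularGroup.coe_T_zpow]
      simp
    rw [h4, one_zpow, mul_one] at h3
    rw [← h3]
    congr 1
    ext
    rw [ModularGroup.coe_T_zpow_smul_eq]
    simp
  -- Off the upper half-plane `ofComplex` takes a constant default value, so periodicity is trivial
  -- there.
  · have h2 : (w + ((n : ℝ) : ℂ)).im ≤ 0 := by simpa using hw
    rw [not_lt] at hw
    rw [Function.comp_apply, Function.comp_apply, ofComplex_apply_of_im_nonpos h2,
      ofComplex_apply_of_im_nonpos hw]

namespace IsModularForm

variable {N : ℕ} {k : ℤ} {χ : DirichletCharacter ℂ N} {f : ℍ → ℂ}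

lemma slash_eq_self (hf : IsModularForm N k χ f) (γ : SL(2, ℤ)) (h0 : ((γ 1 0 : ℤ) : ZMod N) = 0)
    (h1 : ((γ 1 1 : ℤ) : ZMod N) = 1) : f ∣[k] γ = f := by
  rw [hf.slash_eq γ (CongruenceSubgroup.Gamma0_mem.mpr h0), h1]
  simp

/-- The modular form on `Γ₁(N)` with underlying function `f`. -/
def toModularForm (hf : IsModularForm N k χ f) (hN : 0 < N) :
    ModularForm (CongruenceSubgroup.Gamma1 N : Subgroup (GL (Fin 2) ℝ)) k where
  toFun := f
  slash_action_eq' := by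
    rintro _ ⟨γ, hγ, rfl⟩
    have := (CongruenceSubgroup.Gamma1_mem N γ).mp hγ
    exact hf.slash_eq_self γ this.2.2 this.2.1
  holo' := hf.holo
  bdd_at_cusps' := by
    intro c hc
    have : NeZero N := ⟨hN.ne'⟩
    rw [Subgroup.IsArithmetic.isCusp_iff_isCusp_SL2Z] at hc
    rw [OnePoint.isBoundedAt_iff_forall_SL2Z hc]
    exact fun γ _ => hf.bdd_at_cusps γ

lemma periodic (hf : IsModularForm N k χ f) : Function.Periodic (f ∘ ofComplex) ((1 : ℝ) : ℂ) := by
  have := periodic_of_slash_T_pow (f := f) (k := k) 1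
    (hf.slash_eq_self _ (by rw [ModularGroup.coe_T_zpow]; simp)
      (by rw [ModularGroup.coe_T_zpow]; simp))
  simpa using this

lemma bdd (hf : IsModularForm N k χ f) : IsBoundedAtImInfty f := by
  simpa using hf.bdd_at_cusps 1

/-- The conjugate `S T^N S⁻¹ = (1, 0; -N, 1)` lies in `Γ₁(N)`, so it fixes `f` regardless of the
character; the cusp `0` therefore has a period `N`. -/
lemma periodic_slash_S (hf : IsModularForm N k χ f) :
    Function.Periodic ((f ∣[k] ModularGroup.S) ∘ ofComplex) ((N : ℝ) : ℂ) := by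
  apply periodic_of_slash_T_pow (k := k)
  rw [← SlashAction.slash_mul]
  have h1 : ModularGroup.S * ModularGroup.T ^ (N : ℤ)
      = (ModularGroup.S * ModularGroup.T ^ (N : ℤ) * ModularGroup.S⁻¹) * ModularGroup.S := by
    group
  have h2 : (ModularGroup.S * ModularGroup.T ^ (N : ℤ) * ModularGroup.S⁻¹ : SL(2, ℤ)).1
      = !![1, 0; -(N : ℤ), 1] := by
    rw [Matrix.SpecialLinearGroup.coe_mul, Matrix.SpecialLinearGroup.coe_mul,
      ModularGroup.coe_T_zpow, Matrix.SpecialLinearGroup.coe_inv]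
    ext i j
    fin_cases i <;> fin_cases j <;>
      simp [ModularGroup.S, Matrix.mul_apply, Fin.sum_univ_two, Matrix.adjugate_fin_two]
  rw [h1, SlashAction.slash_mul, hf.slash_eq_self]
  · rw [h2]; simp
  · rw [h2]; simp

/-- Hecke's argument without cuspidality: the Petersson norm `|f|² y^k` is invariant under `Γ₁(N)`
and is `O(y^|k|)` at every cusp, hence at most `C max(y, 1/y)^|k|` everywhere. Near the real axis
this gives `f = O(y^(-|k|))`, which bounds the coefficients. -/
lemma coeff_isBigO (hf : IsModularForm N k χ f) (hN : 0 < N) :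
    (fun n ↦ qCoeff f n) =O[atTop] fun n ↦ (n : ℝ) ^ (|(k : ℝ)|) := by
  have : NeZero N := ⟨hN.ne'⟩
  set g := hf.toModularForm hN
  have hgf : (g : ℍ → ℂ) = f := rfl
  have hw : (CongruenceSubgroup.Gamma1 N : Subgroup (GL (Fin 2) ℝ)).strictWidthInfty = 1 :=
    CongruenceSubgroup.strictWidthInfty_Gamma1 N
  have key := qExpansion_coeff_isBigO_of_norm_isBigO g |(k : ℝ)| ?_
  · rwa [hw, hgf] at key
  obtain ⟨C, hC⟩ : ∃ C, ∀ τ, ‖petersson k g g τ‖ ≤ C * max τ.im (1 / τ.im) ^ |(k : ℝ)| := by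
    conv => enter [1, C, τ, 1]; rw [← norm_norm]
    refine ModularGroup.exists_bound_of_subgroup_invariant_of_isArithmetic_of_isBigO
      (Γ := (CongruenceSubgroup.Gamma1 N : Subgroup (GL (Fin 2) ℝ)))
      (show Continuous (‖petersson k g g ·‖) by fun_prop) (abs_nonneg _)
      (fun γ ↦ ?_) (fun γ hγ τ ↦ SlashInvariantFormClass.norm_petersson_smul hγ)
    simp_rw [← UpperHalfPlane.petersson_slash_SL]
    have hb := ModularFormClass.bdd_at_infty_slash g γ
    have h1 : (fun τ : ℍ => ‖((τ.im : ℂ)) ^ k‖) =O[atImInfty] fun τ : ℍ => τ.im ^ |(k : ℝ)| := by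
      refine IsBigO.of_bound 1 ?_
      filter_upwards [UpperHalfPlane.atImInfty_mem _ |>.mpr ⟨1, fun τ hτ => hτ⟩] with τ hτ
      rw [norm_norm, norm_zpow, Complex.norm_real, Real.norm_of_nonneg τ.im_pos.le,
        Real.norm_of_nonneg (Real.rpow_nonneg τ.im_pos.le _), one_mul, ← Real.rpow_intCast]
      exact Real.rpow_le_rpow_of_exponent_le hτ (le_abs_self _)
    simpa [petersson] using hb.norm_left.mul hb.norm_left |>.mul h1
  refine IsBigO.of_bound (Real.sqrt C) ?_
  rw [eventually_comap]
  filter_upwards [eventually_le_nhds zero_lt_one] with t ht τ hτ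
  have hpos := τ.im_pos
  have h1 := hC τ
  have hm : max τ.im (1 / τ.im) = τ.im⁻¹ := by
    rw [one_div]
    exact max_eq_right ((hτ.le.trans ht).trans ((one_le_inv₀ hpos).mpr (hτ.le.trans ht)))
  have h2 : ‖petersson k g g τ‖ = ‖g τ‖ ^ 2 * τ.im ^ (k : ℝ) := by
    rw [petersson, norm_mul, norm_mul, Complex.norm_conj, norm_zpow, Complex.norm_real,
      Real.norm_of_nonneg hpos.le, Real.rpow_intCast]
    ring
  rw [h2, hm, ← le_div_iff₀ (by positivity)] at h1
  rw [Real.norm_of_nonneg (by positivity)]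
  have hC0 : 0 ≤ C := by
    by_contra hneg
    push Not at hneg
    have : C * τ.im⁻¹ ^ |(k : ℝ)| / τ.im ^ (k : ℝ) < 0 :=
      div_neg_of_neg_of_pos (mul_neg_of_neg_of_pos hneg (by positivity)) (by positivity)
    nlinarith [sq_nonneg ‖g τ‖]
  refine abs_le_of_sq_le_sq' ?_ (by positivity) |>.2
  rw [mul_pow, Real.sq_sqrt hC0]
  refine h1.trans ?_
  rw [mul_div_assoc]
  refine mul_le_mul_of_nonneg_left ?_ hC0
  rw [Real.inv_rpow hpos.le, ← Real.rpow_neg hpos.le, ← Real.rpow_sub hpos, ← Real.rpow_natCast,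
    ← Real.rpow_mul hpos.le]
  refine Real.rpow_le_rpow_of_exponent_ge hpos (hτ.le.trans ht) ?_
  have := le_abs_self (k : ℝ)
  push_cast
  linarith

lemma exists_coeff_le (hf : IsModularForm N k χ f) (hN : 0 < N) :
    ∃ (C : ℝ) (K : ℕ), 0 ≤ C ∧ ∀ m : ℕ, 0 < m → ‖qCoeff f m‖ ≤ C * (m : ℝ) ^ K := by
  obtain ⟨C, hC⟩ := (hf.coeff_isBigO hN).bound
  rw [eventually_atTop] at hC
  obtain ⟨M, hM⟩ := hC
  refine ⟨|C| + ∑ m ∈ Finset.range M, ‖qCoeff f m‖, ⌈|(k : ℝ)|⌉₊,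
    add_nonneg (abs_nonneg _) (Finset.sum_nonneg fun _ _ => norm_nonneg _), fun m hm => ?_⟩
  have hm1 : (1 : ℝ) ≤ m := by exact_mod_cast hm
  have hs : 0 ≤ ∑ m ∈ Finset.range M, ‖qCoeff f m‖ := Finset.sum_nonneg fun _ _ => norm_nonneg _
  by_cases h : M ≤ m
  · refine (hM m h).trans ?_
    rw [Real.norm_of_nonneg (by positivity), ← Real.rpow_natCast]
    refine mul_le_mul ((le_abs_self C).trans (by linarith))
      (Real.rpow_le_rpow_of_exponent_le hm1 (Nat.le_ceil _)) (by positivity)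
      (add_nonneg (abs_nonneg _) hs)
  · have h1 : ‖qCoeff f m‖ ≤ ∑ m ∈ Finset.range M, ‖qCoeff f m‖ :=
      Finset.single_le_sum (f := fun m => ‖qCoeff f m‖) (fun _ _ => norm_nonneg _)
        (Finset.mem_range.mpr (not_le.mp h))
    have h2 : (1 : ℝ) ≤ (m : ℝ) ^ ⌈|(k : ℝ)|⌉₊ := one_le_pow₀ hm1
    have := abs_nonneg C
    nlinarith

/-- With `z = iNx` one has `S z = i/(Nx)`, so the behaviour of `f` at `0` is that of its translate
by `S` at `i∞`. -/
lemma onAxis_one_div (f : ℍ → ℂ) (k : ℤ) {N : ℕ} (hN : 0 < N) {x : ℝ} (hx : 0 < x) :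
    onAxis f (1 / (N * x)) =
      (f ∣[k] ModularGroup.S) (ofComplex (I * ((N * x : ℝ) : ℂ))) * (I * ((N * x : ℝ) : ℂ)) ^ k := by
  have hNx : 0 < (N : ℝ) * x := by positivity
  have him : 0 < (I * ((N * x : ℝ) : ℂ)).im := by simpa using hNx
  rw [ModularForm.SL_slash_apply, ModularGroup.denom_S, ofComplex_apply_of_im_pos him,
    modular_S_smul, onAxis]
  have hne : I * ((N * x : ℝ) : ℂ) ≠ 0 := by
    intro h; rw [h] at him; simp at him
  rw [mul_assoc, ← zpow_add₀ hne, neg_add_cancel, zpow_zero, mul_one]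
  congr 1
  rw [ofComplex_apply_of_im_pos]
  · ext
    have : ((N * x : ℝ) : ℂ) ≠ 0 := by exact_mod_cast hNx.ne'
    push_cast at this ⊢
    rw [← neg_mul, mul_inv, inv_neg, inv_I, neg_neg, one_div]
  · simp only [I_mul_im, ofReal_re]
    positivity

theorem isAxisForm (hf : IsModularForm N k χ f) (hN : 0 < N) :
    IsAxisForm N k (qCoeff f) (onAxis f) where
  continuousOn := by
    intro y hy
    have h1 : ContinuousAt (f ∘ ofComplex) (I * (y : ℂ)) :=
      (UpperHalfPlane.mdifferentiableAt_iff.mp (hf.holo ⟨I * y, by simpa using hy⟩)).continuousAt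
    exact (ContinuousAt.comp (g := f ∘ ofComplex) (f := fun y : ℝ => I * (y : ℂ)) h1
      (by fun_prop)).continuousWithinAt
  hasSum := by
    intro y hy
    have him : 0 < (I * (y : ℂ)).im := by simpa using hy
    have := UpperHalfPlane.hasSum_qExpansion one_pos hf.periodic hf.holo hf.bdd ⟨_, him⟩
    rw [onAxis, ofComplex_apply_of_im_pos him]
    convert this using 2 with m
    rw [qCoeff, smul_eq_mul, Function.Periodic.qParam, ← Complex.exp_nat_mul, Complex.ofReal_exp]
    congr 2
    push_cast
    linear_combination (-2 * Real.pi * m * y) * I_mul_I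
  coeff_le := hf.exists_coeff_le hN
  decay := by
    refine ⟨2 * Real.pi, by positivity, ?_⟩
    have h := exp_decay_sub_atImInfty one_pos hf.periodic hf.holo hf.bdd
    have h0 : qCoeff f 0 = valueAtInfty f := qExpansion_coeff_zero one_pos
      (analyticAt_cuspFunction_zero one_pos hf.periodic hf.holo hf.bdd) hf.periodic
    have ht : Tendsto (fun y : ℝ => ofComplex (I * (y : ℂ))) atTop atImInfty := by
      rw [atImInfty, tendsto_comap_iff]
      refine tendsto_id.congr' ?_
      filter_upwards [eventually_gt_atTop 0] with y hy
      have him : 0 < (I * (y : ℂ)).im := by simpa using hy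
      simp [ofComplex_apply_of_im_pos him, ← coe_im]
    rw [h0]
    refine (h.comp_tendsto ht).congr' EventuallyEq.rfl ?_
    filter_upwards [eventually_gt_atTop 0] with y hy
    have him : 0 < (I * (y : ℂ)).im := by simpa using hy
    simp [ofComplex_apply_of_im_pos him, ← coe_im]
  decay_inv := by
    set g := f ∣[k] ModularGroup.S with hg
    have hNr : (0 : ℝ) < N := by exact_mod_cast hN
    have h := exp_decay_sub_atImInfty hNr hf.periodic_slash_S
      (by rw [ModularForm.SL_slash]; exact MDifferentiable.slash hf.holo k _)
      (hf.bdd_at_cusps ModularGroup.S)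
    -- The function `g` has period `N` but is evaluated at `iNx`, so its decay rate in `x` is `2π`.
    -- Of the automorphy factor `(iNx)^k` only `(iN)^k` remains.
    refine ⟨(I * N) ^ k * valueAtInfty g, 2 * Real.pi, by positivity, ?_⟩
    have ht : Tendsto (fun y : ℝ => ofComplex (I * ((N * y : ℝ) : ℂ))) atTop atImInfty := by
      rw [atImInfty, tendsto_comap_iff]
      refine (tendsto_id.const_mul_atTop hNr).congr' ?_
      filter_upwards [eventually_gt_atTop 0] with y hy
      have him : 0 < (I * ((N * y : ℝ) : ℂ)).im := by
        rw [I_mul_im, ofReal_re]; positivity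
      rw [Function.comp_apply, ofComplex_apply_of_im_pos him, ← coe_im]
      simp
    refine ((h.comp_tendsto ht).const_mul_left ((I * N) ^ k)).congr' ?_ ?_
    · filter_upwards [eventually_gt_atTop 0] with x hx
      have hxk : (x : ℂ) ^ k * (x : ℂ) ^ (-k) = 1 := by
        rw [← zpow_add₀ (by exact_mod_cast hx.ne'), add_neg_cancel, zpow_zero]
      rw [onAxis_one_div f k hN hx, Function.comp_apply, ofReal_mul, ofReal_natCast, ← mul_assoc I,
        mul_zpow (I * N : ℂ)]
      linear_combination (-(f ∣[k] ModularGroup.S) (ofComplex (I * N * x)) * (I * N : ℂ) ^ k) * hxk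
    · filter_upwards [eventually_gt_atTop 0] with y hy
      have him : 0 < (I * ((N * y : ℝ) : ℂ)).im := by
        rw [I_mul_im, ofReal_re]; positivity
      simp only [Function.comp_apply, ofComplex_apply_of_im_pos him, ← coe_im]
      congr 1
      rw [I_mul_im, ofReal_re]
      field_simp

end IsModularForm

/-! ### Multiple exponential sums -/

/-- Polynomial growth of a sequence of coefficients. -/
def PolyGrowth (a : ℕ → ℂ) : Prop :=
  ∃ (C : ℝ) (K : ℕ), 0 ≤ C ∧ ∀ m : ℕ, 0 < m → ‖a m‖ ≤ C * (m : ℝ) ^ K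

/-- `m₁ + ⋯ + m_l`. -/
def msum {l : ℕ} (m : Fin l → ℕ+) : ℕ := ∑ r, (m r : ℕ)

/-- The function
`(-2πi)^{-(t₁+⋯+t_l)} ∑ a_{m₁} ⋯ a_{m_l} q^{m₁+⋯+m_l} / ((m₁+⋯+m_l)^{t₁} ⋯ m_l^{t_l})` of `y`,
where `q = exp (-2πy)`. -/
def expSum (l : ℕ) (a : ℕ → ℕ → ℂ) (t : ℕ → ℂ) (y : ℝ) : ℂ :=
  (-2 * (Real.pi : ℂ) * I) ^ (-∑ i ∈ Finset.Icc 1 l, t i) *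
    ∑' m : Fin l → ℕ+, multLTerm l a t m * (Real.exp (-(2 * Real.pi * msum m) * y) : ℂ)

lemma le_msum {l : ℕ} (m : Fin l → ℕ+) (i : Fin l) : (m i : ℕ) ≤ msum m :=
  Finset.single_le_sum (f := fun r => (m r : ℕ)) (fun _ _ => Nat.zero_le _) (Finset.mem_univ i)

lemma msum_pos {l : ℕ} (hl : 0 < l) (m : Fin l → ℕ+) : 0 < msum m :=
  (m ⟨0, hl⟩).pos.trans_le (le_msum m _)

lemma summable_prod_inv_sq (l : ℕ) :
    Summable fun m : Fin l → ℕ+ => ∏ i, (((m i : ℕ) : ℝ) ^ 2)⁻¹ := by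
  induction l with
  | zero => exact Summable.of_finite
  | succ l ih =>
    have h1 : Summable fun m : ℕ+ => (((m : ℕ) : ℝ) ^ 2)⁻¹ :=
      (Real.summable_nat_pow_inv.mpr one_lt_two).comp_injective PNat.coe_injective
    have h2 := h1.mul_of_nonneg ih (fun _ => by positivity)
      (fun _ => Finset.prod_nonneg fun _ _ => by positivity)
    rw [← (Fin.consEquiv fun _ : Fin (l + 1) => ℕ+).summable_iff]
    refine h2.congr fun p => ?_
    simp [Fin.consEquiv, Fin.prod_univ_succ, mul_comm]

lemma summable_inv_msum_pow (l : ℕ) :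
    Summable fun m : Fin l → ℕ+ => ((msum m : ℝ) ^ (2 * l))⁻¹ := by
  refine (summable_prod_inv_sq l).of_nonneg_of_le (fun _ => by positivity) fun m => ?_
  rw [Finset.prod_inv_distrib]
  refine inv_anti₀ (Finset.prod_pos fun i _ => by have := (m i).pos; positivity) ?_
  rw [pow_mul]
  calc ∏ i, ((m i : ℕ) : ℝ) ^ 2 ≤ ∏ _i : Fin l, (msum m : ℝ) ^ 2 :=
        Finset.prod_le_prod (fun _ _ => by positivity) fun i _ => by
          have : ((m i : ℕ) : ℝ) ≤ msum m := by exact_mod_cast le_msum m i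
          gcongr
    _ = _ := by simp

/-- All partial sums in the denominators lie between `1` and `msum m`, so each factor is bounded by
a power of `msum m`, whatever the signs of the real parts of the arguments. -/
lemma exists_norm_multLTerm_le {l : ℕ} {a : ℕ → ℕ → ℂ} (ha : ∀ i : Fin l, PolyGrowth (a (i + 1)))
    (t : ℕ → ℂ) :
    ∃ (C : ℝ) (κ : ℕ), 0 ≤ C ∧ ∀ m : Fin l → ℕ+, ‖multLTerm l a t m‖ ≤ C * (msum m : ℝ) ^ κ := by
  choose C K hC hK using ha
  let e : Fin l → ℕ := fun i => K i + ⌈|(t (i + 1)).re|⌉₊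
  refine ⟨∏ i, C i, ∑ i, e i, Finset.prod_nonneg fun i _ => hC i, fun m => ?_⟩
  rw [multLTerm, norm_prod, ← Finset.prod_pow_eq_pow_sum, ← Finset.prod_mul_distrib]
  refine Finset.prod_le_prod (fun _ _ => norm_nonneg _) fun i _ => ?_
  set S : ℕ := ∑ r ∈ Finset.Ici i, (m r : ℕ) with hS
  have hS1 : 1 ≤ S := (m i).pos.trans_le
    (Finset.single_le_sum (f := fun r => (m r : ℕ)) (fun _ _ => Nat.zero_le _) (by simp))
  have hS2 : S ≤ msum m := Finset.sum_le_sum_of_subset (Finset.subset_univ _)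
  have hSr : (1 : ℝ) ≤ S := by exact_mod_cast hS1
  have hMr : (S : ℝ) ≤ msum m := by exact_mod_cast hS2
  have hM1 : (1 : ℝ) ≤ msum m := hSr.trans hMr
  have hcast : (∑ r ∈ Finset.Ici i, ((m r : ℕ) : ℂ)) = ((S : ℝ) : ℂ) := by
    rw [hS]; push_cast; rfl
  have hmi : ((m i : ℕ) : ℝ) ≤ msum m := by exact_mod_cast le_msum m i
  rw [hcast, norm_div, Complex.norm_cpow_eq_rpow_re_of_pos (by linarith), pow_add, ← mul_assoc,
    div_eq_mul_inv]
  refine mul_le_mul ((hK i _ (m i).pos).trans ?_) ?_ (by positivity)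
    (mul_nonneg (hC i) (by positivity))
  · have := hC i
    gcongr
  · rw [← Real.rpow_neg (by linarith), ← Real.rpow_natCast]
    calc (S : ℝ) ^ (-(t (i + 1)).re) ≤ (S : ℝ) ^ |(t (i + 1)).re| :=
          Real.rpow_le_rpow_of_exponent_le hSr (neg_le_abs _)
      _ ≤ (msum m : ℝ) ^ |(t (i + 1)).re| :=
          Real.rpow_le_rpow (by linarith) hMr (abs_nonneg _)
      _ ≤ _ := Real.rpow_le_rpow_of_exponent_le hM1 (Nat.le_ceil _)

/-- Half of the exponent absorbs `M^n` through `x^n / n! ≤ exp x`; the other half is kept as decay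
in `y`, since `M ≥ 1`. -/
lemma pow_mul_exp_neg_le (n : ℕ) {M y : ℝ} (hM : 1 ≤ M) (hy : 0 < y) :
    M ^ n * Real.exp (-(2 * Real.pi * M) * y) ≤
      n.factorial * (y ^ n)⁻¹ * Real.exp (-Real.pi * y) := by
  have hpi := Real.pi_gt_three
  have h1 := Real.pow_div_factorial_le_exp (Real.pi * M * y) (by positivity) n
  have h2 : M ^ n * y ^ n ≤ n.factorial * Real.exp (Real.pi * M * y) := by
    rw [div_le_iff₀ (by positivity)] at h1
    refine le_trans ?_ (h1.trans (by rw [mul_comm]))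
    rw [← mul_pow]
    refine pow_le_pow_left₀ (by positivity) ?_ n
    have : 0 < M * y := by positivity
    nlinarith
  have h3 : Real.exp (-(2 * Real.pi * M) * y) =
      (Real.exp (Real.pi * M * y))⁻¹ * Real.exp (-(Real.pi * M) * y) := by
    rw [← Real.exp_neg, ← Real.exp_add]; ring_nf
  have h4 : Real.exp (-(Real.pi * M) * y) ≤ Real.exp (-Real.pi * y) := by
    apply Real.exp_le_exp.mpr
    have : Real.pi * y ≤ Real.pi * M * y := by
      have : 0 < Real.pi * y := by positivity
      nlinarith
    linarith
  rw [h3, ← mul_assoc]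
  refine mul_le_mul ?_ h4 (by positivity) (by positivity)
  rw [← div_eq_mul_inv, ← div_eq_mul_inv, div_le_div_iff₀ (by positivity) (by positivity)]
  exact h2

section

variable {l : ℕ} {a : ℕ → ℕ → ℂ}

/-- The terms of the multiple exponential sums are dominated by a convergent series, with
constants that grow at most polynomially in `1 / y`. -/
lemma exists_norm_multLTerm_mul_exp_le (hl : 0 < l) (ha : ∀ i : Fin l, PolyGrowth (a (i + 1)))
    (t : ℕ → ℂ) : ∃ (C : ℝ) (n : ℕ), 0 ≤ C ∧ ∀ (y : ℝ), 0 < y → ∀ m : Fin l → ℕ+,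
      ‖multLTerm l a t m * (Real.exp (-(2 * Real.pi * msum m) * y) : ℂ)‖ ≤
        C * (y ^ n)⁻¹ * Real.exp (-Real.pi * y) * ((msum m : ℝ) ^ (2 * l))⁻¹ := by
  obtain ⟨C, κ, hC, h⟩ := exists_norm_multLTerm_le ha t
  refine ⟨C * (κ + 2 * l).factorial, κ + 2 * l, by positivity, fun y hy m => ?_⟩
  have hM : (1 : ℝ) ≤ msum m := by exact_mod_cast msum_pos hl m
  have hM0 : (0 : ℝ) < msum m := by linarith
  rw [norm_mul, Complex.norm_real, Real.norm_of_nonneg (Real.exp_pos _).le]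
  have h1 := pow_mul_exp_neg_le (κ + 2 * l) hM hy
  calc _ ≤ C * (msum m : ℝ) ^ κ * Real.exp (-(2 * Real.pi * msum m) * y) := by
        gcongr; exact h m
    _ = C * ((msum m : ℝ) ^ (κ + 2 * l) * Real.exp (-(2 * Real.pi * msum m) * y)) *
          ((msum m : ℝ) ^ (2 * l))⁻¹ := by
        rw [pow_add]; field_simp
    _ ≤ C * ((κ + 2 * l).factorial * (y ^ (κ + 2 * l))⁻¹ * Real.exp (-Real.pi * y)) *
          ((msum m : ℝ) ^ (2 * l))⁻¹ := by gcongr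
    _ = _ := by ring

lemma summable_multLTerm_mul_exp (hl : 0 < l) (ha : ∀ i : Fin l, PolyGrowth (a (i + 1)))
    (t : ℕ → ℂ) {y : ℝ} (hy : 0 < y) :
    Summable fun m : Fin l → ℕ+ =>
      multLTerm l a t m * (Real.exp (-(2 * Real.pi * msum m) * y) : ℂ) := by
  obtain ⟨C, n, hC, h⟩ := exists_norm_multLTerm_mul_exp_le hl ha t
  exact Summable.of_norm_bounded ((summable_inv_msum_pow l).mul_left _) (h y hy)

lemma exists_norm_expSum_le (hl : 0 < l) (ha : ∀ i : Fin l, PolyGrowth (a (i + 1)))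
    (t : ℕ → ℂ) : ∃ (C : ℝ) (n : ℕ), 0 ≤ C ∧ ∀ (y : ℝ), 0 < y →
      ‖expSum l a t y‖ ≤ C * (y ^ n)⁻¹ * Real.exp (-Real.pi * y) := by
  obtain ⟨C, n, hC, h⟩ := exists_norm_multLTerm_mul_exp_le hl ha t
  refine ⟨‖(-2 * (Real.pi : ℂ) * I) ^ (-∑ i ∈ Finset.Icc 1 l, t i)‖ *
    (C * ∑' m : Fin l → ℕ+, ((msum m : ℝ) ^ (2 * l))⁻¹), n, by positivity, fun y hy => ?_⟩
  have h1 := tsum_of_norm_bounded ((summable_inv_msum_pow l).mul_left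
    (C * (y ^ n)⁻¹ * Real.exp (-Real.pi * y))).hasSum (h y hy)
  rw [tsum_mul_left] at h1
  rw [expSum, norm_mul]
  calc _ ≤ ‖(-2 * (Real.pi : ℂ) * I) ^ (-∑ i ∈ Finset.Icc 1 l, t i)‖ *
        (C * (y ^ n)⁻¹ * Real.exp (-Real.pi * y) *
          ∑' m : Fin l → ℕ+, ((msum m : ℝ) ^ (2 * l))⁻¹) := by gcongr
    _ = _ := by ring

lemma consArg_one (z : ℂ) (β : ℕ → ℂ) : consArg z β 1 = z := by simp [consArg]

lemma consArg_of_ne (z : ℂ) (β : ℕ → ℂ) {i : ℕ} (hi : i ≠ 1) : consArg z β i = β i := by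
  simp [consArg, hi]

lemma sum_consArg (hl : 0 < l) (z : ℂ) (t : ℕ → ℂ) :
    ∑ i ∈ Finset.Icc 1 l, consArg (t 1 + z) t i = ∑ i ∈ Finset.Icc 1 l, t i + z := by
  rw [← Finset.insert_Icc_add_one_left_eq_Icc (show 1 ≤ l from hl), Finset.sum_insert (by simp),
    Finset.sum_insert (by simp), consArg_one]
  rw [Finset.sum_congr rfl fun i hi => consArg_of_ne _ _ (by
    have := (Finset.mem_Icc.mp hi).1; omega)]
  ring

/-- The first partial sum is the full sum `msum m`, which is also the frequency of the exponential.
Hence differentiation in `y` and Mellin transforms act on the first argument alone. -/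
lemma multLTerm_consArg (hl : 0 < l) (z : ℂ) (t : ℕ → ℂ) (m : Fin l → ℕ+) :
    multLTerm l a (consArg (t 1 + z) t) m = multLTerm l a t m * (msum m : ℂ) ^ (-z) := by
  obtain ⟨l, rfl⟩ := Nat.exists_eq_succ_of_ne_zero hl.ne'
  have hne : (msum m : ℂ) ≠ 0 := by exact_mod_cast (msum_pos hl m).ne'
  have h0 : (∑ r ∈ Finset.Ici (0 : Fin (l + 1)), ((m r : ℕ) : ℂ)) = msum m := by
    rw [show Finset.Ici (0 : Fin (l + 1)) = Finset.univ from by ext; simp, msum]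
    push_cast; rfl
  rw [multLTerm, multLTerm, Fin.prod_univ_succ, Fin.prod_univ_succ]
  simp only [Nat.succ_eq_add_one, Fin.val_zero, zero_add, consArg_one, Fin.val_succ]
  rw [h0, cpow_add _ _ hne, cpow_neg]
  rw [Finset.prod_congr rfl fun (i : Fin l) _ => by
    rw [consArg_of_ne _ t (show (i : ℕ) + 1 + 1 ≠ 1 by omega)]]
  ring

lemma neg_two_pi_I_ne_zero : (-2 * (Real.pi : ℂ) * I) ≠ 0 := by
  simp [Real.pi_ne_zero]

/-- `d/dy = -i d/d(-2πM)` lowers the first argument by one. -/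
lemma hasDerivAt_expSum (hl : 0 < l) (ha : ∀ i : Fin l, PolyGrowth (a (i + 1))) (t : ℕ → ℂ)
    {y : ℝ} (hy : 0 < y) :
    HasDerivAt (expSum l a t) (-I * expSum l a (consArg (t 1 - 1) t) y) y := by
  obtain ⟨C, n, hC, h⟩ := exists_norm_multLTerm_mul_exp_le hl ha (consArg (t 1 - 1) t)
  have hM : ∀ m : Fin l → ℕ+, multLTerm l a (consArg (t 1 - 1) t) m =
      multLTerm l a t m * msum m := fun m => by
    rw [sub_eq_add_neg, multLTerm_consArg hl, neg_neg, cpow_one]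
  have key := hasDerivAt_tsum_of_isPreconnected
    (g := fun (m : Fin l → ℕ+) (x : ℝ) =>
      multLTerm l a t m * (Real.exp (-(2 * Real.pi * msum m) * x) : ℂ))
    (g' := fun (m : Fin l → ℕ+) (x : ℝ) => (-(2 * Real.pi : ℂ)) *
      (multLTerm l a (consArg (t 1 - 1) t) m * (Real.exp (-(2 * Real.pi * msum m) * x) : ℂ)))
    (u := fun m => 2 * Real.pi * (C * ((y / 2) ^ n)⁻¹ * ((msum m : ℝ) ^ (2 * l))⁻¹))
    (t := Ioi (y / 2)) (y₀ := y) (y := y)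
    (((summable_inv_msum_pow l).mul_left _).mul_left _) isOpen_Ioi isPreconnected_Ioi
    (fun m x _ => ?_) (fun m x hx => ?_) (by simpa using hy)
    (summable_multLTerm_mul_exp hl ha t hy) (by simpa using hy)
  · have := key.const_mul ((-2 * (Real.pi : ℂ) * I) ^ (-∑ i ∈ Finset.Icc 1 l, t i))
    refine HasDerivAt.congr_deriv this ?_
    -- Each term brings down `-2πM = -I · (-2πI) · M`; the factor `-2πI` is absorbed by the
    -- normalising power in front of the sum.
    rw [expSum, tsum_mul_left, sub_eq_add_neg (t 1), sum_consArg hl, neg_add, neg_neg,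
      cpow_add _ _ neg_two_pi_I_ne_zero, cpow_one]
    linear_combination (2 * Real.pi * (-2 * (Real.pi : ℂ) * I) ^ (-∑ i ∈ Finset.Icc 1 l, t i) *
      -(∑' m : Fin l → ℕ+, multLTerm l a (consArg (t 1 + -1) t) m *
        (Real.exp (-(2 * Real.pi * msum m) * y) : ℂ))) * I_mul_I
  · have h1 : HasDerivAt (fun x : ℝ => Real.exp (-(2 * Real.pi * msum m) * x))
        (Real.exp (-(2 * Real.pi * msum m) * x) * (-(2 * Real.pi * msum m) * 1)) x :=
      ((hasDerivAt_id x).const_mul _).exp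
    refine HasDerivAt.congr_deriv (h1.ofReal_comp.const_mul _) ?_
    rw [hM]
    push_cast
    ring
  · have hx0 : 0 < x := by have := mem_Ioi.mp hx; linarith
    rw [norm_mul, norm_neg, norm_mul, Complex.norm_real, Real.norm_of_nonneg Real.pi_pos.le,
      Complex.norm_ofNat]
    refine mul_le_mul_of_nonneg_left ((h x hx0 m).trans ?_) (by positivity)
    have h1 : Real.exp (-Real.pi * x) ≤ 1 := by
      apply Real.exp_le_one_iff.mpr
      have := Real.pi_pos
      nlinarith
    have h2 : (x ^ n)⁻¹ ≤ ((y / 2) ^ n)⁻¹ := by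
      apply inv_anti₀ (by positivity)
      have := mem_Ioi.mp hx
      gcongr
    calc C * (x ^ n)⁻¹ * Real.exp (-Real.pi * x) * ((msum m : ℝ) ^ (2 * l))⁻¹
        ≤ C * ((y / 2) ^ n)⁻¹ * 1 * ((msum m : ℝ) ^ (2 * l))⁻¹ := by gcongr
      _ = _ := by ring

lemma continuousOn_expSum (hl : 0 < l) (ha : ∀ i : Fin l, PolyGrowth (a (i + 1))) (t : ℕ → ℂ) :
    ContinuousOn (expSum l a t) (Ioi 0) := fun _ hy =>
  (hasDerivAt_expSum hl ha t hy).continuousAt.continuousWithinAt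

lemma expSum_congr {a' : ℕ → ℕ → ℂ} {t t' : ℕ → ℂ} (ha : ∀ i : Fin l, a (i + 1) = a' (i + 1))
    (ht : ∀ i : Fin l, t (i + 1) = t' (i + 1)) : expSum l a t = expSum l a' t' := by
  have h1 : ∑ i ∈ Finset.Icc 1 l, t i = ∑ i ∈ Finset.Icc 1 l, t' i :=
    Finset.sum_congr rfl fun i hi => by
      have := Finset.mem_Icc.mp hi
      have := ht ⟨i - 1, by omega⟩
      simpa [Nat.sub_add_cancel ‹1 ≤ i ∧ i ≤ l›.1] using this
  ext y
  simp only [expSum, multLTerm, h1, ha, ht]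

lemma multLSeries_congr {a' : ℕ → ℕ → ℂ} {t t' : ℕ → ℂ} (ha : ∀ i : Fin l, a (i + 1) = a' (i + 1))
    (ht : ∀ i : Fin l, t (i + 1) = t' (i + 1)) : multLSeries l a t = multLSeries l a' t' := by
  have h1 : ∑ i ∈ Finset.Icc 1 l, t i = ∑ i ∈ Finset.Icc 1 l, t' i :=
    Finset.sum_congr rfl fun i hi => by
      have := Finset.mem_Icc.mp hi
      have := ht ⟨i - 1, by omega⟩
      simpa [Nat.sub_add_cancel ‹1 ≤ i ∧ i ≤ l›.1] using this
  simp only [multLSeries, multLTerm, h1, ha, ht]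

lemma expSum_zero (a : ℕ → ℕ → ℂ) (t : ℕ → ℂ) (y : ℝ) : expSum 0 a t y = 1 := by
  simp [expSum, multLTerm, msum]

lemma multLTerm_cons (t : ℕ → ℂ) (m₀ : ℕ+) (m : Fin l → ℕ+) :
    multLTerm (l + 1) a t (Fin.cons m₀ m) = a 1 m₀ / ((m₀ + msum m : ℕ) : ℂ) ^ t 1 *
      multLTerm l (fun i => a (i + 1)) (fun i => t (i + 1)) m := by
  rw [multLTerm, Fin.prod_univ_succ, multLTerm]
  congr 1
  · rw [show Finset.Ici (0 : Fin (l + 1)) = Finset.univ from by ext; simp, Fin.sum_univ_succ, msum]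
    push_cast
    simp
  · refine Finset.prod_congr rfl fun i _ => ?_
    have h1 : ∑ r ∈ Finset.Ici i.succ, ((Fin.cons (α := fun _ => ℕ+) m₀ m r : ℕ) : ℂ) =
        ∑ r ∈ Finset.Ici i, ((m r : ℕ) : ℂ) := by
      rw [← Fin.map_succEmb_Ici, Finset.sum_map]
      simp
    rw [h1]
    simp

lemma msum_cons (m₀ : ℕ+) (m : Fin l → ℕ+) :
    msum (Fin.cons (α := fun _ => ℕ+) m₀ m) = m₀ + msum m := by
  simp [msum, Fin.sum_univ_succ]

lemma hasSum_pnat {b : ℕ → ℂ} {y : ℝ} {F : ℂ}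
    (h : HasSum (fun m : ℕ => b m * (Real.exp (-(2 * Real.pi * m * y)) : ℂ)) F) :
    HasSum (fun m : ℕ+ => b m * (Real.exp (-(2 * Real.pi * (m : ℕ)) * y) : ℂ)) (F - b 0) := by
  have h1 := (hasSum_nat_add_iff' 1).mpr h
  rw [← Equiv.pnatEquivNat.hasSum_iff] at h1
  have e : (fun m : ℕ+ => b m * (Real.exp (-(2 * Real.pi * (m : ℕ)) * y) : ℂ)) =
      (fun n : ℕ => b (n + 1) * (Real.exp (-(2 * Real.pi * (n + 1 : ℕ) * y)) : ℂ)) ∘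
        Equiv.pnatEquivNat := by
    funext m
    rw [Function.comp_apply, Equiv.pnatEquivNat_apply, PNat.natPred_add_one, neg_mul]
  have e2 : F - b 0 =
      F - ∑ i ∈ Finset.range 1, b i * (Real.exp (-(2 * Real.pi * i * y)) : ℂ) := by simp
  rw [e, e2]
  exact h1

/-- A multiple exponential sum with vanishing first argument is a product. -/
lemma expSum_succ (ha : ∀ i : Fin (l + 1), PolyGrowth (a (i + 1))) (t : ℕ → ℂ) (ht : t 1 = 0)
    {y : ℝ} (hy : 0 < y) {F : ℂ}
    (hF : HasSum (fun m : ℕ => a 1 m * (Real.exp (-(2 * Real.pi * m * y)) : ℂ)) F) :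
    expSum (l + 1) a t y =
      (F - a 1 0) * expSum l (fun i => a (i + 1)) (fun i => t (i + 1)) y := by
  have hs : ∑ i ∈ Finset.Icc 1 (l + 1), t i = ∑ i ∈ Finset.Icc 1 l, t (i + 1) := by
    rw [← Finset.insert_Icc_add_one_left_eq_Icc (show 1 ≤ l + 1 by omega),
      Finset.sum_insert (by simp), ht, zero_add, ← Finset.image_add_right_Icc,
      Finset.sum_image (by simp)]
  have hA := hasSum_pnat hF
  have hB : Summable fun m : Fin l → ℕ+ => multLTerm l (fun i => a (i + 1)) (fun i => t (i + 1)) m *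
      (Real.exp (-(2 * Real.pi * msum m) * y) : ℂ) := by
    rcases Nat.eq_zero_or_pos l with rfl | hl
    · exact Summable.of_finite
    · exact summable_multLTerm_mul_exp hl (fun i => by simpa using ha i.succ) _ hy
  -- Since `t 1 = 0`, the only denominator coupling the first variable to the others is gone, and
  -- the exponential of a sum factors: a product of two absolutely convergent series.
  rw [expSum, expSum, hs, mul_left_comm, ← hA.tsum_eq,
    tsum_mul_tsum_of_summable_norm hA.summable.norm hB.norm,
    ← (Fin.consEquiv fun _ : Fin (l + 1) => ℕ+).tsum_eq]
  congr 1
  refine tsum_congr fun p => ?_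
  simp only [Fin.consEquiv, Equiv.coe_fn_mk]
  rw [multLTerm_cons, msum_cons, ht, cpow_zero, div_one]
  have : Real.exp (-(2 * Real.pi * ((p.1 : ℕ) + msum p.2 : ℕ)) * y) =
      Real.exp (-(2 * Real.pi * (p.1 : ℕ)) * y) * Real.exp (-(2 * Real.pi * msum p.2) * y) := by
    rw [← Real.exp_add]; push_cast; ring_nf
  rw [this]
  push_cast
  ring

/-! ### Mellin transforms of multiple exponential sums -/

/-- A check on principal branches: positive factors may be split off, and `log (-I) = -log I` gives
`(-I)^(-s) = I^s`. This reconciles the powers of `z = iy` with the powers of `-2πi` in the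
definition of the `L`-series. -/
lemma I_cpow_div (s : ℂ) {M : ℝ} (hM : 0 < M) :
    I ^ s / ((2 * Real.pi * M : ℝ) : ℂ) ^ s = (-2 * (Real.pi : ℂ) * I) ^ (-s) * (M : ℂ) ^ (-s) := by
  have hpi := Real.pi_pos
  have h1 : (-2 * (Real.pi : ℂ) * I) = ((2 * Real.pi : ℝ) : ℂ) * (-I) := by push_cast; ring
  have h2 : (-I : ℂ) ^ (-s) = I ^ s := by
    rw [cpow_def_of_ne_zero (neg_ne_zero.mpr I_ne_zero), cpow_def_of_ne_zero I_ne_zero, log_neg_I,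
      log_I]
    congr 1
    ring
  have h3 : (((2 * Real.pi : ℝ) : ℂ) * (-I)) ^ (-s) = ((2 * Real.pi : ℝ) : ℂ) ^ (-s) * I ^ s := by
    have hp : ((2 * Real.pi : ℝ) : ℂ) ≠ 0 := by
      rw [Ne, ofReal_eq_zero]; positivity
    rw [← h2, cpow_def_of_ne_zero (mul_ne_zero hp (neg_ne_zero.mpr I_ne_zero)),
      log_ofReal_mul (by positivity) (neg_ne_zero.mpr I_ne_zero), cpow_def_of_ne_zero hp,
      cpow_def_of_ne_zero (neg_ne_zero.mpr I_ne_zero), ← Complex.exp_add, ofReal_log (by positivity),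
      add_mul]
  rw [h1, h3, ofReal_mul (2 * Real.pi), mul_cpow_ofReal_nonneg (by positivity) hM.le, cpow_neg,
    cpow_neg, div_eq_mul_inv, mul_inv]
  ring

lemma exists_summable_multLTerm (hl : 0 < l) (ha : ∀ i : Fin l, PolyGrowth (a (i + 1)))
    (t : ℕ → ℂ) : ∃ σ : ℝ, ∀ z : ℂ, σ < z.re →
      Summable (multLTerm l a (consArg (t 1 + z) t)) := by
  obtain ⟨C, κ, hC, h⟩ := exists_norm_multLTerm_le ha t
  refine ⟨κ + 2 * l, fun z hz => ?_⟩
  refine Summable.of_norm_bounded ((summable_inv_msum_pow l).mul_left C) fun m => ?_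
  have hM : (1 : ℝ) ≤ msum m := by exact_mod_cast msum_pos hl m
  have hM0 : (0 : ℝ) < msum m := by linarith
  rw [multLTerm_consArg hl, norm_mul, ← ofReal_natCast, norm_cpow_eq_rpow_re_of_pos hM0, neg_re]
  have h1 : (msum m : ℝ) ^ (-z.re) ≤ ((msum m : ℝ) ^ κ)⁻¹ * ((msum m : ℝ) ^ (2 * l))⁻¹ := by
    rw [← mul_inv, ← pow_add, ← Real.rpow_natCast, ← Real.rpow_neg hM0.le]
    refine Real.rpow_le_rpow_of_exponent_le hM ?_
    push_cast
    linarith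
  calc _ ≤ C * (msum m : ℝ) ^ κ * (((msum m : ℝ) ^ κ)⁻¹ * ((msum m : ℝ) ^ (2 * l))⁻¹) := by
        gcongr; exact h m
    _ = _ := by field_simp

/-- The Mellin transform of a multiple exponential sum is a multiple `L`-series. -/
lemma exists_mellin_expSum (hl : 0 < l) (ha : ∀ i : Fin l, PolyGrowth (a (i + 1)))
    (t : ℕ → ℂ) : ∃ σ : ℝ, ∀ s : ℂ, σ < s.re →
      Summable (multLTerm l a (consArg (t 1 + s) t)) ∧ MellinConvergent (expSum l a t) s ∧
      I ^ s * mellin (expSum l a t) s = Gamma s * multLSeries l a (consArg (t 1 + s) t) := by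
  obtain ⟨σ, hσ⟩ := exists_summable_multLTerm hl ha t
  obtain ⟨C, n, hC, hb⟩ := exists_norm_expSum_le hl ha t
  refine ⟨max σ n, fun s hs => ?_⟩
  have hs1 : σ < s.re := (le_max_left _ _).trans_lt hs
  have hs2 : (n : ℝ) < s.re := (le_max_right _ _).trans_lt hs
  have hs0 : 0 < s.re := (Nat.cast_nonneg n).trans_lt hs2
  refine ⟨hσ s hs1, ?_, ?_⟩
  · refine mellinConvergent_of_isBigO_rpow_exp (a := Real.pi) (b := n) Real.pi_pos
      ((continuousOn_expSum hl ha t).locallyIntegrableOn measurableSet_Ioi) ?_ ?_ hs2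
    · refine IsBigO.of_bound C ?_
      filter_upwards [eventually_ge_atTop 1] with y hy
      refine (hb y (by linarith)).trans ?_
      rw [Real.norm_of_nonneg (Real.exp_pos _).le]
      have : (y ^ n)⁻¹ ≤ 1 := inv_le_one_of_one_le₀ (one_le_pow₀ hy)
      gcongr
      exact mul_le_of_le_one_right hC this
    · refine IsBigO.of_bound C ?_
      filter_upwards [self_mem_nhdsWithin] with y hy
      have hy0 : 0 < y := hy
      refine (hb y hy).trans ?_
      rw [Real.rpow_neg hy0.le, Real.rpow_natCast, Real.norm_of_nonneg (by positivity)]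
      refine mul_le_of_le_one_right (by positivity) (Real.exp_le_one_iff.mpr ?_)
      have := Real.pi_pos
      nlinarith
  · have hsum := hσ s hs1
    set c := (-2 * (Real.pi : ℂ) * I) ^ (-∑ i ∈ Finset.Icc 1 l, t i) with hc
    have key := hasSum_mellin (a := fun m : Fin l → ℕ+ => c * multLTerm l a t m)
      (p := fun m => 2 * Real.pi * msum m) (F := expSum l a t) (s := s)
      (fun m => Or.inr (by have := msum_pos hl m; positivity)) hs0 (fun y hy => ?_) ?_
    · have h1 : ∀ m : Fin l → ℕ+, I ^ s * (Gamma s * (c * multLTerm l a t m) /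
          ((2 * Real.pi * msum m : ℝ) : ℂ) ^ s) = Gamma s * (c * (-2 * (Real.pi : ℂ) * I) ^ (-s) *
            multLTerm l a (consArg (t 1 + s) t) m) := fun m => by
        have hM0 : (0 : ℝ) < msum m := by exact_mod_cast msum_pos hl m
        rw [multLTerm_consArg hl]
        have := I_cpow_div s hM0
        rw [ofReal_natCast] at this
        linear_combination (Gamma s * (c * multLTerm l a t m)) * this
      rw [← key.tsum_eq, ← tsum_mul_left, tsum_congr h1, tsum_mul_left, tsum_mul_left, multLSeries,
        sum_consArg hl, neg_add, cpow_add _ _ neg_two_pi_I_ne_zero]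
    · have := (summable_multLTerm_mul_exp hl ha t hy).hasSum.mul_left c
      simpa only [expSum, ← mul_assoc] using this
    · refine (hsum.norm.mul_left (‖c‖ * (2 * Real.pi) ^ (-s.re))).congr fun m => ?_
      have hM0 : (0 : ℝ) < msum m := by exact_mod_cast msum_pos hl m
      rw [multLTerm_consArg hl, norm_mul, norm_mul, ← ofReal_natCast,
        norm_cpow_eq_rpow_re_of_pos hM0, neg_re, div_eq_mul_inv,
        Real.mul_rpow (by positivity) hM0.le, mul_inv, Real.rpow_neg hM0.le,
        Real.rpow_neg (by positivity)]
      ring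

end

/-! ### Functions with logarithmic Laurent expansions and their Mellin transforms -/

/-- The span of the functions `x ↦ x ^ a * (log x) ^ b`. -/
def logPoly : Submodule ℂ (ℝ → ℂ) :=
  Submodule.span ℂ (range fun p : ℤ × ℕ => fun x : ℝ => (x : ℂ) ^ p.1 * (Real.log x : ℂ) ^ p.2)

/-- Functions that differ from an element of `logPoly` by an exponentially decreasing function. -/
def IsLogExp (φ : ℝ → ℂ) : Prop :=
  ∃ p ∈ logPoly, ∃ δ > 0, (fun x => φ x - p x) =O[atTop] fun x => Real.exp (-δ * x)

lemma zpow_mul_log_pow_mem (a : ℤ) (b : ℕ) :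
    (fun x : ℝ => (x : ℂ) ^ a * (Real.log x : ℂ) ^ b) ∈ logPoly :=
  Submodule.subset_span ⟨(a, b), rfl⟩

lemma const_mem_logPoly (c : ℂ) : (fun _ : ℝ => c) ∈ logPoly := by
  convert logPoly.smul_mem c (zpow_mul_log_pow_mem 0 0) using 1
  ext x
  simp

/-- The product is matched only for `0 < x`, because addition of integer exponents can fail at `0`.
Nothing is lost, as only the behaviour at infinity matters. -/
lemma logPoly_exists_mul {p q : ℝ → ℂ} (hp : p ∈ logPoly) (hq : q ∈ logPoly) :
    ∃ r ∈ logPoly, ∀ x : ℝ, 0 < x → r x = p x * q x := by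
  induction hp using Submodule.span_induction with
  | mem p hp =>
    obtain ⟨⟨a, b⟩, rfl⟩ := hp
    induction hq using Submodule.span_induction with
    | mem q hq =>
      obtain ⟨⟨c, d⟩, rfl⟩ := hq
      refine ⟨_, zpow_mul_log_pow_mem (a + c) (b + d), fun x hx => ?_⟩
      simp only
      rw [zpow_add₀ (by exact_mod_cast hx.ne'), pow_add]
      ring
    | zero => exact ⟨0, logPoly.zero_mem, by simp⟩
    | add q q' _ _ h h' =>
      obtain ⟨r, hr, e⟩ := h
      obtain ⟨r', hr', e'⟩ := h'
      exact ⟨r + r', logPoly.add_mem hr hr', fun x hx => by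
        simp only [Pi.add_apply, e x hx, e' x hx]; ring⟩
    | smul c q _ h =>
      obtain ⟨r, hr, e⟩ := h
      exact ⟨c • r, logPoly.smul_mem c hr, fun x hx => by
        simp only [Pi.smul_apply, smul_eq_mul, e x hx]; ring⟩
  | zero => exact ⟨0, logPoly.zero_mem, by simp⟩
  | add p p' _ _ h h' =>
    obtain ⟨r, hr, e⟩ := h
    obtain ⟨r', hr', e'⟩ := h'
    exact ⟨r + r', logPoly.add_mem hr hr', fun x hx => by
      simp only [Pi.add_apply, e x hx, e' x hx]; ring⟩
  | smul c p _ h =>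
    obtain ⟨r, hr, e⟩ := h
    exact ⟨c • r, logPoly.smul_mem c hr, fun x hx => by
      simp only [Pi.smul_apply, smul_eq_mul, e x hx]; ring⟩

lemma zpow_isBigO_exp (a : ℤ) {δ : ℝ} (hδ : 0 < δ) :
    (fun x : ℝ => (x : ℂ) ^ a) =O[atTop] fun x => Real.exp (δ * x) := by
  refine (isLittleO_zpow_exp_pos_mul_atTop a hδ).isBigO.norm_left.congr_left ?_ |>.of_norm_left
  intro x
  simp

lemma logPoly_isBigO_exp {p : ℝ → ℂ} (hp : p ∈ logPoly) {δ : ℝ} (hδ : 0 < δ) :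
    p =O[atTop] fun x => Real.exp (δ * x) := by
  induction hp using Submodule.span_induction with
  | mem p hp =>
    obtain ⟨⟨a, b⟩, rfl⟩ := hp
    have h2 : (fun x : ℝ => (Real.log x : ℂ) ^ b) =O[atTop] fun x : ℝ => (x : ℂ) ^ (1 : ℤ) := by
      refine IsBigO.of_norm_norm ?_
      refine (Real.isLittleO_pow_log_id_atTop (n := b)).isBigO.norm_norm.congr ?_ ?_ <;>
        · intro x; simp
    refine (((isBigO_refl _ _).mul h2).trans ?_)
    refine (zpow_isBigO_exp (a + 1) hδ).congr' ?_ EventuallyEq.rfl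
    filter_upwards [eventually_gt_atTop 0] with x hx
    rw [zpow_add₀ (by exact_mod_cast hx.ne')]
  | zero => exact isBigO_zero _ _
  | add p q _ _ hp hq => exact hp.add hq
  | smul c p _ hp => exact hp.const_smul_left c

lemma exp_neg_isBigO {δ δ' : ℝ} (h : δ ≤ δ') :
    (fun x : ℝ => Real.exp (-δ' * x)) =O[atTop] fun x => Real.exp (-δ * x) := by
  refine IsBigO.of_bound 1 ?_
  filter_upwards [eventually_ge_atTop 0] with x hx
  rw [Real.norm_of_nonneg (Real.exp_pos _).le, Real.norm_of_nonneg (Real.exp_pos _).le, one_mul]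
  apply Real.exp_le_exp.mpr
  nlinarith

lemma isLogExp_const (c : ℂ) : IsLogExp fun _ => c :=
  ⟨_, const_mem_logPoly c, 1, one_pos, by simpa using isBigO_zero _ _⟩

lemma IsLogExp.congr {φ ψ : ℝ → ℂ} (hφ : IsLogExp φ) (h : φ =ᶠ[atTop] ψ) : IsLogExp ψ := by
  obtain ⟨p, hp, δ, hδ, hO⟩ := hφ
  exact ⟨p, hp, δ, hδ, hO.congr' (h.mono fun x hx => by simp only [hx]) EventuallyEq.rfl⟩

lemma IsLogExp.mul {φ ψ : ℝ → ℂ} (hφ : IsLogExp φ) (hψ : IsLogExp ψ) :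
    IsLogExp fun x => φ x * ψ x := by
  obtain ⟨p, hp, δ, hδ, hφ⟩ := hφ
  obtain ⟨q, hq, ε, hε, hψ⟩ := hψ
  obtain ⟨r, hr, e⟩ := logPoly_exists_mul hp hq
  set ρ := min δ ε with hρ
  have hρ0 : 0 < ρ := lt_min hδ hε
  replace hφ := hφ.trans (exp_neg_isBigO (min_le_left δ ε))
  replace hψ := hψ.trans (exp_neg_isBigO (min_le_right δ ε))
  rw [← hρ] at hφ hψ
  have hp' := logPoly_isBigO_exp hp (half_pos hρ0)
  have hq' := logPoly_isBigO_exp hq (half_pos hρ0)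
  -- The cross terms multiply an error by a member of `logPoly`; half of the rate `ρ` is spent on
  -- the growth of the latter.
  refine ⟨r, hr, ρ / 2, half_pos hρ0, ?_⟩
  have e1 : ∀ x : ℝ, Real.exp (ρ / 2 * x) * Real.exp (-ρ * x) = Real.exp (-(ρ / 2) * x) :=
    fun x => by rw [← Real.exp_add]; ring_nf
  have e2 : ∀ x : ℝ, Real.exp (-ρ * x) * Real.exp (-ρ * x) = Real.exp (-(2 * ρ) * x) :=
    fun x => by rw [← Real.exp_add]; ring_nf
  have h1 := (hp'.mul hψ).congr_right e1
  have h2 := (hq'.mul hφ).congr_right e1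
  have h3 := ((hφ.mul hψ).congr_right e2).trans (exp_neg_isBigO (show ρ / 2 ≤ 2 * ρ by linarith))
  refine ((h1.add h2).add h3).congr' ?_ EventuallyEq.rfl
  filter_upwards [eventually_gt_atTop 0] with x hx
  rw [e x hx]
  ring

/-- Partial integration lowers the power of the logarithm, except for `x⁻¹`, where the primitive
raises it by one. This exceptional case is why logarithms have to be admitted. -/
lemma logPoly_exists_primitive {p : ℝ → ℂ} (hp : p ∈ logPoly) :
    ∃ q ∈ logPoly, ∀ x : ℝ, 0 < x → HasDerivAt q (p x) x := by
  induction hp using Submodule.span_induction with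
  | mem p hp =>
    obtain ⟨⟨a, b⟩, rfl⟩ := hp
    have hlog : ∀ (b : ℕ) {x : ℝ}, 0 < x → HasDerivAt (fun x : ℝ => (Real.log x : ℂ) ^ b)
        (b * (Real.log x : ℂ) ^ (b - 1) * (x : ℂ)⁻¹) x := fun b x hx => by
      have h1 := (Real.hasDerivAt_log hx.ne').ofReal_comp.pow b
      refine HasDerivAt.congr_deriv h1 ?_
      push_cast
      ring
    have hpow : ∀ (a : ℤ) {x : ℝ}, 0 < x → HasDerivAt (fun x : ℝ => (x : ℂ) ^ a)
        (a * (x : ℂ) ^ (a - 1)) x := fun a x hx =>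
      (hasDerivAt_zpow a (x : ℂ) (Or.inl (by exact_mod_cast hx.ne'))).comp_ofReal
    simp only
    by_cases ha : a = -1
    · refine ⟨_, logPoly.smul_mem ((b + 1 : ℂ)⁻¹) (zpow_mul_log_pow_mem 0 (b + 1)), fun x hx => ?_⟩
      have h1 := (hlog (b + 1) hx).const_mul ((b + 1 : ℂ)⁻¹)
      have h2 : (b + 1 : ℂ) ≠ 0 := by exact_mod_cast b.succ_ne_zero
      convert! h1 using 1
      · ext x; simp
      · rw [ha, zpow_neg_one]
        push_cast
        field_simp
        try simp
    · have ha' : (a + 1 : ℂ) ≠ 0 := by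
        intro h; apply ha; have : a + 1 = 0 := by exact_mod_cast h
        omega
      induction b with
      | zero =>
        refine ⟨_, logPoly.smul_mem ((a + 1 : ℂ)⁻¹) (zpow_mul_log_pow_mem (a + 1) 0),
          fun x hx => ?_⟩
        have h1 := (hpow (a + 1) hx).const_mul ((a + 1 : ℂ)⁻¹)
        convert! h1 using 1
        · ext x; simp
        · push_cast
          rw [add_sub_cancel_right]
          field_simp
      | succ b ih =>
        obtain ⟨q, hq, h⟩ := ih
        refine ⟨_, logPoly.sub_mem (logPoly.smul_mem ((a + 1 : ℂ)⁻¹)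
          (zpow_mul_log_pow_mem (a + 1) (b + 1)))
          (logPoly.smul_mem ((b + 1 : ℂ) * (a + 1 : ℂ)⁻¹) hq), fun x hx => ?_⟩
        have h1 := (((hpow (a + 1) hx).mul (hlog (b + 1) hx)).const_mul ((a + 1 : ℂ)⁻¹)).sub
          ((h x hx).const_mul ((b + 1 : ℂ) * (a + 1 : ℂ)⁻¹))
        have hx' : (x : ℂ) ≠ 0 := by exact_mod_cast hx.ne'
        refine HasDerivAt.congr_deriv h1 ?_
        rw [add_sub_cancel_right, zpow_add_one₀ hx', add_tsub_cancel_right]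
        push_cast
        field_simp
        ring
  | zero => exact ⟨0, logPoly.zero_mem, fun x _ => hasDerivAt_const x (0 : ℂ)⟩
  | add p p' _ _ h h' =>
    obtain ⟨r, hr, e⟩ := h
    obtain ⟨r', hr', e'⟩ := h'
    exact ⟨r + r', logPoly.add_mem hr hr', fun x hx => (e x hx).add (e' x hx)⟩
  | smul c p _ h =>
    obtain ⟨r, hr, e⟩ := h
    exact ⟨c • r, logPoly.smul_mem c hr, fun x hx => (e x hx).const_smul c⟩

lemma continuousOn_logPoly {p : ℝ → ℂ} (hp : p ∈ logPoly) : ContinuousOn p (Ioi 0) := by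
  induction hp using Submodule.span_induction with
  | mem p hp =>
    obtain ⟨⟨a, b⟩, rfl⟩ := hp
    intro x hx
    have hx' : x ≠ 0 := (mem_Ioi.mp hx).ne'
    refine (ContinuousAt.mul ?_ ?_).continuousWithinAt
    · exact ContinuousAt.zpow₀ continuous_ofReal.continuousAt a (Or.inl (by exact_mod_cast hx'))
    · exact ((continuous_ofReal.continuousAt).comp (Real.continuousAt_log hx')).pow b
  | zero => exact continuousOn_const
  | add p q _ _ h h' => exact h.add h'
  | smul c p _ h => exact h.const_smul c

/-- A function with exponentially decreasing derivative converges exponentially fast. -/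
lemma exists_sub_isBigO_exp {e e' : ℝ → ℂ} {δ : ℝ} (hδ : 0 < δ)
    (he : ∀ x : ℝ, 0 < x → HasDerivAt e (e' x) x) (hc : ContinuousOn e' (Ioi 0))
    (hO : e' =O[atTop] fun x => Real.exp (-δ * x)) :
    ∃ κ : ℂ, (fun x => e x - κ) =O[atTop] fun x => Real.exp (-δ * x) := by
  obtain ⟨C, hC⟩ := hO.bound
  obtain ⟨M, hM⟩ := eventually_atTop.mp hC
  have hint : ∀ x, max M 1 ≤ x → IntegrableOn e' (Ioi x) := fun x hx => by
    have h1 : IntegrableOn (fun x => C * Real.exp (-δ * x)) (Ioi x) :=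
      (integrableOn_exp_mul_Ioi (by linarith) x).const_mul C
    refine Integrable.mono' h1 ((hc.mono ?_).aestronglyMeasurable measurableSet_Ioi) ?_
    · exact Ioi_subset_Ioi (zero_le_one.trans ((le_max_right _ _).trans hx))
    · refine (ae_restrict_iff' measurableSet_Ioi).mpr (ae_of_all _ fun y hy => ?_)
      have := hM y ((le_max_left _ _).trans (hx.trans (mem_Ioi.mp hy).le))
      rwa [Real.norm_of_nonneg (Real.exp_pos _).le] at this
  have hpos : ∀ x : ℝ, max M 1 ≤ x → 0 < x := fun x hx =>
    zero_lt_one.trans_le ((le_max_right _ _).trans hx)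
  have hlim := tendsto_limUnder_of_hasDerivAt_of_integrableOn_Ioi (a := max M 1)
    (fun x hx => he x (hpos x (mem_Ioi.mp hx).le)) (hint _ le_rfl)
  set κ := limUnder atTop e
  refine ⟨κ, IsBigO.of_bound (C / δ) ?_⟩
  filter_upwards [eventually_ge_atTop (max M 1)] with x hx
  have h1 := integral_Ioi_of_hasDerivAt_of_tendsto (he x (hpos x hx)).continuousAt.continuousWithinAt
    (fun y hy => he y ((hpos x hx).trans hy)) (hint x hx) hlim
  rw [norm_sub_rev, ← h1, Real.norm_of_nonneg (Real.exp_pos _).le]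
  have h2 : IntegrableOn (fun x => C * Real.exp (-δ * x)) (Ioi x) :=
    (integrableOn_exp_mul_Ioi (by linarith) x).const_mul C
  refine (norm_integral_le_of_norm_le h2 ?_).trans (le_of_eq ?_)
  · refine (ae_restrict_iff' measurableSet_Ioi).mpr (ae_of_all _ fun y hy => ?_)
    have := hM y ((le_max_left _ _).trans (hx.trans (mem_Ioi.mp hy).le))
    rwa [Real.norm_of_nonneg (Real.exp_pos _).le] at this
  · rw [integral_const_mul, integral_exp_mul_Ioi (by linarith)]
    field_simp

/-- After a primitive of the logarithmic part is subtracted, the derivative is exponentially small;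
so the difference tends exponentially fast to a constant, and constants belong to `logPoly`. -/
lemma IsLogExp.primitive {Φ φ : ℝ → ℂ} (hφ : IsLogExp φ) (hc : ContinuousOn φ (Ioi 0))
    (h : ∀ x : ℝ, 0 < x → HasDerivAt Φ (φ x) x) : IsLogExp Φ := by
  obtain ⟨p, hp, δ, hδ, hO⟩ := hφ
  obtain ⟨q, hq, hq'⟩ := logPoly_exists_primitive hp
  obtain ⟨κ, hκ⟩ := exists_sub_isBigO_exp hδ (fun x hx => (h x hx).sub (hq' x hx))
    (hc.sub (continuousOn_logPoly hp)) hO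
  refine ⟨_, logPoly.add_mem hq (const_mem_logPoly κ), δ, hδ, hκ.congr_left fun x => ?_⟩
  simp only [Pi.add_apply, Pi.sub_apply]
  ring

/-- Continuous functions `h` on `(0, ∞)` of polynomial growth at `0` such that the Mellin transform
of `h` over `(0, 1]` is meromorphic. -/
def HasMeroMellin (h : ℝ → ℂ) : Prop :=
  ContinuousOn h (Ioi 0) ∧ (∃ b : ℝ, h =O[𝓝[>] 0] (· ^ (-b))) ∧
    ∃ g : ℂ → ℂ, MeromorphicOn g univ ∧ ∃ σ : ℝ, ∀ z : ℂ, σ < z.re →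
      mellin (indicator (Ioc 0 1) h) z = g z

lemma locallyIntegrableOn_indicator_Ioc {h : ℝ → ℂ} (hc : ContinuousOn h (Ioi 0)) :
    LocallyIntegrableOn (indicator (Ioc 0 1) h) (Ioi 0) := by
  intro x hx
  obtain ⟨t, ht, ht'⟩ := hc.locallyIntegrableOn measurableSet_Ioi (μ := volume) x hx
  exact ⟨t, ht, ht'.indicator measurableSet_Ioc⟩

lemma indicator_Ioc_isBigO_atTop (h : ℝ → ℂ) (g : ℝ → ℝ) :
    (indicator (Ioc 0 1) h) =O[atTop] g := by
  refine (isBigO_zero g atTop).congr' ?_ EventuallyEq.rfl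
  filter_upwards [eventually_gt_atTop 1] with x hx
  simp [indicator, not_le.mpr hx]

lemma indicator_Ioc_eventuallyEq (h : ℝ → ℂ) : indicator (Ioc 0 1) h =ᶠ[𝓝[>] 0] h := by
  filter_upwards [Ioc_mem_nhdsGT (zero_lt_one' ℝ)] with x hx
  simp [hx]

lemma mellinConvergent_indicator_Ioc {h : ℝ → ℂ} (hc : ContinuousOn h (Ioi 0)) {b : ℝ}
    (hb : h =O[𝓝[>] 0] (· ^ (-b))) {z : ℂ} (hz : b < z.re) :
    MellinConvergent (indicator (Ioc 0 1) h) z :=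
  mellinConvergent_of_isBigO_rpow (locallyIntegrableOn_indicator_Ioc hc)
    (indicator_Ioc_isBigO_atTop h _) (lt_add_one _)
    (hb.congr' (indicator_Ioc_eventuallyEq h).symm EventuallyEq.rfl) hz

lemma rpow_isBigO_nhdsGT {b b' : ℝ} (h : b ≤ b') :
    (fun x : ℝ => x ^ (-b)) =O[𝓝[>] 0] fun x => x ^ (-b') := by
  refine IsBigO.of_bound 1 ?_
  filter_upwards [Ioc_mem_nhdsGT (zero_lt_one' ℝ)] with x hx
  rw [Real.norm_of_nonneg (Real.rpow_nonneg hx.1.le _),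
    Real.norm_of_nonneg (Real.rpow_nonneg hx.1.le _), one_mul]
  exact Real.rpow_le_rpow_of_exponent_ge hx.1 hx.2 (by linarith)

lemma HasMeroMellin.add {h h' : ℝ → ℂ} (H : HasMeroMellin h) (H' : HasMeroMellin h') :
    HasMeroMellin fun x => h x + h' x := by
  obtain ⟨hc, ⟨b, hb⟩, g, hg, σ, hσ⟩ := H
  obtain ⟨hc', ⟨b', hb'⟩, g', hg', σ', hσ'⟩ := H'
  refine ⟨hc.add hc', ⟨max b b', (hb.trans (rpow_isBigO_nhdsGT (le_max_left _ _))).add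
    (hb'.trans (rpow_isBigO_nhdsGT (le_max_right _ _)))⟩, _, hg.add hg', max (max b b') (max σ σ'),
    fun z hz => ?_⟩
  simp only [max_lt_iff] at hz
  have := (hasMellin_add (mellinConvergent_indicator_Ioc hc hb hz.1.1)
    (mellinConvergent_indicator_Ioc hc' hb' hz.1.2)).2
  rw [Pi.add_apply, ← hσ z hz.2.1, ← hσ' z hz.2.2, ← this]
  congr 1
  exact indicator_add _ _ _

lemma HasMeroMellin.const_mul {h : ℝ → ℂ} (H : HasMeroMellin h) (c : ℂ) :
    HasMeroMellin fun x => c * h x := by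
  obtain ⟨hc, ⟨b, hb⟩, g, hg, σ, hσ⟩ := H
  refine ⟨hc.const_smul c, ⟨b, hb.const_mul_left c⟩, fun z => c * g z,
    (MeromorphicOn.const c).mul hg, σ, fun z hz => ?_⟩
  simp only
  rw [← hσ z hz, ← smul_eq_mul, ← mellin_const_smul]
  congr 1
  ext x
  by_cases hx : x ∈ Ioc (0 : ℝ) 1 <;> simp [hx]

/-- Multiplication by `log x` differentiates the Mellin transform, and derivatives of meromorphic
functions are meromorphic. -/
lemma HasMeroMellin.log_mul {h : ℝ → ℂ} (H : HasMeroMellin h) :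
    HasMeroMellin fun x => (Real.log x : ℂ) * h x := by
  obtain ⟨hc, ⟨b, hb⟩, g, hg, σ, hσ⟩ := H
  refine ⟨?_, ⟨b + 1, by simpa using isBigO_rpow_zero_log_smul (lt_add_one b) hb⟩, deriv g,
    hg.deriv, max b σ, fun z hz => ?_⟩
  · refine ContinuousOn.mul (fun x hx => ?_) hc
    exact ((continuous_ofReal.continuousAt).comp
      (Real.continuousAt_log (mem_Ioi.mp hx).ne')).continuousWithinAt
  · simp only [max_lt_iff] at hz
    have h1 := (mellin_hasDerivAt_of_isBigO_rpow (locallyIntegrableOn_indicator_Ioc hc)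
      (indicator_Ioc_isBigO_atTop h _) (lt_add_one _)
      (hb.congr' (indicator_Ioc_eventuallyEq h).symm EventuallyEq.rfl) hz.1).2
    have h2 : g =ᶠ[𝓝 z] mellin (indicator (Ioc 0 1) h) := by
      filter_upwards [(isOpen_lt continuous_const Complex.continuous_re).mem_nhds hz.2] with w hw
      exact (hσ w hw).symm
    rw [h2.deriv_eq, h1.deriv]
    congr 1
    ext x
    by_cases hx : x ∈ Ioc (0 : ℝ) 1 <;> simp [hx]

lemma hasMeroMellin_zpow (a : ℤ) : HasMeroMellin fun x => (x : ℂ) ^ a := by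
  refine ⟨fun x hx => (ContinuousAt.zpow₀ continuous_ofReal.continuousAt a
    (Or.inl (by exact_mod_cast (mem_Ioi.mp hx).ne'))).continuousWithinAt, ⟨-a, ?_⟩,
    fun z => 1 / (z + a), ?_, -a, fun z hz => ?_⟩
  · refine IsBigO.of_bound 1 ?_
    filter_upwards [self_mem_nhdsWithin] with x hx
    have hx0 : 0 < x := hx
    rw [neg_neg, Real.rpow_intCast, norm_zpow, norm_zpow, Complex.norm_real, one_mul]
  · exact (MeromorphicOn.const 1).div (MeromorphicOn.id.add (MeromorphicOn.const _))
  · simp only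
    rw [← (hasMellin_cpow_Ioc (a : ℂ) (s := z) (by simp; linarith)).2]
    congr 1
    ext x
    simp

/-- Induction on the power of the logarithm, with `log (1/(Nx)) = -log N - log x`. -/
lemma hasMeroMellin_logPoly {p : ℝ → ℂ} (hp : p ∈ logPoly) {N : ℕ} (hN : 0 < N) :
    ∃ h, HasMeroMellin h ∧ ∀ x : ℝ, 0 < x → h x = p (1 / (N * x)) := by
  have hNr : (0 : ℝ) < N := by exact_mod_cast hN
  induction hp using Submodule.span_induction with
  | mem p hp =>
    obtain ⟨⟨a, b⟩, rfl⟩ := hp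
    induction b with
    | zero =>
      refine ⟨_, (hasMeroMellin_zpow (-a)).const_mul ((N : ℂ) ^ (-a)), fun x hx => ?_⟩
      simp only [pow_zero, mul_one]
      push_cast
      rw [← mul_zpow, one_div, inv_zpow, zpow_neg]
    | succ b ih =>
      obtain ⟨h, H, e⟩ := ih
      refine ⟨_, (H.const_mul (-(Real.log N : ℂ))).add (H.log_mul.const_mul (-1)),
        fun x hx => ?_⟩
      have h1 : Real.log (1 / (N * x)) = -Real.log N - Real.log x := by
        rw [one_div, Real.log_inv, Real.log_mul hNr.ne' hx.ne']; ring
      simp only at e ⊢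
      rw [e x hx, h1, pow_succ]
      push_cast
      ring
  | zero => exact ⟨_, (hasMeroMellin_zpow 0).const_mul 0, by simp⟩
  | add p p' _ _ h h' =>
    obtain ⟨r, hr, e⟩ := h
    obtain ⟨r', hr', e'⟩ := h'
    exact ⟨_, hr.add hr', fun x hx => by simp only [Pi.add_apply, e x hx, e' x hx]⟩
  | smul c p _ h =>
    obtain ⟨r, hr, e⟩ := h
    exact ⟨_, hr.const_mul c, fun x hx => by simp only [Pi.smul_apply, smul_eq_mul, e x hx]⟩

/-- The Mellin transform of a function with a logarithmic Laurent expansion at `0` has a meromorphic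
continuation. -/
theorem exists_meromorphic_mellin {φ : ℝ → ℂ} (hc : ContinuousOn φ (Ioi 0)) {N : ℕ} (hN : 0 < N)
    {δ : ℝ} (hδ : 0 < δ) (htop : φ =O[atTop] fun y => Real.exp (-δ * y))
    (hφ : IsLogExp fun x => φ (1 / (N * x))) :
    ∃ g : ℂ → ℂ, MeromorphicOn g univ ∧ ∃ σ : ℝ, ∀ z : ℂ, σ < z.re →
      mellin φ z = g z ∧ AnalyticAt ℂ g z := by
  have hNr : (0 : ℝ) < N := by exact_mod_cast hN
  obtain ⟨p, hp, ε, hε, hO⟩ := hφ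
  obtain ⟨h, ⟨hhc, ⟨b, hb⟩, g, hg, σ, hσ⟩, hh⟩ := hasMeroMellin_logPoly hp hN
  -- The expansion at `0`, cut off at `1`, has a meromorphic Mellin transform. The remainder `ψ`
  -- decays faster than any power at both ends, so its transform is entire.
  set ψ : ℝ → ℂ := fun x => φ x - indicator (Ioc 0 1) h x with hψ
  have hli : LocallyIntegrableOn ψ (Ioi 0) :=
    (hc.locallyIntegrableOn measurableSet_Ioi).sub (locallyIntegrableOn_indicator_Ioc hhc)
  have hψtop : ψ =O[atTop] fun y => Real.exp (-δ * y) :=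
    htop.sub (indicator_Ioc_isBigO_atTop h _)
  have hψ0 : ∀ B : ℝ, ψ =O[𝓝[>] 0] (· ^ (-B)) := fun B => by
    have ht : Tendsto (fun x : ℝ => 1 / (N * x)) (𝓝[>] 0) atTop := by
      refine (tendsto_inv_nhdsGT_zero.const_mul_atTop (inv_pos.mpr hNr)).congr fun x => ?_
      rw [one_div, mul_inv]
    have h1 := (hO.trans (isLittleO_exp_neg_mul_rpow_atTop hε B).isBigO).comp_tendsto ht
    refine (h1.trans (IsBigO.of_bound ((N : ℝ) ^ (-B)) ?_)).congr' ?_ EventuallyEq.rfl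
    · filter_upwards [self_mem_nhdsWithin] with x hx
      have hx0 : 0 < x := hx
      simp only [Function.comp_apply]
      rw [one_div, Real.inv_rpow (by positivity), ← Real.rpow_neg (by positivity),
        Real.mul_rpow hNr.le hx0.le, norm_mul, Real.norm_of_nonneg (by positivity)]
    · filter_upwards [Ioc_mem_nhdsGT (zero_lt_one' ℝ)] with x hx
      have hx0 : 0 < x := hx.1
      simp only [Function.comp_apply, hψ]
      rw [indicator_of_mem hx, hh x hx0]
      congr 2
      field_simp
  have hψd : Differentiable ℂ (mellin ψ) := fun z =>
    mellin_differentiableAt_of_isBigO_rpow_exp hδ hli hψtop (hψ0 (z.re - 1)) (by linarith)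
  have heq : ∀ z : ℂ, max b σ < z.re → mellin φ z = mellin ψ z + g z := fun z hz => by
    simp only [max_lt_iff] at hz
    rw [← hσ z hz.2, ← (hasMellin_add (mellinConvergent_of_isBigO_rpow_exp hδ hli hψtop
      (hψ0 (z.re - 1)) (by linarith)) (mellinConvergent_indicator_Ioc hhc hb hz.1)).2]
    congr 1
    ext x
    simp [hψ]
  refine ⟨fun z => mellin ψ z + g z, ?_, max b σ, fun z hz => ⟨heq z hz, ?_⟩⟩
  · exact MeromorphicOn.add (fun z _ => (hψd.analyticAt z).meromorphicAt) hg
  · have hg' : DifferentiableOn ℂ g {w | max b σ < w.re} := fun w hw => by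
      have hw' : b < w.re ∧ σ < w.re := max_lt_iff.mp hw
      have h1 := mellin_differentiableAt_of_isBigO_rpow (locallyIntegrableOn_indicator_Ioc hhc)
        (indicator_Ioc_isBigO_atTop h _) (lt_add_one _)
        (hb.congr' (indicator_Ioc_eventuallyEq h).symm EventuallyEq.rfl) hw'.1
      have h2 : g =ᶠ[𝓝 w] mellin (indicator (Ioc 0 1) h) := by
        filter_upwards [(isOpen_lt continuous_const Complex.continuous_re).mem_nhds hw'.2] with u hu
        exact (hσ u hu).symm
      exact (h1.congr_of_eventuallyEq h2).differentiableWithinAt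
    exact (hψd.analyticAt z).add
      (hg'.analyticAt ((isOpen_lt continuous_const Complex.continuous_re).mem_nhds hz))

/-! ### Meromorphic continuation of the multiple `L`-functions -/

lemma IsAxisForm.polyGrowth {N : ℕ} {k : ℤ} {a : ℕ → ℂ} {F : ℝ → ℂ} (h : IsAxisForm N k a F) :
    PolyGrowth a := h.coeff_le

/-- Modularity gives `F(1/(Nx)) = b x^k` up to an exponentially small error. Multiplying that error
by `x^k` costs half of the rate. -/
lemma IsAxisForm.isLogExp {N : ℕ} {k : ℤ} {a : ℕ → ℂ} {F : ℝ → ℂ} (h : IsAxisForm N k a F) :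
    IsLogExp fun x => F (1 / (N * x)) - a 0 := by
  obtain ⟨b, δ, hδ, hO⟩ := h.decay_inv
  refine ⟨_, logPoly.sub_mem (logPoly.smul_mem b (zpow_mul_log_pow_mem k 0))
    (const_mem_logPoly (a 0)), δ / 2, half_pos hδ, ?_⟩
  refine ((zpow_isBigO_exp k (half_pos hδ)).mul hO).congr' ?_ (Eventually.of_forall fun x => ?_)
  · filter_upwards [eventually_gt_atTop 0] with x hx
    have hxk : (x : ℂ) ^ k * (x : ℂ) ^ (-k) = 1 := by
      rw [← zpow_add₀ (by exact_mod_cast hx.ne'), add_neg_cancel, zpow_zero]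
    simp only [Pi.sub_apply, Pi.smul_apply, pow_zero, smul_eq_mul, mul_one]
    linear_combination F (1 / (N * x)) * hxk
  · simp only
    rw [← Real.exp_add]
    ring_nf

/-- Double induction on the length and on the first argument. If the first argument is `0`, the sum
is a form without its constant term times a shorter sum; otherwise it is, up to an elementary
factor, a primitive of the sum with first argument one less. Both operations preserve `IsLogExp`. -/
lemma isLogExp_expSum {N : ℕ} (hN : 0 < N) (l : ℕ) : ∀ (a : ℕ → ℕ → ℂ) (t : ℕ → ℂ),
    (∀ i : Fin l, ∃ k F, IsAxisForm N k (a (i + 1)) F) →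
    (∀ i : Fin l, ∃ n : ℕ, t (i + 1) = n) → IsLogExp fun x => expSum l a t (1 / (N * x)) := by
  have hNr : (0 : ℝ) < N := by exact_mod_cast hN
  induction l with
  | zero =>
    intro a t _ _
    simpa only [expSum_zero] using isLogExp_const 1
  | succ l ih =>
    intro a t ha ht
    have hg : ∀ i : Fin (l + 1), PolyGrowth (a (i + 1)) := fun i => by
      obtain ⟨k, F, h⟩ := ha i
      exact h.polyGrowth
    obtain ⟨n, hn⟩ := ht 0
    simp only [Fin.val_zero, zero_add] at hn
    induction n generalizing t with
    | zero =>
      obtain ⟨k, F, h⟩ := ha 0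
      simp only [Fin.val_zero, zero_add] at h
      refine (h.isLogExp.mul (ih (fun i => a (i + 1)) (fun i => t (i + 1))
        (fun i => by rw [← Fin.val_succ]; exact ha i.succ)
        (fun i => by rw [← Fin.val_succ]; exact ht i.succ))).congr ?_
      filter_upwards [eventually_gt_atTop 0] with x hx
      rw [expSum_succ hg t (by rw [hn, Nat.cast_zero]) (by positivity) (h.hasSum _ (by positivity))]
    | succ n ihn =>
      have h1 := ihn (consArg (t 1 - 1) t) (fun i => by
        by_cases hi : i = 0
        · subst hi
          exact ⟨n, by rw [Fin.val_zero, zero_add, consArg_one, hn]; push_cast; ring⟩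
        · have : (i : ℕ) ≠ 0 := fun h => hi (Fin.ext h)
          rw [consArg_of_ne _ _ (by omega)]
          exact ht i) (by rw [consArg_one, hn]; push_cast; ring)
      -- The prefactor is `-I` from `hasDerivAt_expSum` times the derivative `-N⁻¹ x⁻²` of `1/(Nx)`.
      have h2 : IsLogExp fun x : ℝ => I * (N : ℂ)⁻¹ * (x : ℂ) ^ (-2 : ℤ) *
          expSum (l + 1) a (consArg (t 1 - 1) t) (1 / (N * x)) := by
        refine IsLogExp.mul ⟨_, logPoly.smul_mem (I * (N : ℂ)⁻¹) (zpow_mul_log_pow_mem (-2) 0),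
          1, one_pos, ?_⟩ h1
        refine (isBigO_zero _ _).congr_left fun x => ?_
        simp
      have hinv : ∀ x : ℝ, 0 < x → HasDerivAt (fun x : ℝ => 1 / (N * x)) (-(N : ℝ)⁻¹ * (x ^ 2)⁻¹) x :=
        fun x hx => by
          have := (hasDerivAt_inv hx.ne').const_mul ((N : ℝ)⁻¹)
          refine (HasDerivAt.congr_deriv this (by ring)).congr_of_eventuallyEq
            (Eventually.of_forall fun y => ?_)
          simp only [one_div, mul_inv]
      refine h2.primitive ?_ fun x hx => ?_
      · refine ContinuousOn.mul (ContinuousOn.mul continuousOn_const fun x hx => ?_) ?_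
        · exact (ContinuousAt.zpow₀ continuous_ofReal.continuousAt _
            (Or.inl (by exact_mod_cast (mem_Ioi.mp hx).ne'))).continuousWithinAt
        · refine (continuousOn_expSum l.succ_pos hg _).comp
            (fun x hx => (hinv x hx).continuousAt.continuousWithinAt) fun x hx => ?_
          have : 0 < x := hx
          exact mem_Ioi.mpr (by positivity)
      · have hd := (hasDerivAt_expSum l.succ_pos hg t (y := 1 / (N * x)) (by positivity)).scomp x
          (hinv x hx)
        refine HasDerivAt.congr_deriv hd ?_
        rw [real_smul, zpow_neg]
        push_cast
        rw [zpow_ofNat]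
        ring

/-- Take the exponential sum with first argument `0` and let `z` be the Mellin variable: the
`L`-function is `I^z / Γ(z)` times a Mellin transform whose continuation is known, provided that the
other arguments are natural numbers. -/
theorem exists_isContinuedL {N : ℕ} (hN : 0 < N) {l : ℕ} (hl : 0 < l) {a : ℕ → ℕ → ℂ}
    (ha : ∀ i : Fin l, ∃ k F, IsAxisForm N k (a (i + 1)) F) {β : ℕ → ℂ}
    (hβ : ∀ i, 2 ≤ i → i ≤ l → ∃ n : ℕ, β i = n) : ∃ g, IsContinuedL l a β g := by
  have hg : ∀ i : Fin l, PolyGrowth (a (i + 1)) := fun i => by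
    obtain ⟨k, F, h⟩ := ha i
    exact h.polyGrowth
  obtain ⟨σ₁, h₁⟩ := exists_mellin_expSum hl hg (consArg 0 β)
  obtain ⟨C, n, hC, hb⟩ := exists_norm_expSum_le hl hg (consArg 0 β)
  obtain ⟨g, hgm, σ₂, h₂⟩ := exists_meromorphic_mellin (continuousOn_expSum hl hg (consArg 0 β)) hN
    Real.pi_pos (IsBigO.of_bound C (by
      filter_upwards [eventually_ge_atTop 1] with y hy
      refine (hb y (by linarith)).trans ?_
      rw [Real.norm_of_nonneg (Real.exp_pos _).le]
      have : (y ^ n)⁻¹ ≤ 1 := inv_le_one_of_one_le₀ (one_le_pow₀ hy)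
      gcongr
      exact mul_le_of_le_one_right hC this))
    (isLogExp_expSum hN l a (consArg 0 β) ha fun i => by
      by_cases hi : (i : ℕ) = 0
      · exact ⟨0, by rw [hi, zero_add, consArg_one]; simp⟩
      · rw [consArg_of_ne _ _ (by omega)]
        exact hβ _ (by omega) (by omega))
  have hI : Differentiable ℂ fun z : ℂ => I ^ z := fun z =>
    (differentiableAt_id).const_cpow (Or.inl I_ne_zero)
  set G : ℂ → ℂ := fun z => (Gamma z)⁻¹ * (I ^ z * g z) with hG
  have hGm : MeromorphicOn G univ :=
    MeromorphicOn.mul (fun z _ => (differentiable_one_div_Gamma.analyticAt z).meromorphicAt)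
      (MeromorphicOn.mul (fun z _ => (hI.analyticAt z).meromorphicAt) hgm)
  refine ⟨toMeromorphicNFOn G univ, meromorphicNFOn_toMeromorphicNFOn G univ,
    max 0 (max σ₁ σ₂), fun z hz => ?_⟩
  simp only [max_lt_iff] at hz
  have hcons : consArg (consArg 0 β 1 + z) (consArg 0 β) = consArg z β := by
    ext i
    by_cases hi : i = 1
    · rw [hi]; simp [consArg_one]
    · simp [consArg_of_ne _ _ hi]
  obtain ⟨hsum, -, hmel⟩ := h₁ z hz.2.1
  obtain ⟨heq, han⟩ := h₂ z hz.2.2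
  rw [hcons] at hsum hmel
  refine ⟨hsum, ?_⟩
  -- Passing to the normal form leaves values at points of analyticity unchanged, so the normalised
  -- function still equals the series on the half-plane.
  have hGan : AnalyticAt ℂ G z :=
    (differentiable_one_div_Gamma.analyticAt z).mul ((hI.analyticAt z).mul han)
  rw [toMeromorphicNFOn_eq_toMeromorphicNFAt hGm (mem_univ z),
    toMeromorphicNFAt_eq_self.mpr hGan.meromorphicNFAt, hG]
  simp only
  rw [← heq, hmel, inv_mul_cancel_left₀ (Gamma_ne_zero_of_re_pos hz.1)]

/-! ### Holomorphic parameter integrals in several variables -/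

/-- Cauchy's estimate on the complex line through `w` in direction `v`. The radius `ε / (4‖v‖)`
keeps the circle inside the larger ball, since `w` lies in the ball of half the radius. -/
lemma norm_fderiv_le_of_bound {r : ℕ} {h : (Fin r → ℂ) → ℂ} (hd : Differentiable ℂ h)
    {w₀ w : Fin r → ℂ} {ε B : ℝ} (hε : 0 < ε) (hB : ∀ v ∈ Metric.ball w₀ ε, ‖h v‖ ≤ B)
    (hw : w ∈ Metric.ball w₀ (ε / 2)) : ‖fderiv ℂ h w‖ ≤ B * (4 / ε) := by
  have hB0 : 0 ≤ B := (norm_nonneg _).trans (hB w₀ (Metric.mem_ball_self hε))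
  refine ContinuousLinearMap.opNorm_le_bound _ (by positivity) fun v => ?_
  rcases eq_or_ne v 0 with rfl | hv
  · simp
  have hv' : 0 < ‖v‖ := norm_pos_iff.mpr hv
  have hline : ∀ z : ℂ, HasDerivAt (fun z : ℂ => w + z • v) v z := fun z => by
    simpa using ((hasDerivAt_id z).smul_const v).const_add w
  have hg : ∀ z : ℂ, HasDerivAt (fun z : ℂ => h (w + z • v)) (fderiv ℂ h (w + z • v) v) z :=
    fun z => (hd _).hasFDerivAt.comp_hasDerivAt z (hline z)
  have h1 := Complex.norm_deriv_le_of_forall_mem_sphere_norm_le (c := 0) (R := ε / (4 * ‖v‖))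
    (C := B) (f := fun z : ℂ => h (w + z • v)) (by positivity)
    (Differentiable.diffContOnCl fun z => (hg z).differentiableAt) fun z hz => by
      apply hB
      rw [mem_sphere_zero_iff_norm] at hz
      rw [Metric.mem_ball, dist_eq_norm] at hw ⊢
      calc ‖w + z • v - w₀‖ = ‖(w - w₀) + z • v‖ := by congr 1; abel
        _ ≤ ‖w - w₀‖ + ‖z‖ * ‖v‖ := (norm_add_le _ _).trans (by rw [norm_smul])
        _ = ‖w - w₀‖ + ε / 4 := by rw [hz]; field_simp
        _ < ε := by linarith
  rw [(hg 0).deriv, zero_smul, add_zero] at h1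
  refine h1.trans (le_of_eq ?_)
  field_simp

/-- An integral of entire functions of several variables, which are locally uniformly dominated by
integrable functions, is entire. -/
theorem differentiable_integral_of_dominated {r : ℕ} {μ : Measure ℝ} {G : (Fin r → ℂ) → ℝ → ℂ}
    (hm : ∀ w, AEStronglyMeasurable (G w) μ)
    (hd : ∀ᵐ u ∂μ, Differentiable ℂ fun w => G w u)
    (hb : ∀ w₀, ∃ ε > 0, ∃ g : ℝ → ℝ, Integrable g μ ∧
      ∀ᵐ u ∂μ, ∀ w ∈ Metric.ball w₀ ε, ‖G w u‖ ≤ g u) :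
    Differentiable ℂ fun w => ∫ u, G w u ∂μ := by
  intro w₀
  obtain ⟨ε, hε, g, hg, hGg⟩ := hb w₀
  -- Partial derivatives are limits of measurable difference quotients, and the finitely many
  -- coordinate directions determine the derivative.
  have hF' : AEStronglyMeasurable (fun u => fderiv ℂ (fun w => G w u) w₀) μ := by
    have h1 : ∀ i : Fin r, AEStronglyMeasurable
        (fun u => fderiv ℂ (fun w => G w u) w₀ (Pi.single i 1)) μ := fun i => by
      refine aestronglyMeasurable_of_tendsto_ae atTop
        (f := fun (n : ℕ) u => (n : ℂ) • (G (w₀ + (n : ℂ)⁻¹ • Pi.single i 1) u - G w₀ u))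
        (fun n => ((hm (w₀ + (n : ℂ)⁻¹ • Pi.single i 1)).sub (hm w₀)).const_smul (n : ℂ)) ?_
      filter_upwards [hd] with u hu
      refine (hu w₀).hasFDerivAt.lim _ ?_
      simpa using tendsto_natCast_atTop_atTop (R := ℝ)
    have h2 : (fun u => fderiv ℂ (fun w => G w u) w₀) = fun u =>
        ∑ i : Fin r, fderiv ℂ (fun w => G w u) w₀ (Pi.single i 1) •
          (ContinuousLinearMap.proj i : (Fin r → ℂ) →L[ℂ] ℂ) := by
      ext u v
      rw [sum_apply]
      conv_lhs => rw [pi_eq_sum_univ' v, map_sum]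
      refine Finset.sum_congr rfl fun i _ => ?_
      rw [map_smul, smul_apply, ContinuousLinearMap.proj_apply, smul_eq_mul,
        smul_eq_mul, mul_comm]
    rw [h2]
    exact Finset.aestronglyMeasurable_fun_sum _ fun i _ => (h1 i).smul_const _
  refine (hasFDerivAt_integral_of_dominated_of_fderiv_le
    (F' := fun w u => fderiv ℂ (fun w => G w u) w) (bound := fun u => g u * (4 / ε))
    (Metric.ball_mem_nhds w₀ (half_pos hε)) (Eventually.of_forall hm) ?_ hF' ?_
    (hg.mul_const _) ?_).differentiableAt
  · refine hg.mono' (hm w₀) ?_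
    filter_upwards [hGg] with u hu using hu w₀ (Metric.mem_ball_self hε)
  · filter_upwards [hd, hGg] with u hu hu' w hw using norm_fderiv_le_of_bound hu hε hu' hw
  · filter_upwards [hd] with u hu w _ using (hu w).hasFDerivAt

/-! ### Integrals over simplices -/

lemma isOpen_simplex (r : ℕ) {S : Set ℝ} (hS : IsOpen S) : IsOpen (simplex r S) := by
  have h : simplex r S = (⋂ (i : Fin r) (j : Fin r) (_ : i < j), {y | y i < y j}) ∩
      ⋂ i : Fin r, {y | y i ∈ S} := by
    ext y
    simp [simplex, StrictMono]
  rw [h]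
  refine IsOpen.inter ?_ (isOpen_iInter_of_finite fun i => hS.preimage (continuous_apply i))
  refine isOpen_iInter_of_finite fun i => isOpen_iInter_of_finite fun j =>
    isOpen_iInter_of_finite fun _ => isOpen_lt (continuous_apply i) (continuous_apply j)

lemma cons_mem_simplex_Ioi {r : ℕ} {x a : ℝ} {v : Fin r → ℝ} :
    (Fin.cons a v : Fin (r + 1) → ℝ) ∈ simplex (r + 1) (Ioi x) ↔
      x < a ∧ v ∈ simplex r (Ioi a) := by
  constructor
  · rintro ⟨hm, hS⟩
    refine ⟨by simpa using hS 0, fun i j hij => ?_, fun i => ?_⟩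
    · simpa using hm (Fin.succ_lt_succ_iff.mpr hij)
    · simpa using hm (Fin.succ_pos i)
  · rintro ⟨ha, hm, hS⟩
    refine ⟨fun i j hij => ?_, fun i => ?_⟩
    · refine Fin.cases (fun h => ?_) (fun i h => ?_) i hij
      · obtain ⟨j, rfl⟩ := Fin.exists_succ_eq.mpr (ne_of_gt h)
        simpa using hS j
      · obtain ⟨j, rfl⟩ := Fin.exists_succ_eq.mpr (ne_of_gt ((Fin.succ_pos i).trans h))
        simpa using hm (Fin.succ_lt_succ_iff.mp h)
    · refine Fin.cases (by simpa using ha) (fun i => ?_) i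
      simpa using ha.trans (hS i)

/-- Fubini's theorem for the outermost variable of an integral over a simplex. -/
theorem integral_simplex_succ {r : ℕ} {x : ℝ} {p : ℝ → ℂ} {q : (Fin r → ℝ) → ℂ}
    (hc : ContinuousOn (fun u : Fin (r + 1) → ℝ => p (u 0) * q (Fin.tail u))
      (simplex (r + 1) (Ioi x)))
    (hq : ∀ a, x < a → IntegrableOn q (simplex r (Ioi a)))
    {b : ℝ → ℝ} (hb : IntegrableOn b (Ioi x))
    (hpb : ∀ a, x < a → ‖p a‖ * ∫ v in simplex r (Ioi a), ‖q v‖ ≤ b a) :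
    IntegrableOn (fun u : Fin (r + 1) → ℝ => p (u 0) * q (Fin.tail u)) (simplex (r + 1) (Ioi x)) ∧
      ∫ u in simplex (r + 1) (Ioi x), p (u 0) * q (Fin.tail u) =
        ∫ a in Ioi x, p a * ∫ v in simplex r (Ioi a), q v ∧
      ∫ u in simplex (r + 1) (Ioi x), ‖p (u 0) * q (Fin.tail u)‖ ≤ ∫ a in Ioi x, b a := by
  set h : (Fin (r + 1) → ℝ) → ℂ := fun u => p (u 0) * q (Fin.tail u) with hh
  have hS := (isOpen_simplex (r + 1) (isOpen_Ioi (a := x))).measurableSet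
  have hSa := fun a : ℝ => (isOpen_simplex r (isOpen_Ioi (a := a))).measurableSet
  set e := MeasurableEquiv.piFinSuccAbove (fun _ : Fin (r + 1) => ℝ) 0 with he
  have hmp : MeasurePreserving e := volume_preserving_piFinSuccAbove (fun _ => ℝ) 0
  -- The integrand, extended by zero, with the first coordinate split off: for fixed first
  -- coordinate `a > x` its section lives on the simplex above `a`.
  set H : ℝ × (Fin r → ℝ) → ℂ := fun z => indicator (simplex (r + 1) (Ioi x)) h (e.symm z) with hH
  have hsymm : ∀ a v, e.symm (a, v) = (Fin.cons a v : Fin (r + 1) → ℝ) := fun a v => by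
    simp [he, MeasurableEquiv.piFinSuccAbove, Fin.insertNthEquiv]
  have hHe : H ∘ e = indicator (simplex (r + 1) (Ioi x)) h := by
    ext u; simp [hH]
  have hHm : AEStronglyMeasurable H (volume.prod volume) := by
    have h1 : AEStronglyMeasurable (indicator (simplex (r + 1) (Ioi x)) h) :=
      (aestronglyMeasurable_indicator_iff hS).mpr (hc.aestronglyMeasurable hS)
    exact h1.comp_measurePreserving (hmp.symm e)
  have hsec : ∀ a v, H (a, v) = indicator (Ioi x)
      (fun a => p a * indicator (simplex r (Ioi a)) q v) a := fun a v => by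
    simp only [hH, hsymm]
    by_cases ha : x < a
    · rw [indicator_of_mem (mem_Ioi.mpr ha)]
      by_cases hv : v ∈ simplex r (Ioi a)
      · rw [indicator_of_mem (cons_mem_simplex_Ioi.mpr ⟨ha, hv⟩), indicator_of_mem hv, hh]
        simp
      · rw [indicator_of_notMem (fun hm => hv (cons_mem_simplex_Ioi.mp hm).2),
          indicator_of_notMem hv, mul_zero]
    · rw [indicator_of_notMem (fun hm => ha (cons_mem_simplex_Ioi.mp hm).1),
        indicator_of_notMem (s := Ioi x) (fun hm => ha hm)]
  have hnorm : ∀ a, ∫ v, ‖H (a, v)‖ ≤ indicator (Ioi x) b a := fun a => by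
    simp only [hsec]
    by_cases ha : a ∈ Ioi x
    · simp only [indicator_of_mem ha, norm_mul]
      rw [integral_const_mul]
      refine le_trans (le_of_eq ?_) (hpb a ha)
      congr 1
      rw [← integral_indicator (hSa a)]
      congr 1
      ext v
      exact norm_indicator_eq_indicator_norm _ _
    · simp [indicator_of_notMem ha]
  have hint : Integrable H (volume.prod volume) := by
    rw [integrable_prod_iff hHm]
    constructor
    · refine Eventually.of_forall fun a => ?_
      simp only [hsec]
      by_cases ha : a ∈ Ioi x
      · simp only [indicator_of_mem ha]
        exact ((integrable_indicator_iff (hSa a)).mpr (hq a ha)).const_mul _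
      · simp only [indicator_of_notMem ha]
        exact integrable_zero _ _ _
    · refine Integrable.mono' ((integrable_indicator_iff measurableSet_Ioi).mpr hb)
        hHm.norm.integral_prod_right' (Eventually.of_forall fun a => ?_)
      rw [Real.norm_of_nonneg (integral_nonneg fun _ => norm_nonneg _)]
      exact hnorm a
  refine ⟨?_, ?_, ?_⟩
  · rw [← integrable_indicator_iff hS, ← hHe]
    exact (hmp.integrable_comp_emb e.measurableEmbedding).mpr hint
  · rw [← integral_indicator hS, ← hHe]
    have h1 : ∫ u, (H ∘ e) u = ∫ z, H z ∂(volume.prod volume) :=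
      hmp.integral_comp e.measurableEmbedding H
    rw [h1, integral_prod _ hint, ← integral_indicator measurableSet_Ioi]
    congr 1
    ext a
    simp only [hsec]
    by_cases ha : a ∈ Ioi x
    · simp only [indicator_of_mem ha]
      rw [integral_const_mul, integral_indicator (hSa a)]
    · simp [indicator_of_notMem ha]
  · rw [← integral_indicator hS, ← integral_indicator measurableSet_Ioi]
    have h1 : ∫ u, ‖(H ∘ e) u‖ = ∫ z, ‖H z‖ ∂(volume.prod volume) :=
      hmp.integral_comp e.measurableEmbedding fun z => ‖H z‖
    have h2 : (indicator (simplex (r + 1) (Ioi x)) fun u => ‖h u‖) = fun u => ‖(H ∘ e) u‖ := by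
      ext u
      rw [hHe, norm_indicator_eq_indicator_norm]
    rw [h2, h1, integral_prod _ hint.norm]
    exact integral_mono hint.integral_norm_prod_left
      ((integrable_indicator_iff measurableSet_Ioi).mpr hb) hnorm

/-! ### Regularised iterated integrals from infinity -/

/-- Continuous functions on `(0, ∞)` which converge to `c` exponentially fast. -/
def IsReg (φ : ℝ → ℂ) (c : ℂ) : Prop :=
  ContinuousOn φ (Ioi 0) ∧ ∃ δ > 0, (fun u => φ u - c) =O[atTop] fun u => Real.exp (-δ * u)

lemma exists_bound_exp {f : ℝ → ℂ} (hc : ContinuousOn f (Ioi 0)) {δ : ℝ}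
    (hO : f =O[atTop] fun u => Real.exp (-δ * u)) {x : ℝ} (hx : 0 < x) :
    ∃ C, 0 ≤ C ∧ ∀ u, x ≤ u → ‖f u‖ ≤ C * Real.exp (-δ * u) := by
  obtain ⟨C, hC⟩ := hO.bound
  obtain ⟨M, hM⟩ := eventually_atTop.mp hC
  have hcont : ContinuousOn (fun u => ‖f u‖ / Real.exp (-δ * u)) (Icc x M) :=
    ContinuousOn.div (hc.mono fun u hu => hx.trans_le hu.1).norm (by fun_prop)
      fun u _ => (Real.exp_pos _).ne'
  obtain ⟨C', hC'⟩ := isCompact_Icc.exists_bound_of_continuousOn hcont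
  refine ⟨max (max C C') 0, le_max_right _ _, fun u hu => ?_⟩
  by_cases h : M ≤ u
  · have := hM u h
    rw [Real.norm_of_nonneg (Real.exp_pos _).le] at this
    refine this.trans ?_
    gcongr
    exact (le_max_left _ _).trans (le_max_left _ _)
  · have := hC' u ⟨hu, (not_le.mp h).le⟩
    rw [norm_div, norm_norm, Real.norm_of_nonneg (Real.exp_pos _).le,
      div_le_iff₀ (Real.exp_pos _)] at this
    refine this.trans ?_
    gcongr
    exact (le_max_right _ _).trans (le_max_left _ _)

lemma IsReg.exists_bound {φ : ℝ → ℂ} {c : ℂ} (h : IsReg φ c) {x : ℝ} (hx : 0 < x) :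
    ∃ B δ : ℝ, 0 ≤ B ∧ 0 < δ ∧ ∀ u, x ≤ u → ‖φ u‖ ≤ B ∧ ‖φ u - c‖ ≤ B * Real.exp (-δ * u) := by
  obtain ⟨hc, δ, hδ, hO⟩ := h
  obtain ⟨C, hC, hb⟩ := exists_bound_exp (hc.sub continuousOn_const) hO hx
  refine ⟨C + ‖c‖, δ, by positivity, hδ, fun u hu => ⟨?_, ?_⟩⟩
  · have h1 : Real.exp (-δ * u) ≤ 1 := Real.exp_le_one_iff.mpr (by nlinarith)
    calc ‖φ u‖ = ‖(φ u - c) + c‖ := by rw [sub_add_cancel]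
      _ ≤ ‖φ u - c‖ + ‖c‖ := norm_add_le _ _
      _ ≤ C + ‖c‖ := by
        gcongr
        exact (hb u hu).trans (mul_le_of_le_one_right hC h1)
  · refine (hb u hu).trans ?_
    gcongr
    linarith [norm_nonneg c]

/-- The constant is uniform over a vertical strip of exponents, which gives domination locally
uniformly in the parameters. The two summands treat `u ≥ 1` and `u ≤ 1`. -/
lemma exists_norm_cpow_le (n : ℕ) {ρ x : ℝ} (hρ : 0 < ρ) (hx : 0 < x) :
    ∃ C, 0 ≤ C ∧ ∀ u, x ≤ u → ∀ w : ℂ, |w.re| ≤ n → ‖(u : ℂ) ^ w‖ ≤ C * Real.exp (ρ * u) := by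
  refine ⟨n.factorial / ρ ^ n + (x ^ n)⁻¹, by positivity, fun u hu w hw => ?_⟩
  have hu0 : 0 < u := hx.trans_le hu
  have he : 1 ≤ Real.exp (ρ * u) := Real.one_le_exp (by positivity)
  have h1 : u ^ n ≤ n.factorial / ρ ^ n * Real.exp (ρ * u) := by
    have := Real.pow_div_factorial_le_exp (ρ * u) (by positivity) n
    rw [div_le_iff₀ (by positivity), mul_pow] at this
    rw [div_mul_eq_mul_div, le_div_iff₀ (by positivity)]
    linarith
  have h2 : (u ^ n)⁻¹ ≤ (x ^ n)⁻¹ * Real.exp (ρ * u) :=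
    (inv_anti₀ (by positivity) (by gcongr)).trans (le_mul_of_one_le_right (by positivity) he)
  have hpos1 : 0 ≤ (x ^ n)⁻¹ * Real.exp (ρ * u) := by positivity
  have hpos2 : 0 ≤ n.factorial / ρ ^ n * Real.exp (ρ * u) := by positivity
  rw [norm_cpow_eq_rpow_re_of_pos hu0, add_mul]
  obtain ⟨hw1, hw2⟩ := abs_le.mp hw
  rcases le_total 1 u with h | h
  · have : u ^ w.re ≤ u ^ n := by
      rw [← Real.rpow_natCast]; exact Real.rpow_le_rpow_of_exponent_le h hw2
    linarith
  · have : u ^ w.re ≤ (u ^ n)⁻¹ := by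
      rw [← Real.rpow_natCast, ← Real.rpow_neg hu0.le]
      exact Real.rpow_le_rpow_of_exponent_ge hu0 h hw1
    linarith

/-- The integrand in the recursion for the regularised iterated integrals. -/
def regKer (φ : ℝ → ℂ) (c A : ℂ) (R : ℝ → ℂ) (S w : ℂ) (u : ℝ) : ℂ :=
  (φ u * R u + (φ u - c) * (A * (u : ℂ) ^ S)) * (u : ℂ) ^ (w - 1)

/-- The exponentially decreasing part of the numerator of a regularised iterated integral. -/
def regRem : (r : ℕ) → (Fin r → ℝ → ℂ) → (Fin r → ℂ) → (Fin r → ℂ) → ℝ → ℂ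
  | 0, _, _, _, _ => 0
  | r + 1, φ, c, w, y => -(∑ i, w i) * ∫ u in Ioi y,
      regKer (φ 0) (c 0) (∏ i : Fin r, c i.succ)
        (regRem r (fun i => φ i.succ) (fun i => c i.succ) (fun i => w i.succ))
        (∑ i : Fin r, w i.succ) (w 0) u

/-- The numerator of the meromorphic continuation of
`∫ ∏ φᵢ(uᵢ) uᵢ ^ (wᵢ - 1)` over `y < u₁ < ⋯ < u_r`. -/
def regNum (r : ℕ) (φ : Fin r → ℝ → ℂ) (c w : Fin r → ℂ) (y : ℝ) : ℂ :=
  regRem r φ c w y + (∏ i, c i) * (y : ℂ) ^ ∑ i, w i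

/-- The denominator of the meromorphic continuation. -/
def regDen (r : ℕ) (w : Fin r → ℂ) : ℂ := ∏ i, -∑ t ∈ Finset.Ici i, w t

lemma hasDerivAt_integral_Ioi {f : ℝ → ℂ} (hc : ContinuousOn f (Ioi 0))
    (hi : ∀ y, 0 < y → IntegrableOn f (Ioi y)) {y : ℝ} (hy : 0 < y) :
    HasDerivAt (fun y => ∫ u in Ioi y, f u) (-f y) y := by
  have hy2 : 0 < y / 2 := by linarith
  have h1 : ∀ z, y / 2 < z → ∫ u in Ioi z, f u = (∫ u in Ioi (y / 2), f u) - ∫ u in (y / 2)..z, f u :=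
    fun z hz => by
      rw [← intervalIntegral.integral_interval_add_Ioi (hi _ hy2) (hi z (hy2.trans hz))]
      ring
  have h2 : HasDerivAt (fun z => ∫ u in (y / 2)..z, f u) (f y) y := by
    refine intervalIntegral.integral_hasDerivAt_right ?_ ?_ (hc.continuousAt (Ioi_mem_nhds hy))
    · rw [intervalIntegrable_iff_integrableOn_Ioc_of_le (by linarith)]
      exact (hi _ hy2).mono_set Ioc_subset_Ioi_self
    · exact hc.stronglyMeasurableAtFilter isOpen_Ioi y hy
  refine (h2.const_sub (∫ u in Ioi (y / 2), f u)).congr_of_eventuallyEq ?_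
  filter_upwards [Ioi_mem_nhds (show y / 2 < y by linarith)] with z hz using h1 z hz

lemma integrableOn_of_bound_exp {f : ℝ → ℂ} (hc : ContinuousOn f (Ioi 0)) {x C δ : ℝ} (hx : 0 < x)
    (hδ : 0 < δ) (hb : ∀ u, x ≤ u → ‖f u‖ ≤ C * Real.exp (-δ * u)) : IntegrableOn f (Ioi x) := by
  refine Integrable.mono' ((integrableOn_exp_mul_Ioi (neg_lt_zero.mpr hδ) x).const_mul C)
    ((hc.mono (Ioi_subset_Ioi hx.le)).aestronglyMeasurable measurableSet_Ioi) ?_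
  exact (ae_restrict_iff' measurableSet_Ioi).mpr (ae_of_all _ fun u hu => hb u (mem_Ioi.mp hu).le)

lemma norm_integral_Ioi_le_of_bound_exp {f : ℝ → ℂ} {x C δ : ℝ}
    (hδ : 0 < δ) (hb : ∀ u, x ≤ u → ‖f u‖ ≤ C * Real.exp (-δ * u)) :
    ‖∫ u in Ioi x, f u‖ ≤ C / δ * Real.exp (-δ * x) := by
  refine (norm_integral_le_of_norm_le
    ((integrableOn_exp_mul_Ioi (neg_lt_zero.mpr hδ) x).const_mul C)
    ((ae_restrict_iff' measurableSet_Ioi).mpr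
      (ae_of_all _ fun u hu => hb u (mem_Ioi.mp hu).le))).trans (le_of_eq ?_)
  rw [integral_const_mul, integral_exp_mul_Ioi (neg_lt_zero.mpr hδ)]
  field_simp

lemma continuousOn_ofReal_cpow (S : ℂ) : ContinuousOn (fun u : ℝ => (u : ℂ) ^ S) (Ioi 0) :=
  fun _ hu => (continuousAt_ofReal_cpow_const _ _
    (Or.inr (mem_Ioi.mp hu).ne')).continuousWithinAt

/-- The regularity properties of `regRem`, proved by induction. -/
structure RegRemGood (r : ℕ) (R : (Fin r → ℂ) → ℝ → ℂ) : Prop where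
  cont : ∀ w, ContinuousOn (R w) (Ioi 0)
  diff : ∀ u, 0 < u → Differentiable ℂ fun w => R w u
  bound : ∀ w₀ x, 0 < x → ∃ ε > 0, ∃ C δ : ℝ, 0 ≤ C ∧ 0 < δ ∧
    ∀ w ∈ Metric.ball w₀ ε, ∀ u, x ≤ u → ‖R w u‖ ≤ C * Real.exp (-δ * u)

section

variable {r : ℕ}

lemma norm_sum_re_le (w : Fin r → ℂ) : ‖∑ i, w i‖ ≤ r * ‖w‖ :=
  (norm_sum_le _ _).trans ((Finset.sum_le_sum fun i _ => norm_le_pi_norm w i).trans (by simp))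

lemma tail_mem_ball {w₀ w : Fin (r + 1) → ℂ} {ε : ℝ} (hε : 0 < ε) (h : w ∈ Metric.ball w₀ ε) :
    (fun i => w i.succ : Fin r → ℂ) ∈ Metric.ball (fun i => w₀ i.succ) ε := by
  rw [Metric.mem_ball, dist_pi_lt_iff hε] at h ⊢
  exact fun i => h i.succ

/-- The integrand of the recursion inherits the properties of `regRem`. -/
lemma RegRemGood.ker {φ : ℝ → ℂ} {c : ℂ} (hφ : IsReg φ c) {R : (Fin r → ℂ) → ℝ → ℂ}
    (hR : RegRemGood r R) (A : ℂ) :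
    RegRemGood (r + 1) fun w => regKer φ c A (R fun i => w i.succ) (∑ i : Fin r, w i.succ) (w 0) where
  cont w := ((hφ.1.mul (hR.cont _)).add ((hφ.1.sub continuousOn_const).mul
    (continuousOn_const.mul (continuousOn_ofReal_cpow _)))).mul (continuousOn_ofReal_cpow _)
  diff u hu := by
    have hu' : (u : ℂ) ≠ 0 := by exact_mod_cast hu.ne'
    have h1 : Differentiable ℂ fun w : Fin (r + 1) → ℂ => R (fun i => w i.succ) u :=
      (hR.diff u hu).comp (differentiable_pi.mpr fun i => differentiable_apply _)
    refine Differentiable.mul (((h1.const_mul _)).add (Differentiable.const_mul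
      (Differentiable.const_mul ?_ _) _)) ?_
    · exact Differentiable.const_cpow (by fun_prop) (Or.inl hu')
    · exact Differentiable.const_cpow (by fun_prop) (Or.inl hu')
  bound w₀ x hx := by
    obtain ⟨B, δ, hB, hδ, hφb⟩ := hφ.exists_bound hx
    obtain ⟨ε, hε, C, δ', hC, hδ', hRb⟩ := hR.bound (fun i => w₀ i.succ) x hx
    set d := min δ δ' with hd
    have hd0 : 0 < d := lt_min hδ hδ'
    -- This bounds the real parts of both exponents on the whole ball. Each of the two powers costs
    -- a quarter of the rate `d`, which leaves `d / 2`.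
    set n := ⌈(r + 1 : ℝ) * (‖w₀‖ + ε) + 1⌉₊ with hn
    obtain ⟨C', hC', hpow⟩ := exists_norm_cpow_le n (show 0 < d / 4 by linarith) hx
    refine ⟨ε, hε, (B * C + B * (‖A‖ * C')) * C', d / 2, by positivity, by linarith,
      fun w hw u hu => ?_⟩
    have hwn : ‖w‖ ≤ ‖w₀‖ + ε := by
      rw [Metric.mem_ball, dist_eq_norm] at hw
      calc ‖w‖ = ‖w₀ + (w - w₀)‖ := by rw [add_sub_cancel]
        _ ≤ ‖w₀‖ + ‖w - w₀‖ := norm_add_le _ _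
        _ ≤ _ := by linarith
    have hn' : (r + 1 : ℝ) * (‖w₀‖ + ε) + 1 ≤ n := Nat.le_ceil _
    have hS : |(∑ i : Fin r, w i.succ).re| ≤ n := by
      refine (abs_re_le_norm _).trans ((norm_sum_re_le _).trans (le_trans ?_ hn'))
      have h1 : ‖(fun i => w i.succ : Fin r → ℂ)‖ ≤ ‖w₀‖ + ε :=
        (pi_norm_le_iff_of_nonneg (by positivity)).mpr fun i => (norm_le_pi_norm w _).trans hwn
      have : (r : ℝ) * ‖(fun i => w i.succ : Fin r → ℂ)‖ ≤ r * (‖w₀‖ + ε) := by gcongr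
      have : 0 ≤ ‖w₀‖ + ε := by positivity
      linarith
    have hw0 : |(w 0 - 1).re| ≤ n := by
      refine (abs_re_le_norm _).trans ((norm_sub_le _ _).trans (le_trans ?_ hn'))
      rw [norm_one]
      have h1 := (norm_le_pi_norm w 0).trans hwn
      have : 0 ≤ (r : ℝ) * (‖w₀‖ + ε) := by positivity
      linarith
    have e1 := hpow u hu _ hS
    have e2 := hpow u hu _ hw0
    have e3 := hRb _ (tail_mem_ball hε hw) u hu
    obtain ⟨e4, e5⟩ := hφb u hu
    have hu0 : 0 < u := hx.trans_le hu
    have m1 : Real.exp (-δ * u) ≤ Real.exp (-d * u) := by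
      apply Real.exp_le_exp.mpr
      have := min_le_left δ δ'
      nlinarith
    have m2 : Real.exp (-δ' * u) ≤ Real.exp (-(3 * d / 4) * u) := by
      apply Real.exp_le_exp.mpr
      have := min_le_right δ δ'
      nlinarith
    have m3 : Real.exp (-d * u) * Real.exp (d / 4 * u) = Real.exp (-(3 * d / 4) * u) := by
      rw [← Real.exp_add]; ring_nf
    have m4 : Real.exp (-(3 * d / 4) * u) * Real.exp (d / 4 * u) = Real.exp (-(d / 2) * u) := by
      rw [← Real.exp_add]; ring_nf
    rw [regKer, norm_mul]
    calc _ ≤ (B * (C * Real.exp (-(3 * d / 4) * u)) +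
          B * Real.exp (-d * u) * (‖A‖ * (C' * Real.exp (d / 4 * u)))) *
          (C' * Real.exp (d / 4 * u)) := by
          refine mul_le_mul ((norm_add_le _ _).trans (add_le_add ?_ ?_)) e2 (norm_nonneg _)
            (by positivity)
          · rw [norm_mul]
            exact mul_le_mul e4 (e3.trans (by gcongr)) (norm_nonneg _) hB
          · rw [norm_mul, norm_mul]
            exact mul_le_mul (e5.trans (by gcongr)) (by gcongr) (by positivity) (by positivity)
      _ = (B * C * Real.exp (-(3 * d / 4) * u) + B * (‖A‖ * C') *
            (Real.exp (-d * u) * Real.exp (d / 4 * u))) * (C' * Real.exp (d / 4 * u)) := by ring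
      _ = (B * C + B * (‖A‖ * C')) * C' *
            (Real.exp (-(3 * d / 4) * u) * Real.exp (d / 4 * u)) := by rw [m3]; ring
      _ = _ := by rw [m4]

lemma RegRemGood.integrableOn {R : (Fin r → ℂ) → ℝ → ℂ} (hR : RegRemGood r R) (w : Fin r → ℂ)
    {y : ℝ} (hy : 0 < y) : IntegrableOn (R w) (Ioi y) := by
  obtain ⟨ε, hε, C, δ, hC, hδ, hb⟩ := hR.bound w y hy
  exact integrableOn_of_bound_exp (hR.cont w) hy hδ fun u hu =>
    hb w (Metric.mem_ball_self hε) u hu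

lemma RegRemGood.integral {R : (Fin r → ℂ) → ℝ → ℂ} (hR : RegRemGood r R) :
    RegRemGood r fun w y => -(∑ i, w i) * ∫ u in Ioi y, R w u where
  cont w y hy := ((hasDerivAt_integral_Ioi (hR.cont w) (fun _ h => hR.integrableOn w h)
    hy).const_mul _).continuousAt.continuousWithinAt
  diff y hy := by
    refine Differentiable.mul (by fun_prop) (differentiable_integral_of_dominated (fun w =>
      ((hR.cont w).mono (Ioi_subset_Ioi hy.le)).aestronglyMeasurable measurableSet_Ioi) ?_ ?_)
    · exact (ae_restrict_iff' measurableSet_Ioi).mpr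
        (ae_of_all _ fun u hu => hR.diff u (hy.trans hu))
    · intro w₀
      obtain ⟨ε, hε, C, δ, hC, hδ, hb⟩ := hR.bound w₀ y hy
      exact ⟨ε, hε, _, (integrableOn_exp_mul_Ioi (neg_lt_zero.mpr hδ) y).const_mul C,
        (ae_restrict_iff' measurableSet_Ioi).mpr
          (ae_of_all _ fun u hu w hw => hb w hw u (mem_Ioi.mp hu).le)⟩
  bound w₀ x hx := by
    obtain ⟨ε, hε, C, δ, hC, hδ, hb⟩ := hR.bound w₀ x hx
    refine ⟨ε, hε, r * (‖w₀‖ + ε) * (C / δ), δ, by positivity, hδ, fun w hw y hy => ?_⟩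
    have hwn : ‖w‖ ≤ ‖w₀‖ + ε := by
      rw [Metric.mem_ball, dist_eq_norm] at hw
      calc ‖w‖ = ‖w₀ + (w - w₀)‖ := by rw [add_sub_cancel]
        _ ≤ ‖w₀‖ + ‖w - w₀‖ := norm_add_le _ _
        _ ≤ _ := by linarith
    have h1 := norm_integral_Ioi_le_of_bound_exp hδ fun u hu => hb w hw u (hy.trans hu)
    rw [norm_mul, norm_neg, mul_assoc]
    exact mul_le_mul ((norm_sum_re_le w).trans (by gcongr)) h1 (norm_nonneg _) (by positivity)

theorem regRemGood : ∀ {r : ℕ} {φ : Fin r → ℝ → ℂ} {c : Fin r → ℂ}, (∀ i, IsReg (φ i) (c i)) →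
    RegRemGood r (regRem r φ c)
  | 0, _, _, _ => by
    refine ⟨fun w => continuousOn_const, fun u _ => differentiable_const _,
      fun _ _ _ => ⟨1, one_pos, 0, 1, le_rfl, one_pos, fun w _ u _ => ?_⟩⟩
    simp [regRem]
  | r + 1, φ, c, h => by
    have ih := regRemGood (φ := fun i => φ i.succ) (c := fun i => c i.succ) fun i => h i.succ
    exact (ih.ker (h 0) (∏ i : Fin r, c i.succ)).integral

lemma regDen_succ (w : Fin (r + 1) → ℂ) :
    regDen (r + 1) w = -(∑ i, w i) * regDen r fun i => w i.succ := by
  rw [regDen, Fin.prod_univ_succ, show Finset.Ici (0 : Fin (r + 1)) = Finset.univ from by ext; simp]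
  congr 1
  refine Finset.prod_congr rfl fun i _ => ?_
  rw [← Fin.map_succEmb_Ici, Finset.sum_map]
  rfl

variable {φ : Fin r → ℝ → ℂ} {c : Fin r → ℂ}

lemma differentiable_regNum (h : ∀ i, IsReg (φ i) (c i)) {y : ℝ} (hy : 0 < y) :
    Differentiable ℂ fun w => regNum r φ c w y :=
  ((regRemGood h).diff y hy).add (Differentiable.const_mul
    (Differentiable.const_cpow (by fun_prop) (Or.inl (by exact_mod_cast hy.ne'))) _)

lemma differentiable_regDen : Differentiable ℂ (regDen r) := by
  unfold regDen
  fun_prop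

lemma hasDerivAt_ofReal_cpow' (S : ℂ) {y : ℝ} (hy : 0 < y) :
    HasDerivAt (fun y : ℝ => (y : ℂ) ^ S) (S * (y : ℂ) ^ (S - 1)) y := by
  have := (hasDerivAt_id (y : ℂ)).cpow_const (c := S) (Or.inl (by simpa using hy))
  simpa using this.comp_ofReal

/-- Differentiating the explicit power restores exactly the term `c A u^S` that `regKer` leaves out.
No condition on `w` is needed, so the fundamental theorem of calculus persists for the continued
integrals. -/
lemma hasDerivAt_regNum {φ : Fin (r + 1) → ℝ → ℂ} {c : Fin (r + 1) → ℂ}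
    (h : ∀ i, IsReg (φ i) (c i)) (w : Fin (r + 1) → ℂ) {y : ℝ} (hy : 0 < y) :
    HasDerivAt (regNum (r + 1) φ c w) ((∑ i, w i) * (φ 0 y * (y : ℂ) ^ (w 0 - 1) *
      regNum r (fun i => φ i.succ) (fun i => c i.succ) (fun i => w i.succ) y)) y := by
  have ih := regRemGood (φ := fun i => φ i.succ) (c := fun i => c i.succ) fun i => h i.succ
  have hk := ih.ker (h 0) (∏ i : Fin r, c i.succ)
  have h1 := (hasDerivAt_integral_Ioi (hk.cont w) (fun _ h => hk.integrableOn w h) hy).const_mul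
    (-(∑ i, w i))
  have h2 := (hasDerivAt_ofReal_cpow' (∑ i, w i) hy).const_mul (∏ i, c i)
  refine (h1.add h2).congr_deriv ?_
  have h3 : (y : ℂ) ^ (∑ i, w i - 1) = (y : ℂ) ^ (∑ i : Fin r, w i.succ) * (y : ℂ) ^ (w 0 - 1) := by
    rw [← cpow_add _ _ (by exact_mod_cast hy.ne'), Fin.sum_univ_succ]
    congr 1
    ring
  rw [h3, regKer, regNum, Fin.prod_univ_succ]
  ring

lemma norm_ofReal_cpow_Ioi {y : ℝ} (hy : 0 < y) (S : ℂ) : ‖(y : ℂ) ^ S‖ = y ^ S.re :=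
  norm_cpow_eq_rpow_re_of_pos hy S

/-- The integrand of the iterated integral over `y < u₁ < ⋯ < u_r`. -/
def powIntegrand (φ : Fin r → ℝ → ℂ) (w : Fin r → ℂ) (u : Fin r → ℝ) : ℂ :=
  ∏ i, φ i (u i) * (u i : ℂ) ^ (w i - 1)

lemma continuousOn_powIntegrand (h : ∀ i, ContinuousOn (φ i) (Ioi 0)) (w : Fin r → ℂ) {x : ℝ}
    (hx : 0 ≤ x) : ContinuousOn (powIntegrand φ w) (simplex r (Ioi x)) := by
  refine continuousOn_finsetProd _ fun i _ => ?_
  have hm : MapsTo (fun u : Fin r → ℝ => u i) (simplex r (Ioi x)) (Ioi 0) :=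
    fun u hu => hx.trans_lt (hu.2 i)
  exact ((h i).mul (continuousOn_ofReal_cpow _)).comp (continuous_apply i).continuousOn hm

lemma tail_mem_domInfty {w : Fin (r + 1) → ℂ} (hw : w ∈ domInfty (r + 1)) :
    (fun i => w i.succ : Fin r → ℂ) ∈ domInfty r := fun i => by
  have := hw i.succ
  rwa [← Fin.map_succEmb_Ici, Finset.sum_map] at this

lemma sum_re_neg_of_mem_domInfty {w : Fin (r + 1) → ℂ} (hw : w ∈ domInfty (r + 1)) :
    (∑ i, w i).re < 0 := by
  have := hw 0
  rwa [show Finset.Ici (0 : Fin (r + 1)) = Finset.univ from by ext; simp] at this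

/-- A bound by the power `x^(Re ∑ w)`, uniform for `x ≥ x₀`, reproduces itself under integration as
long as the exponent is negative. This makes Fubini's theorem available at each stage, and the same
power later gives the vanishing of integrals to `0`. -/
lemma powIntegrand_succ_aux {φ : Fin (r + 1) → ℝ → ℂ} {c : Fin (r + 1) → ℂ}
    (h : ∀ i, IsReg (φ i) (c i)) {w : Fin (r + 1) → ℂ} (hw : w ∈ domInfty (r + 1)) {x₀ C : ℝ}
    (hx₀ : 0 < x₀) (hC : 0 ≤ C)
    (ih : ∀ x, x₀ ≤ x →
      IntegrableOn (powIntegrand (fun i => φ i.succ) (fun i => w i.succ)) (simplex r (Ioi x)) ∧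
      ∫ u in simplex r (Ioi x), ‖powIntegrand (fun i => φ i.succ) (fun i => w i.succ) u‖ ≤
        C * x ^ (∑ i : Fin r, w i.succ).re) :
    ∃ C' : ℝ, 0 ≤ C' ∧ ∀ x, x₀ ≤ x → IntegrableOn (powIntegrand φ w) (simplex (r + 1) (Ioi x)) ∧
      ∫ u in simplex (r + 1) (Ioi x), powIntegrand φ w u =
        ∫ a in Ioi x, φ 0 a * (a : ℂ) ^ (w 0 - 1) *
          ∫ v in simplex r (Ioi a), powIntegrand (fun i => φ i.succ) (fun i => w i.succ) v ∧
      ∫ u in simplex (r + 1) (Ioi x), ‖powIntegrand φ w u‖ ≤ C' * x ^ (∑ i, w i).re := by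
  obtain ⟨B, δ, hB, -, hφ⟩ := (h 0).exists_bound hx₀
  have hneg := sum_re_neg_of_mem_domInfty hw
  have hb : ∀ x, x₀ ≤ x → ∀ a, x < a → ‖φ 0 a * (a : ℂ) ^ (w 0 - 1)‖ *
      ∫ v in simplex r (Ioi a), ‖powIntegrand (fun i => φ i.succ) (fun i => w i.succ) v‖ ≤
        B * C * a ^ ((∑ i, w i).re - 1) := fun x hx a ha => by
    have ha0 : 0 < a := (hx₀.trans_le hx).trans ha
    have h1 : a ^ ((∑ i, w i).re - 1) = a ^ (w 0 - 1).re * a ^ (∑ i : Fin r, w i.succ).re := by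
      rw [← Real.rpow_add ha0, Fin.sum_univ_succ]
      congr 1
      simp only [add_re, sub_re, one_re]
      ring
    rw [norm_mul, norm_ofReal_cpow_Ioi ha0, h1]
    calc _ ≤ B * a ^ (w 0 - 1).re * (C * a ^ (∑ i : Fin r, w i.succ).re) :=
          mul_le_mul (mul_le_mul_of_nonneg_right (hφ a (hx.trans ha.le)).1 (by positivity))
            (ih a (hx.trans ha.le)).2 (integral_nonneg fun _ => norm_nonneg _) (by positivity)
      _ = _ := by ring
  have hfac : ∀ u : Fin (r + 1) → ℝ, powIntegrand φ w u = φ 0 (u 0) * (u 0 : ℂ) ^ (w 0 - 1) *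
      powIntegrand (fun i => φ i.succ) (fun i => w i.succ) (Fin.tail u) := fun u => by
    rw [powIntegrand, Fin.prod_univ_succ]; rfl
  have hbi : ∀ x, x₀ ≤ x → IntegrableOn (fun a => B * C * a ^ ((∑ i, w i).re - 1)) (Ioi x) :=
    fun x hx => (integrableOn_Ioi_rpow_of_lt (by linarith) (hx₀.trans_le hx)).const_mul _
  refine ⟨B * C / -(∑ i, w i).re, div_nonneg (by positivity) (by linarith), fun x hx => ?_⟩
  have hx0 := hx₀.trans_le hx
  have hcont := continuousOn_powIntegrand (fun i => (h i).1) w hx0.le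
  have h1 := integral_simplex_succ (p := fun a => φ 0 a * (a : ℂ) ^ (w 0 - 1))
    (q := powIntegrand (fun i => φ i.succ) (fun i => w i.succ))
    (hcont.congr fun u _ => (hfac u).symm) (fun a ha => (ih a (hx.trans ha.le)).1) (hbi x hx)
    (hb x hx)
  have hfac' := funext hfac
  rw [hfac']
  refine ⟨h1.1, h1.2.1, ?_⟩
  refine h1.2.2.trans (le_of_eq ?_)
  rw [integral_const_mul, integral_Ioi_rpow_of_lt (by linarith) hx0, sub_add_cancel]
  have : (∑ i, w i).re ≠ 0 := hneg.ne
  field_simp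

lemma integrableOn_powIntegrand : ∀ {r : ℕ} {φ : Fin r → ℝ → ℂ} {c : Fin r → ℂ},
    (∀ i, IsReg (φ i) (c i)) → ∀ {w : Fin r → ℂ}, w ∈ domInfty r → ∀ {x₀ : ℝ}, 0 < x₀ →
    ∃ C : ℝ, 0 ≤ C ∧ ∀ x, x₀ ≤ x → IntegrableOn (powIntegrand φ w) (simplex r (Ioi x)) ∧
      ∫ u in simplex r (Ioi x), ‖powIntegrand φ w u‖ ≤ C * x ^ (∑ i, w i).re
  | 0, φ, c, _, w, _, x₀, hx₀ => by
    refine ⟨1, zero_le_one, fun x hx => ⟨Integrable.of_finite, ?_⟩⟩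
    have : simplex 0 (Ioi x) = univ :=
      eq_univ_of_forall fun u => ⟨fun i => i.elim0, fun i => i.elim0⟩
    simp [this, powIntegrand, Measure.volume_pi_eq_dirac (0 : Fin 0 → ℝ)]
  | r + 1, φ, c, h, w, hw, x₀, hx₀ => by
    obtain ⟨C, hC, ih⟩ := integrableOn_powIntegrand (φ := fun i => φ i.succ)
      (c := fun i => c i.succ) (fun i => h i.succ) (tail_mem_domInfty hw) hx₀
    obtain ⟨C', hC', h'⟩ := powIntegrand_succ_aux h hw hx₀ hC ih
    exact ⟨C', hC', fun x hx => ⟨(h' x hx).1, (h' x hx).2.2⟩⟩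

lemma integral_powIntegrand_succ {φ : Fin (r + 1) → ℝ → ℂ} {c : Fin (r + 1) → ℂ}
    (h : ∀ i, IsReg (φ i) (c i)) {w : Fin (r + 1) → ℂ} (hw : w ∈ domInfty (r + 1)) {x : ℝ}
    (hx : 0 < x) :
    ∫ u in simplex (r + 1) (Ioi x), powIntegrand φ w u =
      ∫ a in Ioi x, φ 0 a * (a : ℂ) ^ (w 0 - 1) *
        ∫ v in simplex r (Ioi a), powIntegrand (fun i => φ i.succ) (fun i => w i.succ) v := by
  obtain ⟨C, hC, ih⟩ := integrableOn_powIntegrand (fun i => h i.succ) (tail_mem_domInfty hw) hx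
  obtain ⟨C', hC', h'⟩ := powIntegrand_succ_aux h hw hx hC ih
  exact (h' x le_rfl).2.1

lemma integral_Ioi_ofReal_cpow {S : ℂ} (hS : S.re < 0) {x : ℝ} (hx : 0 < x) :
    IntegrableOn (fun u : ℝ => (u : ℂ) ^ (S - 1)) (Ioi x) ∧
      -S * ∫ u in Ioi x, (u : ℂ) ^ (S - 1) = (x : ℂ) ^ S := by
  have h1 : (S - 1).re < -1 := by rw [sub_re, one_re]; linarith
  have hS0 : S ≠ 0 := fun h => by simp [h] at hS
  refine ⟨integrableOn_Ioi_cpow_of_lt h1 hx, ?_⟩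
  rw [integral_Ioi_cpow_of_lt h1 hx, sub_add_cancel]
  field_simp

/-- In the domain of convergence the iterated integral is a quotient of entire functions. -/
theorem regNum_eq_regDen_mul_integral : ∀ {r : ℕ} {φ : Fin r → ℝ → ℂ} {c : Fin r → ℂ},
    (∀ i, IsReg (φ i) (c i)) → ∀ {w : Fin r → ℂ}, w ∈ domInfty r → ∀ {x : ℝ}, 0 < x →
    regNum r φ c w x = regDen r w * ∫ u in simplex r (Ioi x), powIntegrand φ w u
  | 0, φ, c, _, w, _, x, hx => by
    have : simplex 0 (Ioi x) = univ :=
      eq_univ_of_forall fun u => ⟨fun i => i.elim0, fun i => i.elim0⟩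
    simp [regNum, regRem, regDen, this, powIntegrand, Measure.volume_pi_eq_dirac (0 : Fin 0 → ℝ)]
  | r + 1, φ, c, h, w, hw, x, hx => by
    have htail := fun i : Fin r => h i.succ
    have ih := fun (a : ℝ) (ha : 0 < a) =>
      regNum_eq_regDen_mul_integral htail (tail_mem_domInfty hw) ha
    have h2 := integral_powIntegrand_succ h hw hx
    have hneg := sum_re_neg_of_mem_domInfty hw
    obtain ⟨hI, hIeq⟩ := integral_Ioi_ofReal_cpow hneg hx
    have hk := (regRemGood htail).ker (h 0) (∏ i : Fin r, c i.succ)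
    rw [h2, regDen_succ, mul_assoc, ← integral_const_mul, regNum, regRem, ← hIeq,
      mul_left_comm, ← mul_add, ← integral_const_mul, ← integral_add (hk.integrableOn w hx)
        (hI.const_mul _)]
    congr 1
    refine setIntegral_congr_fun measurableSet_Ioi fun a ha => ?_
    have ha0 : 0 < a := hx.trans ha
    have h3 : (a : ℂ) ^ (∑ i, w i - 1) =
        (a : ℂ) ^ (∑ i : Fin r, w i.succ) * (a : ℂ) ^ (w 0 - 1) := by
      rw [← cpow_add _ _ (by exact_mod_cast ha0.ne'), Fin.sum_univ_succ]
      congr 1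
      ring
    have h4 := ih a ha0
    simp only [h3]
    -- The regularised kernel plus the pure power is `φ` times the numerator of the inner integral:
    -- `(φ R + (φ - c) A a^S) + c A a^S = φ (R + A a^S)`.
    rw [mul_left_comm (regDen r _), ← h4, regKer, regNum, Fin.prod_univ_succ]
    ring

end

/-! ### The index sets of the formula -/

lemma idx_eq {l : ℕ} (ν : Fin (l + 1) → ℕ) (i : ℕ) :
    idx ν i = (∑ r : Fin (l + 1), if (r : ℕ) < i then ν r else 0) + i := by
  rw [idx, Finset.sum_filter]

lemma le_idx {l : ℕ} (ν : Fin (l + 1) → ℕ) (i : ℕ) : i ≤ idx ν i := Nat.le_add_left _ _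

@[simp] lemma idx_zero {l : ℕ} (ν : Fin (l + 1) → ℕ) : idx ν 0 = 0 := by simp [idx]

lemma idx_strictMono {l : ℕ} (ν : Fin (l + 1) → ℕ) : StrictMono (idx ν) := by
  refine strictMono_nat_of_lt_succ fun i => ?_
  rw [idx, idx]
  have : ∑ r ∈ Finset.univ.filter (fun r : Fin (l + 1) => (r : ℕ) < i), ν r ≤
      ∑ r ∈ Finset.univ.filter (fun r : Fin (l + 1) => (r : ℕ) < i + 1), ν r :=
    Finset.sum_le_sum_of_subset fun r hr => by
      simp only [Finset.mem_filter, Finset.mem_univ, true_and] at hr ⊢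
      omega
  omega

lemma mem_nuTuples {n l : ℕ} {ν : Fin (l + 1) → ℕ} : ν ∈ nuTuples n l ↔ ∑ i, ν i = n - l :=
  Finset.Nat.mem_antidiagonalTuple

lemma last_add_idx {n l : ℕ} (hl : l ≤ n) {ν : Fin (l + 1) → ℕ} (hν : ν ∈ nuTuples n l) :
    ν (Fin.last l) + idx ν l = n := by
  rw [mem_nuTuples, Fin.sum_univ_castSucc] at hν
  rw [idx_eq, Fin.sum_univ_castSucc]
  simp only [Fin.val_castSucc, Fin.is_lt, if_true, Fin.val_last, lt_irrefl, if_false]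
  omega

/-- `(n₁ + 1, n₂, …)`. -/
def bump {l : ℕ} (ν : Fin (l + 1) → ℕ) : Fin (l + 1) → ℕ := Fin.cons (ν 0 + 1) (Fin.tail ν)

/-- `(0, n₁, n₂, …)`. -/
def consZero {l : ℕ} (ν : Fin (l + 1) → ℕ) : Fin (l + 1 + 1) → ℕ := Fin.cons 0 ν

lemma idx_bump {l : ℕ} (ν : Fin (l + 1) → ℕ) {i : ℕ} (hi : 1 ≤ i) :
    idx (bump ν) i = idx ν i + 1 := by
  rw [idx_eq, idx_eq, Fin.sum_univ_succ, Fin.sum_univ_succ]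
  simp [bump, Fin.tail, show 0 < i from hi]
  omega

lemma idx_consZero {l : ℕ} (ν : Fin (l + 1) → ℕ) (i : ℕ) :
    idx (consZero ν) (i + 1) = idx ν i + 1 := by
  rw [idx_eq, idx_eq, Fin.sum_univ_succ]
  simp [consZero]
  omega

lemma bump_last {l : ℕ} (hl : 1 ≤ l) (ν : Fin (l + 1) → ℕ) :
    bump ν (Fin.last l) = ν (Fin.last l) := by
  obtain ⟨l, rfl⟩ := Nat.exists_eq_add_of_le' hl
  rw [← Fin.succ_last, bump, Fin.cons_succ, Fin.tail]

lemma consZero_last {l : ℕ} (ν : Fin (l + 1) → ℕ) :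
    consZero ν (Fin.last (l + 1)) = ν (Fin.last l) := by
  rw [← Fin.succ_last, consZero, Fin.cons_succ]

/-- Either `n₁ = 0`, so that the index `1` is selected and dropping `n₁` leaves a shorter tuple, or
`n₁` can be lowered by one. The condition `l + 1 ≤ n` guards against truncated subtraction, which
would add a spurious zero tuple. -/
lemma sum_nuTuples_succ {n l : ℕ} (hl : l ≤ n) (g : (Fin (l + 1 + 1) → ℕ) → ℂ) :
    ∑ ν ∈ nuTuples (n + 1) (l + 1), g ν =
      (∑ ν ∈ nuTuples n l, g (consZero ν)) +
        if l + 1 ≤ n then ∑ ν ∈ nuTuples n (l + 1), g (bump ν) else 0 := by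
  classical
  rw [← Finset.sum_filter_add_sum_filter_not _ (fun ν => ν 0 = 0)]
  congr 1
  · refine Finset.sum_bij' (fun ν _ => Fin.tail ν) (fun ν _ => consZero ν) ?_ ?_ ?_ ?_ ?_
    · intro ν hν
      simp only [Finset.mem_filter, mem_nuTuples, Fin.sum_univ_succ ν] at hν ⊢
      simp only [Fin.tail]
      omega
    · intro ν hν
      rw [mem_nuTuples] at hν
      rw [Finset.mem_filter, mem_nuTuples, consZero, Fin.sum_cons, hν, Fin.cons_zero]
      omega
    · intro ν hν
      rw [Finset.mem_filter] at hν
      rw [consZero, ← hν.2, Fin.cons_self_tail]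
    · intro ν hν
      rw [consZero, Fin.tail_cons]
    · intro ν hν
      rw [Finset.mem_filter] at hν
      rw [consZero, ← hν.2, Fin.cons_self_tail]
  · split_ifs with h
    · refine Finset.sum_bij' (fun ν _ => Fin.cons (ν 0 - 1) (Fin.tail ν)) (fun ν _ => bump ν)
        ?_ ?_ ?_ ?_ ?_
      · intro ν hν
        simp only [Finset.mem_filter, mem_nuTuples, Fin.sum_univ_succ, Fin.cons_zero,
          Fin.cons_succ, Fin.tail] at hν ⊢
        omega
      · intro ν hν
        simp only [Finset.mem_filter, mem_nuTuples, Fin.sum_univ_succ, Fin.cons_zero,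
          Fin.cons_succ, bump, Fin.tail] at hν ⊢
        omega
      · intro ν hν
        rw [Finset.mem_filter] at hν
        rw [bump, Fin.cons_zero, Fin.tail_cons, Nat.sub_add_cancel (by omega), Fin.cons_self_tail]
      · intro ν hν
        rw [bump, Fin.cons_zero, Fin.tail_cons, Nat.add_sub_cancel, Fin.cons_self_tail]
      · intro ν hν
        rw [Finset.mem_filter] at hν
        rw [bump, Fin.cons_zero, Fin.tail_cons, Nat.sub_add_cancel (by omega), Fin.cons_self_tail]
    · refine Finset.sum_eq_zero fun ν hν => ?_
      simp only [Finset.mem_filter, mem_nuTuples, Fin.sum_univ_succ ν] at hν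
      omega

lemma nuTuples_zero_right (n : ℕ) : nuTuples n 0 = {fun _ => n} := by
  ext ν
  rw [mem_nuTuples, Finset.mem_singleton, Fin.sum_univ_one]
  constructor
  · intro h
    ext i
    rw [Fin.fin_one_eq_zero i, h, Nat.sub_zero]
  · rintro rfl
    rfl

/-- The recursion for the outer sums of the formula. -/
lemma sum_sum_nuTuples_succ (n : ℕ) (g : (l : ℕ) → (Fin (l + 1) → ℕ) → ℂ) :
    ∑ l ∈ Finset.Icc 1 (n + 1), ∑ ν ∈ nuTuples (n + 1) l, g l ν =
      g 1 (consZero fun _ => n) +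
        ∑ l ∈ Finset.Icc 1 n, ∑ ν ∈ nuTuples n l, (g (l + 1) (consZero ν) + g l (bump ν)) := by
  have hI : ∀ (m : ℕ) (h : ℕ → ℂ), ∑ l ∈ Finset.Icc 1 m, h l = ∑ l ∈ Finset.range m, h (l + 1) :=
    fun m h => by
      rw [Finset.range_eq_Ico, Finset.sum_Ico_add' (fun l => h l) 0 m 1]
      rfl
  rw [hI, hI]
  have h1 : ∀ l ∈ Finset.range (n + 1), ∑ ν ∈ nuTuples (n + 1) (l + 1), g (l + 1) ν =
      (∑ ν ∈ nuTuples n l, g (l + 1) (consZero ν)) +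
        if l + 1 ≤ n then ∑ ν ∈ nuTuples n (l + 1), g (l + 1) (bump ν) else 0 := fun l hl =>
    sum_nuTuples_succ (by simpa [Nat.lt_succ_iff] using hl) _
  -- For `l = 0` the first sum has the single tuple `(n)`, which produces the isolated term; in the
  -- second sum the top value of `l` drops out.
  rw [Finset.sum_congr rfl h1, Finset.sum_add_distrib, Finset.sum_range_succ', nuTuples_zero_right,
    Finset.sum_singleton, Finset.sum_range_succ _ n, if_neg (by omega), add_zero]
  have h2 : ∀ l ∈ Finset.range n, (if l + 1 ≤ n then ∑ ν ∈ nuTuples n (l + 1), g (l + 1) (bump ν)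
      else 0) = ∑ ν ∈ nuTuples n (l + 1), g (l + 1) (bump ν) := fun l hl =>
    if_pos (by simpa [Nat.succ_le_iff] using hl)
  rw [Finset.sum_congr rfl h2]
  simp only [Finset.sum_add_distrib]
  ring

/-- `(i, j₂, j₃, …)` with the indices shifted by one. -/
def shiftCons (i : ℕ) (j : ℕ →₀ ℕ) : ℕ →₀ ℕ :=
  j.mapDomain (· + 1) + Finsupp.single 2 i

lemma shiftCons_succ (i : ℕ) (j : ℕ →₀ ℕ) (r : ℕ) :
    shiftCons i j (r + 1) = j r + if r = 1 then i else 0 := by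
  rw [shiftCons, Finsupp.add_apply, Finsupp.mapDomain_apply (add_left_injective 1),
    Finsupp.single_apply]
  congr 1
  simp [eq_comm]

lemma shiftCons_zero (i : ℕ) (j : ℕ →₀ ℕ) : shiftCons i j 0 = 0 := by
  rw [shiftCons, Finsupp.add_apply, Finsupp.mapDomain_of_notMem_range _ _ (by simp)]
  simp

/-- The lowest entry occurs in one constraint only, its own upper bound, which depends on the next
entry. It can therefore be summed last, and the remaining entries form a tuple of the smaller set
after a shift of indices. -/
lemma sum_jSet_succ {M : ℕ} (hM : 1 ≤ M) {b b' : ℕ → ℕ} (hb : ∀ r, 1 ≤ r → b' (r + 1) = b r)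
    (g : (ℕ →₀ ℕ) → ℂ) :
    ∑ j ∈ (jSet_finite (M + 1) b').toFinset, g j =
      ∑ j ∈ (jSet_finite M b).toFinset, ∑ i ∈ Finset.range (b 1 + j 2), g (shiftCons i j) := by
  rw [Finset.sum_sigma']
  symm
  refine Finset.sum_bij' (fun x _ => shiftCons x.2 x.1)
    (fun j _ => ⟨(j.erase 2).comapDomain (· + 1) (add_left_injective 1).injOn, j 2⟩) ?_ ?_ ?_ ?_ ?_
  · rintro ⟨j, i⟩ h
    simp only [Finset.mem_sigma, Set.Finite.mem_toFinset, Finset.mem_range, jSet,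
      Set.mem_ofPred_eq] at h ⊢
    obtain ⟨⟨h0, h1⟩, h2⟩ := h
    constructor
    · intro r hr
      rcases r with _ | r
      · exact shiftCons_zero _ _
      · rw [shiftCons_succ, h0 r (by omega), if_neg (by omega)]
    · intro r hr hr'
      rcases r with _ | r
      · omega
      · rw [shiftCons_succ, shiftCons_succ, hb r (by omega), if_neg (show ¬ r + 1 = 1 by omega),
          add_zero]
        rcases eq_or_ne r 1 with rfl | h3
        · rw [if_pos rfl, h0 1 (by omega), zero_add]
          exact h2
        · rw [if_neg h3]
          exact h1 r (by omega) (by omega)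
  · intro j h
    simp only [Finset.mem_sigma, Set.Finite.mem_toFinset, Finset.mem_range, jSet,
      Set.mem_ofPred_eq, Finsupp.comapDomain_apply] at h ⊢
    obtain ⟨h0, h1⟩ := h
    have key : ∀ r, r ≠ 1 → (j.erase 2) (r + 1) = j (r + 1) := fun r hr =>
      Finsupp.erase_ne (by omega)
    refine ⟨⟨fun r hr => ?_, fun r hr hr' => ?_⟩, ?_⟩
    · by_cases h3 : r = 1
      · rw [h3]; exact Finsupp.erase_same
      · rw [key r h3]; exact h0 _ (by omega)
    · rw [key r (by omega), key (r + 1) (by omega), ← hb r (by omega)]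
      exact h1 (r + 1) (by omega) (by omega)
    · rw [key 2 (by omega), ← hb 1 le_rfl]
      exact h1 2 le_rfl (by omega)
  · rintro ⟨j, i⟩ h
    simp only [Finset.mem_sigma, Set.Finite.mem_toFinset, jSet, Set.mem_ofPred_eq] at h
    have h1 : j 1 = 0 := h.1.1 1 (by omega)
    have h2 : shiftCons i j 2 = i := by rw [shiftCons_succ, if_pos rfl, h1, zero_add]
    ext1
    · ext r
      rw [Finsupp.comapDomain_apply]
      by_cases h3 : r = 1
      · rw [h3]; exact (Finsupp.erase_same).trans h1.symm
      · rw [Finsupp.erase_ne (by omega), shiftCons_succ, if_neg h3, add_zero]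
    · exact heq_of_eq h2
  · intro j h
    simp only [Set.Finite.mem_toFinset, jSet, Set.mem_ofPred_eq] at h
    ext r
    rcases r with _ | r
    · rw [shiftCons_zero, h.1 0 (by omega)]
    · rw [shiftCons_succ, Finsupp.comapDomain_apply]
      by_cases h3 : r = 1
      · rw [h3, if_pos rfl, Finsupp.erase_same, zero_add]
      · rw [Finsupp.erase_ne (by omega), if_neg h3, add_zero]
  · intro x h
    rfl

/-! ### The terms of the expansion of iterated integrals from infinity -/

/-- The exponent of `z` in the terms of the integrand. -/
def powExp (n M : ℕ) (α : ℕ → ℕ) (j : ℕ → ℕ) : ℕ :=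
  if M = 1 then ∑ r ∈ Finset.Icc 2 n, α r else j 2

/-- The denominator that belongs to the power of `z`. -/
def powDen (M : ℕ) (j : ℕ → ℕ) : ℂ := if M = 1 then 1 else ((j 2).factorial : ℂ)

/-- The part of the Gamma factor which does not contain the first argument, up to a sign. -/
def gammaTail (n M : ℕ) (α : ℕ → ℕ) : ℂ :=
  (-1) ^ (M - 1) * (∏ r ∈ Finset.Icc 2 (M - 1), Gamma (α r)) *
    if M = 1 then 1 else Gamma (∑ r ∈ Finset.Icc M n, (α r : ℂ))

/-- The coefficients of the expansion. -/
def tailCoef (n M : ℕ) (α : ℕ → ℕ) (j : ℕ → ℕ) : ℂ :=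
  gammaTail n M α * ∏ k ∈ Finset.Icc 3 M, ((α (k - 1) + j k - 1).choose (j k) : ℂ)

/-- The first argument in the expansion of the integrand. -/
def tailArg (n : ℕ) {l : ℕ} (ν : Fin (l + 1) → ℕ) (α : ℕ → ℕ) (j : ℕ → ℕ) : ℂ :=
  (∑ r ∈ Finset.Icc 2 (upper n ν 1), (α r : ℂ)) + (j (idx ν 1 + 1) : ℂ) -
    powExp n (idx ν l) α j

/-- The function that belongs to a tuple `j` in the expansion of the integrand. -/
def innerW (n : ℕ) {l : ℕ} (ν : Fin (l + 1) → ℕ) (a : ℕ → ℕ → ℂ) (α : ℕ → ℕ) (j : ℕ → ℕ)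
    (y : ℝ) : ℂ :=
  (I * y) ^ powExp n (idx ν l) α j / powDen (idx ν l) j *
    expSum l (fun i => a (idx ν i)) (consArg (tailArg n ν α j) (otherArg n ν α j)) y

/-- The term that belongs to `ν` in the expansion of the integrand of the outermost integral. -/
def termD (n : ℕ) {l : ℕ} (ν : Fin (l + 1) → ℕ) (a : ℕ → ℕ → ℂ) (α : ℕ → ℕ) (y : ℝ) : ℂ :=
  coeffB n (ν (Fin.last l)) (fun r => (α r : ℂ)) *
    ∑ j ∈ jTuples n (idx ν l) α, tailCoef n (idx ν l) α j * innerW n ν a α j y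

/-- The product of constant terms that belongs to `ν`. -/
def constProd (n : ℕ) {l : ℕ} (a : ℕ → ℕ → ℂ) (ν : Fin (l + 1) → ℕ) : ℂ :=
  ∏ i ∈ Finset.Icc 1 n \ (Finset.Icc 1 l).image (idx ν), a i 0

/-- Both sides are `Γ(s) s (s+1) ⋯ (s+j-1) / j!`. The binomial coefficients of the formula arise in
this way from Mellin transforms of powers divided by factorials. -/
lemma Gamma_add_natCast_div {s : ℂ} (hs : ∀ m : ℕ, s ≠ -(m : ℂ)) (j : ℕ) :
    Gamma (s + j) / (j.factorial : ℂ) = Gamma s * Ring.choose (s + j - 1) j := by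
  have h1 : ∀ j : ℕ, Gamma (s + j) = Gamma s * (ascPochhammer ℂ j).eval s := fun j => by
    induction j with
    | zero => simp
    | succ j ih =>
      have h2 : s + j ≠ 0 := fun h => hs j (eq_neg_of_add_eq_zero_left h)
      rw [Nat.cast_succ, ← add_assoc, Gamma_add_one _ h2, ih, ascPochhammer_succ_eval]
      ring
  have h2 : (j.factorial : ℂ) * Ring.choose (s + j - 1) j = (ascPochhammer ℂ j).eval s := by
    rw [← nsmul_eq_mul, ← Ring.multichoose_eq, Ring.factorial_nsmul_multichoose_eq_ascPochhammer,
      ← Polynomial.ascPochhammer_smeval_eq_eval]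
  rw [h1, ← h2]
  have : (j.factorial : ℂ) ≠ 0 := by exact_mod_cast j.factorial_ne_zero
  field_simp

/-- The Gamma factor that contains the first argument. -/
def gammaHead (n M : ℕ) (s : ℂ) (α : ℕ → ℕ) : ℂ :=
  if M = 1 then Gamma (s + ∑ r ∈ Finset.Icc 2 n, (α r : ℂ)) else Gamma s

lemma sum_args_Icc_one {n : ℕ} (hn : 1 ≤ n) (s : ℂ) (α : ℕ → ℕ) :
    ∑ r ∈ Finset.Icc 1 n, args s α r = s + ∑ r ∈ Finset.Icc 2 n, (α r : ℂ) := by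
  rw [← Finset.insert_Icc_add_one_left_eq_Icc hn, Finset.sum_insert (by simp)]
  congr 1
  refine Finset.sum_congr rfl fun r hr => ?_
  rw [Finset.mem_Icc] at hr
  exact if_neg (by omega)

lemma args_of_two_le {s : ℂ} {α : ℕ → ℕ} {r : ℕ} (hr : 2 ≤ r) : args s α r = α r :=
  if_neg (by omega)

lemma gammaFactor_eq {n M : ℕ} (hM : 1 ≤ M) (hMn : M ≤ n) (s : ℂ) (α : ℕ → ℕ) :
    gammaFactor n M s α = -gammaHead n M s α * gammaTail n M α := by
  rcases eq_or_ne M 1 with rfl | h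
  · simp [gammaFactor, gammaHead, gammaTail, sum_args_Icc_one hMn]
  · have h2 : 2 ≤ M := by omega
    obtain ⟨m, rfl⟩ := Nat.exists_eq_add_of_le' h2
    rw [gammaFactor, gammaHead, gammaTail, if_neg h, if_neg h, Nat.add_sub_assoc (by norm_num),
      ← Finset.insert_Icc_add_one_left_eq_Icc (show 1 ≤ m + (2 - 1) by omega),
      Finset.prod_insert (by simp)]
    have h3 : ∏ r ∈ Finset.Icc (1 + 1) (m + (2 - 1)), Gamma (args s α r) =
        ∏ r ∈ Finset.Icc 2 (m + (2 - 1)), Gamma (α r) := Finset.prod_congr rfl fun r hr => by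
      rw [args_of_two_le (Finset.mem_Icc.mp hr).1]
    have h4 : ∑ r ∈ Finset.Icc (m + 2) n, args s α r = ∑ r ∈ Finset.Icc (m + 2) n, (α r : ℂ) :=
      Finset.sum_congr rfl fun r hr => args_of_two_le (by rw [Finset.mem_Icc] at hr; omega)
    rw [h3, h4, show args s α 1 = s from rfl]
    simp only [Nat.reduceSub, pow_succ]
    ring

/-- The coefficients of the formula in terms of those of the expansion of the integrand. -/
lemma gammaFactor_mul_binomFactor {n M : ℕ} (hM : 1 ≤ M) (hMn : M ≤ n) {s : ℂ}
    (hs : ∀ m : ℕ, s ≠ -(m : ℂ)) {α : ℕ → ℕ} {j : ℕ → ℕ} (hj : M = 1 → j 2 = 0) :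
    gammaFactor n M s α * binomFactor M s α j =
      -(Gamma (s + powExp n M α j) / powDen M j) * tailCoef n M α j := by
  rw [gammaFactor_eq hM hMn, binomFactor, tailCoef]
  rcases eq_or_ne M 1 with rfl | h
  · simp [gammaHead, powExp, powDen, hj rfl]
  · rw [gammaHead, if_neg h, powExp, if_neg h, powDen, if_neg h, Gamma_add_natCast_div hs]
    ring

lemma mem_jTuples {n M : ℕ} {α : ℕ → ℕ} {j : ℕ →₀ ℕ} :
    j ∈ jTuples n M α ↔ (∀ r, ¬ (2 ≤ r ∧ r ≤ M) → j r = 0) ∧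
      ∀ r, 2 ≤ r → r ≤ M → j r < alphaTail n M α r + j (r + 1) := by
  rw [jTuples, Set.Finite.mem_toFinset]; rfl

lemma sum_Icc_add_one {X : Type*} [AddCommMonoid X] (g : ℕ → X) (p q : ℕ) :
    ∑ r ∈ Finset.Icc (p + 1) (q + 1), g r = ∑ r ∈ Finset.Icc p q, g (r + 1) := by
  rw [← Finset.map_add_right_Icc, Finset.sum_map]
  rfl

lemma prod_Icc_add_one {X : Type*} [CommMonoid X] (g : ℕ → X) (p q : ℕ) :
    ∏ r ∈ Finset.Icc (p + 1) (q + 1), g r = ∏ r ∈ Finset.Icc p q, g (r + 1) := by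
  rw [← Finset.map_add_right_Icc, Finset.prod_map]
  rfl

lemma upper_bump {n l : ℕ} (ν : Fin (l + 1) → ℕ) {i : ℕ} (hi : 1 ≤ i) :
    upper (n + 1) (bump ν) i = upper n ν i + 1 := by
  rw [upper, upper, idx_bump ν hi]
  split_ifs <;> rfl

lemma upper_consZero {n l : ℕ} (ν : Fin (l + 1) → ℕ) (i : ℕ) :
    upper (n + 1) (consZero ν) (i + 1) = upper n ν i + 1 := by
  rw [upper, upper, idx_consZero]
  simp only [add_left_inj]
  split_ifs <;> rfl

lemma coeffB_succ {n m : ℕ} (hm : m ≤ n) (x : ℕ → ℂ) :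
    coeffB (n + 1) m x = coeffB n m fun r => x (r + 1) := by
  refine Finset.prod_congr rfl fun k hk => ?_
  rw [Finset.mem_Icc] at hk
  rw [show n + 1 - k + 1 = (n - k + 1) + 1 by omega, sum_Icc_add_one]

lemma coeffB_congr {n m : ℕ} {x x' : ℕ → ℂ} (h : ∀ r, n < r + m → x r = x' r) :
    coeffB n m x = coeffB n m x' := by
  refine Finset.prod_congr rfl fun k hk => ?_
  rw [Finset.mem_Icc] at hk
  congr 1
  refine Finset.sum_congr rfl fun r hr => h r ?_
  rw [Finset.mem_Icc] at hr
  omega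

lemma image_idx_bump {l : ℕ} (ν : Fin (l + 1) → ℕ) :
    (Finset.Icc 1 l).image (idx (bump ν)) = ((Finset.Icc 1 l).image (idx ν)).image (· + 1) := by
  rw [Finset.image_image]
  refine Finset.image_congr fun i hi => ?_
  simp only [Finset.coe_Icc, Set.mem_Icc] at hi
  exact idx_bump ν hi.1

lemma image_idx_consZero {l : ℕ} (ν : Fin (l + 1) → ℕ) :
    (Finset.Icc 1 (l + 1)).image (idx (consZero ν)) =
      insert 1 (((Finset.Icc 1 l).image (idx ν)).image (· + 1)) := by
  ext x
  simp only [Finset.mem_image, Finset.mem_Icc, Finset.mem_insert, exists_exists_and_eq_and]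
  constructor
  · rintro ⟨i, hi, rfl⟩
    obtain ⟨i, rfl⟩ := Nat.exists_eq_add_of_le' hi.1
    rw [idx_consZero]
    rcases Nat.eq_zero_or_pos i with rfl | h
    · left; simp
    · right; exact ⟨i, by omega, rfl⟩
  · rintro (rfl | ⟨i, hi, rfl⟩)
    · exact ⟨0 + 1, by omega, by rw [idx_consZero]; simp⟩
    · exact ⟨i + 1, by omega, idx_consZero ν i⟩

/-- Under `bump` the index `1` is not selected and contributes its constant term; under `consZero`
it is selected and contributes nothing. -/
lemma constProd_bump {n l : ℕ} (a : ℕ → ℕ → ℂ) (ν : Fin (l + 1) → ℕ) :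
    constProd (n + 1) a (bump ν) = a 1 0 * constProd n (fun i => a (i + 1)) ν := by
  have h : Finset.Icc 1 (n + 1) \ (Finset.Icc 1 l).image (idx (bump ν)) =
      insert 1 ((Finset.Icc 1 n \ (Finset.Icc 1 l).image (idx ν)).image (· + 1)) := by
    rw [image_idx_bump]
    ext x
    simp only [Finset.mem_sdiff, Finset.mem_image, Finset.mem_Icc, Finset.mem_insert,
      exists_exists_and_eq_and]
    constructor
    · rintro ⟨h1, h2⟩
      rcases eq_or_ne x 1 with rfl | h
      · exact Or.inl rfl
      · refine Or.inr ⟨x - 1, ⟨by omega, ?_⟩, by omega⟩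
        rintro ⟨i, hi, h3⟩
        exact h2 ⟨i, hi, by omega⟩
    · rintro (rfl | ⟨y, ⟨hy, h2⟩, rfl⟩)
      · refine ⟨by omega, ?_⟩
        rintro ⟨i, hi, h3⟩
        have := le_idx ν i
        omega
      · refine ⟨by omega, ?_⟩
        rintro ⟨i, hi, h3⟩
        exact h2 ⟨i, hi, by omega⟩
  rw [constProd, h, Finset.prod_insert, Finset.prod_image (by simp), constProd]
  simp

lemma constProd_consZero {n l : ℕ} (a : ℕ → ℕ → ℂ) (ν : Fin (l + 1) → ℕ) :
    constProd (n + 1) a (consZero ν) = constProd n (fun i => a (i + 1)) ν := by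
  have h : Finset.Icc 1 (n + 1) \ (Finset.Icc 1 (l + 1)).image (idx (consZero ν)) =
      (Finset.Icc 1 n \ (Finset.Icc 1 l).image (idx ν)).image (· + 1) := by
    rw [image_idx_consZero]
    ext x
    simp only [Finset.mem_sdiff, Finset.mem_image, Finset.mem_Icc, Finset.mem_insert,
      exists_exists_and_eq_and]
    constructor
    · rintro ⟨h1, h2⟩
      refine ⟨x - 1, ⟨by omega, ?_⟩, by omega⟩
      rintro ⟨i, hi, h3⟩
      exact h2 (Or.inr ⟨i, hi, by omega⟩)
    · rintro ⟨y, ⟨hy, h2⟩, rfl⟩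
      refine ⟨by omega, ?_⟩
      rintro (h3 | ⟨i, hi, h3⟩)
      · omega
      · exact h2 ⟨i, hi, by omega⟩
  rw [constProd, h, Finset.prod_image (by simp), constProd]


/-! ### Recursion for the terms of the expansion -/

section

variable {n l : ℕ} {a : ℕ → ℕ → ℂ} {ν : Fin (l + 1) → ℕ}

lemma idx_le_of_mem (hl : l ≤ n) (hν : ν ∈ nuTuples n l) : idx ν l ≤ n := by
  have := last_add_idx hl hν
  omega

lemma polyGrowth_idx (ha : ∀ i, 1 ≤ i → i ≤ n → PolyGrowth (a i)) (hl : l ≤ n)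
    (hν : ν ∈ nuTuples n l) (i : Fin l) : PolyGrowth (a (idx ν (i + 1))) :=
  ha _ (by have := le_idx ν (i + 1); omega)
    (((idx_strictMono ν).monotone (show (i : ℕ) + 1 ≤ l from i.2)).trans (idx_le_of_mem hl hν))

lemma jTuples_one (n : ℕ) (α : ℕ → ℕ) : jTuples n 1 α = {0} := by
  ext j
  rw [mem_jTuples, Finset.mem_singleton]
  constructor
  · rintro ⟨h, -⟩
    ext r
    exact h r (by omega)
  · rintro rfl
    exact ⟨fun _ _ => rfl, fun r h1 h2 => by omega⟩

/-- When the index `1` is selected, the first argument of the exponential sum is `j₂ - j₂ = 0`, so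
`expSum_succ` applies: multiplying by the form without its constant term opens one new summation
variable. -/
lemma innerW_consZero (ha : ∀ i, 1 ≤ i → i ≤ n + 1 → PolyGrowth (a i)) (hl : 1 ≤ l) (hln : l ≤ n)
    (hν : ν ∈ nuTuples n l) (α j : ℕ → ℕ) {y : ℝ} (hy : 0 < y) {F : ℂ}
    (hF : HasSum (fun m : ℕ => a 1 m * (Real.exp (-(2 * Real.pi * m * y)) : ℂ)) F) :
    innerW (n + 1) (consZero ν) a α j y = (F - a 1 0) * innerW (n + 1) (bump ν) a α j y := by
  have h1 : idx (consZero ν) 1 = 1 := by rw [idx_consZero ν 0, idx_zero]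
  have hi : idx (consZero ν) (l + 1) = idx (bump ν) l := by rw [idx_consZero, idx_bump ν hl]
  have hne : idx (bump ν) l ≠ 1 := by
    have := le_idx ν l
    rw [idx_bump ν hl]; omega
  have hpg : ∀ i : Fin (l + 1), PolyGrowth (a (idx (consZero ν) (i + 1))) := fun i => by
    refine ha _ ?_ ?_
    · rw [idx_consZero]; omega
    · rw [idx_consZero]
      have := (idx_strictMono ν).monotone (show (i : ℕ) ≤ l by omega)
      have := idx_le_of_mem hln hν
      omega
  have ht : tailArg (n + 1) (consZero ν) α j = 0 := by
    rw [tailArg, upper, if_neg (by omega), h1, hi, powExp, if_neg hne]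
    simp
  rw [innerW, expSum_succ hpg _ (by rw [consArg_one, ht]) hy (by rw [h1]; exact hF), h1, hi, innerW,
    expSum_congr (a := fun i => a (idx (consZero ν) (i + 1)))
      (a' := fun i => a (idx (bump ν) i))
      (t' := consArg (tailArg (n + 1) (bump ν) α j) (otherArg (n + 1) (bump ν) α j))]
  · ring
  · intro i
    rw [idx_consZero, idx_bump _ (by omega)]
  · intro i
    rw [consArg_of_ne _ _ (by omega), otherArg, Nat.add_sub_cancel, idx_consZero, idx_consZero,
      upper_consZero]
    rcases Nat.eq_zero_or_pos (i : ℕ) with h0 | h0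
    · rw [h0, zero_add, consArg_one, tailArg, powExp, if_neg hne, idx_bump _ le_rfl,
        upper_bump _ le_rfl]
      simp
      ring
    · rw [consArg_of_ne _ _ (by omega), otherArg, Nat.add_sub_cancel, idx_bump _ h0,
        idx_bump _ (by omega), upper_bump _ (by omega)]

lemma termD_consZero (ha : ∀ i, 1 ≤ i → i ≤ n + 1 → PolyGrowth (a i)) (hl : 1 ≤ l) (hln : l ≤ n)
    (hν : ν ∈ nuTuples n l) (α : ℕ → ℕ) {y : ℝ} (hy : 0 < y) {F : ℂ}
    (hF : HasSum (fun m : ℕ => a 1 m * (Real.exp (-(2 * Real.pi * m * y)) : ℂ)) F) :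
    termD (n + 1) (consZero ν) a α y = (F - a 1 0) * termD (n + 1) (bump ν) a α y := by
  have hi : idx (consZero ν) (l + 1) = idx (bump ν) l := by rw [idx_consZero, idx_bump ν hl]
  rw [termD, termD, consZero_last, bump_last hl, hi, mul_left_comm, Finset.mul_sum _ _ (F - a 1 0)]
  congr 1
  refine Finset.sum_congr rfl fun j _ => ?_
  rw [innerW_consZero ha hl hln hν α j hy hF]
  ring

/-- The case in which only the index `1` is selected. The remaining forms contribute their constant
terms alone, hence a pure power of `z`; this is the origin of the special case `M = 1` in `powExp`.
-/
lemma termD_consZero_const (ha : PolyGrowth (a 1)) (α : ℕ → ℕ) {y : ℝ} (hy : 0 < y) {F : ℂ}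
    (hF : HasSum (fun m : ℕ => a 1 m * (Real.exp (-(2 * Real.pi * m * y)) : ℂ)) F) :
    termD (n + 1) (consZero fun _ : Fin (0 + 1) => n) a α y = (F - a 1 0) *
      (coeffB (n + 1) n (fun r => (α r : ℂ)) * (I * y) ^ ∑ r ∈ Finset.Icc 2 (n + 1), α r) := by
  set ν : Fin (0 + 1) → ℕ := fun _ => n
  have hi : idx (consZero ν) (0 + 1) = 1 := by rw [idx_consZero, idx_zero]
  have ht : tailArg (n + 1) (consZero ν) α (0 : ℕ →₀ ℕ) = 0 := by
    rw [tailArg, upper, if_pos (by rfl), hi, powExp, if_pos rfl]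
    push_cast
    simp
  rw [termD, consZero_last, hi, jTuples_one, Finset.sum_singleton, innerW, hi,
    expSum_succ (fun i => by rw [Fin.fin_one_eq_zero i]; simpa [hi] using ha) _
      (by rw [consArg_one, ht]) hy (by rw [show idx (consZero ν) 1 = 1 from hi]; exact hF),
    expSum_zero, show idx (consZero ν) 1 = 1 from hi, powExp, if_pos rfl, powDen, if_pos rfl,
    tailCoef, gammaTail]
  simp [ν]
  ring

/-- The telescoping sum behind partial integration. -/
lemma hasDerivAt_sum_pow_mul_expSum (hl : 0 < l) {a : ℕ → ℕ → ℂ}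
    (ha : ∀ i : Fin l, PolyGrowth (a (i + 1))) (t : ℂ) (β : ℕ → ℂ) (b : ℕ) {y : ℝ} (hy : 0 < y) :
    HasDerivAt (fun y : ℝ => ∑ i ∈ Finset.range (b + 1), (I * y) ^ i / (i.factorial : ℂ) *
        expSum l a (consArg (t + (b + 1) - i) β) y)
      (-I * ((I * y) ^ b / (b.factorial : ℂ) * expSum l a (consArg t β) y)) y := by
  have hz : HasDerivAt (fun y : ℝ => I * (y : ℂ)) I y := by
    simpa using ((hasDerivAt_id y).ofReal_comp).const_mul I
  have hW : ∀ c, HasDerivAt (expSum l a (consArg c β)) (-I * expSum l a (consArg (c - 1) β) y) y :=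
    fun c => (hasDerivAt_expSum hl ha (consArg c β) hy).congr_deriv (by
      rw [consArg_one, expSum_congr (fun _ => rfl)]
      intro i
      by_cases h : (i : ℕ) + 1 = 1
      · rw [h, consArg_one, consArg_one]
      · rw [consArg_of_ne _ _ h, consArg_of_ne _ _ h, consArg_of_ne _ _ h])
  induction b generalizing t with
  | zero => simpa using hW (t + 1)
  | succ b ih =>
    -- Differentiating the power in the new top term cancels the derivative left over by the
    -- induction hypothesis at `t + 1`; differentiating the exponential sum gives the new remainder.
    have h1 := ((hz.pow (b + 1)).div_const ((b + 1).factorial : ℂ)).mul (hW (t + 1))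
    refine ((ih (t + 1)).add h1).congr_of_eventuallyEq (Eventually.of_forall fun y => ?_)
      |>.congr_deriv ?_
    · rw [Finset.sum_range_succ]
      simp only [Pi.add_apply, Pi.mul_apply, Pi.pow_apply]
      congr 1
      · refine Finset.sum_congr rfl fun i _ => ?_
        congr 4
        push_cast
        ring
      · congr 3
        push_cast
        ring
    · have h2 : ((b : ℂ) + 1) ≠ 0 := by exact_mod_cast b.succ_ne_zero
      have h3 : (b.factorial : ℂ) ≠ 0 := by exact_mod_cast b.factorial_ne_zero
      rw [Nat.factorial_succ, add_sub_cancel_right, Nat.add_sub_cancel]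
      push_cast
      rw [Pi.pow_apply]
      field_simp
      ring

/-- The sum over the lowest index of the tuples, in the expansion of an iterated integral. -/
lemma termD_bump_eq (hl : 1 ≤ l) (hln : l ≤ n) (hν : ν ∈ nuTuples n l) (a : ℕ → ℕ → ℂ)
    {α : ℕ → ℕ} (hα : 0 < α 2) (y : ℝ) :
    termD (n + 1) (bump ν) a α y = coeffB n (ν (Fin.last l)) (fun r => (α (r + 1) : ℂ)) *
      ∑ j ∈ jTuples n (idx ν l) (fun r => α (r + 1)),
        -(Gamma (α 2 + powExp n (idx ν l) (fun r => α (r + 1)) j) / powDen (idx ν l) j) *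
          tailCoef n (idx ν l) (fun r => α (r + 1)) j *
        ∑ i ∈ Finset.range (α 2 + powExp n (idx ν l) (fun r => α (r + 1)) j),
          (I * y) ^ i / (i.factorial : ℂ) *
            expSum l (fun i => a (idx ν i + 1)) (consArg (tailArg n ν (fun r => α (r + 1)) j +
              (α 2 + powExp n (idx ν l) (fun r => α (r + 1)) j) - i)
                (otherArg n ν (fun r => α (r + 1)) j)) y := by
  set α' : ℕ → ℕ := fun r => α (r + 1) with hα'
  have hM1 : 1 ≤ idx ν l := hl.trans (le_idx ν l)
  have hMn := idx_le_of_mem hln hν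
  have hlast : ν (Fin.last l) ≤ n := by have := last_add_idx hln hν; omega
  have hb : ∀ r, 1 ≤ r → alphaTail (n + 1) (idx ν l + 1) α (r + 1) =
      alphaTail n (idx ν l) α' r := fun r _ => by
    rw [alphaTail, alphaTail, sum_Icc_add_one]
    simp only [add_left_inj]
    rfl
  rw [termD, bump_last hl, coeffB_succ hlast, idx_bump ν hl, jTuples, sum_jSet_succ hM1 hb]
  congr 1
  refine Finset.sum_congr rfl fun j hj => ?_
  have hj2 : idx ν l = 1 → j 2 = 0 := fun h => (mem_jTuples.mp hj).1 2 (by omega)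
  have hs : ∀ m : ℕ, (α 2 : ℂ) ≠ -(m : ℂ) := fun m h => by
    have : ((α 2 + m : ℕ) : ℂ) = 0 := by push_cast; rw [h]; ring
    have : α 2 + m = 0 := by exact_mod_cast this
    omega
  -- The number of admissible lowest entries equals the number of partial integrations needed for
  -- the power `z^(α₂ + e - 1)`, where `e` is the exponent `powExp`.
  have hrange : alphaTail n (idx ν l) α' 1 + j 2 = α 2 + powExp n (idx ν l) α' j := by
    rw [alphaTail, powExp]
    by_cases h : idx ν l = 1
    · rw [if_pos h, h, if_pos rfl, hj2 h, ← Finset.insert_Icc_add_one_left_eq_Icc (by omega),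
        Finset.sum_insert (by simp), add_zero]
      rfl
    · rw [if_neg (Ne.symm h), if_neg h]
  rw [hrange, ← gammaFactor_mul_binomFactor hM1 hMn hs hj2, Finset.mul_sum]
  refine Finset.sum_congr rfl fun i _ => ?_
  -- The coefficients for `n + 1` forms are the full coefficients for `n` forms with `α₂` in the
  -- role of `s`.
  have hcoef : tailCoef (n + 1) (idx ν l + 1) α (shiftCons i j) =
      gammaFactor n (idx ν l) (α 2) α' * binomFactor (idx ν l) (α 2) α' j := by
    have hargs : ∀ r, 1 ≤ r → args (α 2) α' r = α (r + 1) := fun r hr => by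
      rcases eq_or_ne r 1 with rfl | h
      · rfl
      · exact args_of_two_le (by omega)
    have h1 : ∏ r ∈ Finset.Icc 2 (idx ν l), Gamma (α r) =
        ∏ r ∈ Finset.Icc 1 (idx ν l - 1), Gamma (args (α 2) α' r) := by
      rw [show Finset.Icc 2 (idx ν l) = Finset.Icc (1 + 1) (idx ν l - 1 + 1) by
        rw [Nat.sub_add_cancel hM1], prod_Icc_add_one]
      exact Finset.prod_congr rfl fun r hr => by rw [hargs r (Finset.mem_Icc.mp hr).1]
    have h2 : ∑ r ∈ Finset.Icc (idx ν l + 1) (n + 1), (α r : ℂ) =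
        ∑ r ∈ Finset.Icc (idx ν l) n, args (α 2) α' r := by
      rw [sum_Icc_add_one]
      exact Finset.sum_congr rfl fun r hr => by
        rw [hargs r (hM1.trans (Finset.mem_Icc.mp hr).1)]
    have h3 : ∏ k ∈ Finset.Icc 3 (idx ν l + 1), ((α (k - 1) + shiftCons i j k - 1).choose
        (shiftCons i j k) : ℂ) = Ring.choose ((α 2 : ℂ) + (j 2 : ℂ) - 1) (j 2) *
          ∏ k ∈ Finset.Icc 3 (idx ν l), ((α' (k - 1) + j k - 1).choose (j k) : ℂ) := by
      have h4 : ∀ k, 2 ≤ k → ((α (k + 1 - 1) + shiftCons i j (k + 1) - 1).choose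
          (shiftCons i j (k + 1)) : ℂ) = ((α' (k - 1) + j k - 1).choose (j k) : ℂ) := fun k hk => by
        rw [shiftCons_succ, if_neg (by omega), add_zero, Nat.add_sub_cancel, hα']
        simp only
        rw [Nat.sub_add_cancel (by omega)]
      rw [prod_Icc_add_one, Finset.prod_congr rfl fun k hk => h4 k (Finset.mem_Icc.mp hk).1]
      rcases eq_or_ne (idx ν l) 1 with h | h
      · simp [h, hj2 h]
      · rw [← Finset.insert_Icc_add_one_left_eq_Icc (by omega), Finset.prod_insert (by simp),
          ← Ring.choose_natCast]
        congr 2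
        have : 1 ≤ α' (2 - 1) := hα
        rw [Nat.cast_sub (by omega)]
        push_cast
        rfl
    rw [tailCoef, binomFactor, gammaTail, gammaFactor, Nat.add_sub_cancel, if_neg (by omega), h1,
      h2, h3]
  rw [hcoef, mul_assoc, mul_assoc]
  congr 2
  have hsc2 : shiftCons i j 2 = i := by
    rw [shiftCons_succ, if_pos rfl, (mem_jTuples.mp hj).1 1 (by omega), zero_add]
  have hother : ∀ p, 1 ≤ p → otherArg (n + 1) (bump ν) α (shiftCons i j) (p + 1) =
      otherArg n ν α' j (p + 1) := fun p hp => by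
    have h1 := le_idx ν p
    have h2 := le_idx ν (p + 1)
    rw [otherArg, otherArg, Nat.add_sub_cancel, idx_bump ν hp, idx_bump ν (by omega),
      upper_bump ν (by omega), sum_Icc_add_one, shiftCons_succ, shiftCons_succ,
      if_neg (by omega), if_neg (by omega), add_zero, add_zero]
  have htail : tailArg (n + 1) (bump ν) α (shiftCons i j) = tailArg n ν α' j +
      (α 2 + powExp n (idx ν l) α' j) - i := by
    have h1 := le_idx ν 1
    have h2 : 1 ≤ upper n ν 1 := by
      rw [upper]; split_ifs <;> omega
    rw [tailArg, tailArg, idx_bump ν hl, powExp, if_neg (by omega), hsc2, idx_bump ν le_rfl,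
      shiftCons_succ, if_neg (by omega), add_zero, upper_bump ν le_rfl, sum_Icc_add_one,
      ← Finset.insert_Icc_add_one_left_eq_Icc h2, Finset.sum_insert (by simp)]
    simp only [hα']
    ring_nf
  rw [innerW, idx_bump ν hl, powExp, if_neg (by omega), powDen, if_neg (by omega), hsc2, htail,
    expSum_congr (a' := fun i => a (idx ν i + 1))]
  · intro p
    rw [idx_bump ν (by omega)]
  · intro p
    rcases Nat.eq_zero_or_pos (p : ℕ) with h | h
    · rw [h, zero_add, consArg_one, consArg_one]
    · rw [consArg_of_ne _ _ (by omega), consArg_of_ne _ _ (by omega), hother _ h]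

end

/-! ### The expansion of iterated integrals from infinity -/

section

variable {n l : ℕ} {a : ℕ → ℕ → ℂ} {ν : Fin (l + 1) → ℕ}

/-- One integration of the recursion. The factor `Γ(α₂ + e)` equals `b!` with `b = α₂ + e - 1`, and
cancels the factorial that is left by the telescoping sum. -/
lemma hasDerivAt_termD_bump (ha : ∀ i, 2 ≤ i → i ≤ n + 1 → PolyGrowth (a i)) (hl : 1 ≤ l)
    (hln : l ≤ n) (hν : ν ∈ nuTuples n l) {α : ℕ → ℕ} (hα : 0 < α 2) {y : ℝ} (hy : 0 < y) :
    HasDerivAt (termD (n + 1) (bump ν) a α)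
      ((I * y) ^ α 2 / y * termD n ν (fun i => a (i + 1)) (fun r => α (r + 1)) y) y := by
  rw [funext fun y => termD_bump_eq hl hln hν a hα y, termD, mul_left_comm, Finset.mul_sum _ _
    (((I * y) ^ α 2 / y : ℂ))]
  refine (HasDerivAt.fun_sum fun j _ => ?_).const_mul _
  set e := powExp n (idx ν l) (fun r => α (r + 1)) j with he
  obtain ⟨b, hb⟩ := Nat.exists_eq_add_of_le' (show 1 ≤ α 2 + e by omega)
  have hpg : ∀ i : Fin l, PolyGrowth (a (idx ν (i + 1) + 1)) := fun i =>
    polyGrowth_idx (a := fun i => a (i + 1)) (fun i h1 h2 => ha (i + 1) (by omega) (by omega))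
      hln hν i
  have h1 := hasDerivAt_sum_pow_mul_expSum hl (a := fun i => a (idx ν i + 1)) hpg
    (tailArg n ν (fun r => α (r + 1)) j) (otherArg n ν (fun r => α (r + 1)) j) b hy
  have hbc : ((α 2 : ℂ) + (e : ℂ)) = (b : ℂ) + 1 := by exact_mod_cast hb
  rw [hb, hbc, Gamma_nat_eq_factorial]
  refine (h1.const_mul _).congr_deriv ?_
  have hy' : (y : ℂ) ≠ 0 := by exact_mod_cast hy.ne'
  have hbf : (b.factorial : ℂ) ≠ 0 := by exact_mod_cast b.factorial_ne_zero
  have h2 : (I * y : ℂ) ^ α 2 * (I * y) ^ e = (I * y) ^ b * (I * y) := by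
    rw [← pow_add, hb, pow_succ]
  have h3 : (I * y : ℂ) ^ α 2 / y * (I * y) ^ e = (I * y) ^ b * I := by
    rw [div_mul_eq_mul_div, h2]; field_simp
  rw [innerW, ← he]
  calc _ = (I * y : ℂ) ^ b * I * (tailCoef n (idx ν l) (fun r => α (r + 1)) j /
        powDen (idx ν l) j * expSum l (fun i => a (idx ν i + 1))
          (consArg (tailArg n ν (fun r => α (r + 1)) j) (otherArg n ν (fun r => α (r + 1)) j)) y) := by
        field_simp
    _ = _ := by
        rw [← h3]
        ring

/-- The expansion of the iterated integral from infinity of forms with the coefficients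
`a₂, …, a_{n+1}` and the exponents `α₂, …, α_{n+1}`. -/
def expandE (n : ℕ) (a : ℕ → ℕ → ℂ) (α : ℕ → ℕ) (y : ℝ) : ℂ :=
  (∏ i ∈ Finset.Icc 2 (n + 1), a i 0) * coeffB (n + 1) n (fun r => (α r : ℂ)) *
      (I * y) ^ (∑ r ∈ Finset.Icc 2 (n + 1), α r) +
    ∑ l ∈ Finset.Icc 1 n, ∑ ν ∈ nuTuples n l,
      constProd n (fun i => a (i + 1)) ν * termD (n + 1) (bump ν) a α y

/-- The decaying part of the integrand of the outermost integral. -/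
def decayD (n : ℕ) (a : ℕ → ℕ → ℂ) (α : ℕ → ℕ) (y : ℝ) : ℂ :=
  ∑ l ∈ Finset.Icc 1 n, ∑ ν ∈ nuTuples n l, constProd n a ν * termD n ν a α y

/-- Write `F = a₀ + (F - a₀)`: the constant part acts by `bump`, the rest by `consZero`, and
`sum_sum_nuTuples_succ` reassembles the two families into all tuples for `n + 1`. -/
lemma mul_expandE (ha : ∀ i, 1 ≤ i → i ≤ n + 1 → PolyGrowth (a i)) (α : ℕ → ℕ) {y : ℝ}
    (hy : 0 < y) {F : ℂ}
    (hF : HasSum (fun m : ℕ => a 1 m * (Real.exp (-(2 * Real.pi * m * y)) : ℂ)) F) :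
    F * expandE n a α y = (∏ i ∈ Finset.Icc 1 (n + 1), a i 0) *
      coeffB (n + 1) n (fun r => (α r : ℂ)) * (I * y) ^ (∑ r ∈ Finset.Icc 2 (n + 1), α r) +
        decayD (n + 1) a α y := by
  have h0 : constProd (n + 1) a (consZero fun _ : Fin (0 + 1) => n) =
      ∏ i ∈ Finset.Icc 2 (n + 1), a i 0 := by
    rw [constProd_consZero, constProd, show Finset.Icc 2 (n + 1) = Finset.Icc (1 + 1) (n + 1) from rfl,
      prod_Icc_add_one]
    simp
  have h1 : ∏ i ∈ Finset.Icc 1 (n + 1), a i 0 = a 1 0 * ∏ i ∈ Finset.Icc 2 (n + 1), a i 0 := by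
    rw [← Finset.insert_Icc_add_one_left_eq_Icc (show 1 ≤ n + 1 by omega),
      Finset.prod_insert (by simp)]
    rfl
  have h2 : ∀ l ∈ Finset.Icc 1 n, ∀ ν ∈ nuTuples n l,
      constProd (n + 1) a (consZero ν) * termD (n + 1) (consZero ν) a α y +
        constProd (n + 1) a (bump ν) * termD (n + 1) (bump ν) a α y =
      F * (constProd n (fun i => a (i + 1)) ν * termD (n + 1) (bump ν) a α y) :=
    fun l hl ν hν => by
      rw [Finset.mem_Icc] at hl
      rw [constProd_consZero, constProd_bump, termD_consZero ha hl.1 hl.2 hν α hy hF]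
      ring
  rw [decayD, sum_sum_nuTuples_succ n fun l ν => constProd (n + 1) a ν * termD (n + 1) ν a α y, h0,
    termD_consZero_const (ha 1 le_rfl (by omega)) α hy hF,
    Finset.sum_congr rfl fun l hl => Finset.sum_congr rfl (h2 l hl)]
  simp only [← Finset.mul_sum]
  rw [expandE, h1]
  ring

lemma hasDerivAt_expandE (ha : ∀ i, 2 ≤ i → i ≤ n + 1 → PolyGrowth (a i)) {α : ℕ → ℕ}
    (hn : 1 ≤ n) (hα : 0 < α 2) {y : ℝ} (hy : 0 < y) :
    HasDerivAt (expandE n a α) ((I * y) ^ α 2 / y *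
      ((∏ i ∈ Finset.Icc 2 (n + 1), a i 0) * coeffB n (n - 1) (fun r => (α (r + 1) : ℂ)) *
        (I * y) ^ (∑ r ∈ Finset.Icc 2 n, α (r + 1)) +
        decayD n (fun i => a (i + 1)) (fun r => α (r + 1)) y)) y := by
  have hy' : (y : ℂ) ≠ 0 := by exact_mod_cast hy.ne'
  have hz : HasDerivAt (fun y : ℝ => I * (y : ℂ)) I y := by
    simpa using ((hasDerivAt_id y).ofReal_comp).const_mul I
  set A := ∑ r ∈ Finset.Icc 2 (n + 1), α r with hA
  have hA1 : A = α 2 + ∑ r ∈ Finset.Icc 2 n, α (r + 1) := by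
    rw [hA, ← Finset.insert_Icc_add_one_left_eq_Icc (show 2 ≤ n + 1 by omega),
      Finset.sum_insert (by simp), sum_Icc_add_one]
  obtain ⟨b, hb⟩ := Nat.exists_eq_add_of_le' (show 1 ≤ A by omega)
  have hAc : (A : ℂ) ≠ 0 := by rw [hb]; exact_mod_cast b.succ_ne_zero
  -- The last factor of `coeffB` is the reciprocal of the total exponent, which differentiation of
  -- the power brings down.
  have hB : coeffB (n + 1) n (fun r => (α r : ℂ)) * A =
      coeffB n (n - 1) (fun r => (α (r + 1) : ℂ)) := by
    obtain ⟨p, rfl⟩ := Nat.exists_eq_add_of_le' hn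
    rw [Nat.add_sub_cancel, ← coeffB_succ (show p ≤ p + 1 by omega) (fun r => (α r : ℂ)), coeffB,
      Finset.prod_Icc_succ_top (by omega), coeffB,
      show p + 1 + 1 - (p + 1) + 1 = 2 by omega, hA, mul_assoc]
    push_cast at hAc ⊢
    rw [inv_mul_cancel₀ (by rw [hA] at hAc; exact_mod_cast hAc), mul_one]
  have h1 := (hz.pow A).const_mul ((∏ i ∈ Finset.Icc 2 (n + 1), a i 0) *
    coeffB (n + 1) n (fun r => (α r : ℂ)))
  have h2 : HasDerivAt (fun y => ∑ l ∈ Finset.Icc 1 n, ∑ ν ∈ nuTuples n l,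
      constProd n (fun i => a (i + 1)) ν * termD (n + 1) (bump ν) a α y)
      (∑ l ∈ Finset.Icc 1 n, ∑ ν ∈ nuTuples n l, constProd n (fun i => a (i + 1)) ν *
        ((I * y) ^ α 2 / y * termD n ν (fun i => a (i + 1)) (fun r => α (r + 1)) y)) y :=
    HasDerivAt.fun_sum fun l hl => HasDerivAt.fun_sum fun ν hν =>
      (hasDerivAt_termD_bump ha (Finset.mem_Icc.mp hl).1 (Finset.mem_Icc.mp hl).2 hν hα hy).const_mul _
  refine (h1.add h2).congr_deriv ?_
  have h3 : ∑ l ∈ Finset.Icc 1 n, ∑ ν ∈ nuTuples n l, constProd n (fun i => a (i + 1)) ν *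
      ((I * y) ^ α 2 / y * termD n ν (fun i => a (i + 1)) (fun r => α (r + 1)) y) =
        (I * y) ^ α 2 / y * decayD n (fun i => a (i + 1)) (fun r => α (r + 1)) y := by
    rw [decayD, Finset.mul_sum]
    refine Finset.sum_congr rfl fun l _ => ?_
    rw [Finset.mul_sum]
    refine Finset.sum_congr rfl fun ν _ => ?_
    ring
  rw [h3, mul_add, ← hB]
  congr 1
  have h4 : (I * y : ℂ) ^ (A - 1) * I = (I * y) ^ α 2 / y *
      (I * y) ^ (∑ r ∈ Finset.Icc 2 n, α (r + 1)) := by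
    rw [div_mul_eq_mul_div, ← pow_add, ← hA1, hb, Nat.add_sub_cancel, pow_succ]
    field_simp
  calc _ = (∏ i ∈ Finset.Icc 2 (n + 1), a i 0) * coeffB (n + 1) n (fun r => (α r : ℂ)) * A *
        ((I * y : ℂ) ^ (A - 1) * I) := by ring
    _ = _ := by rw [h4]; ring

/-- The derivative of the iterated integral from infinity. -/
theorem hasDerivAt_expandE_succ (ha : ∀ i, 2 ≤ i → i ≤ n + 1 + 1 → PolyGrowth (a i)) {α : ℕ → ℕ}
    (hα : 0 < α 2) {y : ℝ} (hy : 0 < y) {F : ℂ}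
    (hF : HasSum (fun m : ℕ => a 2 m * (Real.exp (-(2 * Real.pi * m * y)) : ℂ)) F) :
    HasDerivAt (expandE (n + 1) a α) ((I * y) ^ α 2 / y *
      (F * expandE n (fun i => a (i + 1)) (fun r => α (r + 1)) y)) y := by
  refine (hasDerivAt_expandE ha (by omega) hα hy).congr_deriv ?_
  rw [mul_expandE (fun i h1 h2 => ha (i + 1) (by omega) (by omega)) _ hy hF, Nat.add_sub_cancel,
    show Finset.Icc 2 (n + 1 + 1) = Finset.Icc (1 + 1) (n + 1 + 1) from rfl, prod_Icc_add_one]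

/-! ### Growth of the expansion at zero and at infinity -/

lemma norm_I_mul_pow {y : ℝ} (hy : 0 < y) (e : ℕ) : ‖(I * y : ℂ) ^ e‖ = y ^ e := by
  rw [norm_pow, norm_mul, norm_I, one_mul, norm_real, Real.norm_of_nonneg hy.le]


/-- Functions which tend to zero at infinity and grow polynomially at zero. -/
def IsTame (g : ℝ → ℂ) : Prop :=
  Tendsto g atTop (𝓝 0) ∧ ∃ m : ℕ, g =O[𝓝[>] 0] fun y => (y ^ m)⁻¹

lemma IsTame.const_mul {g : ℝ → ℂ} (hg : IsTame g) (c : ℂ) : IsTame fun y => c * g y := by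
  obtain ⟨h1, m, h2⟩ := hg
  exact ⟨by simpa using h1.const_mul c, m, h2.const_mul_left c⟩

lemma isBigO_inv_pow_of_le {m m' : ℕ} (h : m ≤ m') :
    (fun y : ℝ => (y ^ m)⁻¹) =O[𝓝[>] 0] fun y => (y ^ m')⁻¹ := by
  refine IsBigO.of_bound 1 ?_
  filter_upwards [Ioo_mem_nhdsGT (zero_lt_one' ℝ)] with y hy
  have hy0 := hy.1
  rw [one_mul, Real.norm_of_nonneg (by positivity), Real.norm_of_nonneg (by positivity)]
  exact inv_anti₀ (by positivity) (pow_le_pow_of_le_one hy.1.le hy.2.le h)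

lemma IsTame.sum {ι : Type*} {s : Finset ι} {g : ι → ℝ → ℂ} (hg : ∀ i ∈ s, IsTame (g i)) :
    IsTame fun y => ∑ i ∈ s, g i y := by
  classical
  induction s using Finset.induction_on with
  | empty =>
    refine ⟨by simp, 0, ?_⟩
    simp only [Finset.sum_empty]
    exact isBigO_zero _ _
  | insert i s hi ih =>
    obtain ⟨h1, m, h2⟩ := hg i (Finset.mem_insert_self i s)
    obtain ⟨h3, m', h4⟩ := ih fun i hi => hg i (Finset.mem_insert_of_mem hi)
    simp only [Finset.sum_insert hi]
    exact ⟨by simpa using h1.add h3, max m m',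
      (h2.trans (isBigO_inv_pow_of_le (le_max_left _ _))).add
        (h4.trans (isBigO_inv_pow_of_le (le_max_right _ _)))⟩

lemma isTame_pow_mul_expSum (hl : 0 < l) {a : ℕ → ℕ → ℂ}
    (ha : ∀ i : Fin l, PolyGrowth (a (i + 1))) (t : ℕ → ℂ) (e : ℕ) (c : ℂ) :
    IsTame fun y => (I * y) ^ e / c * expSum l a t y := by
  obtain ⟨C, m, hC, h⟩ := exists_norm_expSum_le hl ha t
  have hb : ∀ y : ℝ, 0 < y → ‖(I * y : ℂ) ^ e / c * expSum l a t y‖ ≤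
      ‖c‖⁻¹ * C * (y ^ e * (y ^ m)⁻¹ * Real.exp (-Real.pi * y)) := fun y hy => by
    rw [norm_mul, norm_div, norm_I_mul_pow hy]
    calc _ ≤ y ^ e / ‖c‖ * (C * (y ^ m)⁻¹ * Real.exp (-Real.pi * y)) := by
          gcongr; exact h y hy
      _ = _ := by ring
  constructor
  · have h1 : Tendsto (fun y : ℝ => ‖c‖⁻¹ * C * (y ^ e * Real.exp (-Real.pi * y))) atTop (𝓝 0) := by
      have := tendsto_rpow_mul_exp_neg_mul_atTop_nhds_zero e Real.pi Real.pi_pos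
      simpa using this.const_mul (‖c‖⁻¹ * C)
    refine squeeze_zero_norm' ?_ h1
    filter_upwards [eventually_ge_atTop 1] with y hy
    have hy0 : 0 < y := by linarith
    refine (hb y hy0).trans ?_
    gcongr
    exact mul_le_of_le_one_right (by positivity) (inv_le_one_of_one_le₀ (one_le_pow₀ hy))
  · refine ⟨m, IsBigO.of_bound (‖c‖⁻¹ * C) ?_⟩
    filter_upwards [Ioo_mem_nhdsGT (zero_lt_one' ℝ)] with y hy
    have hy0 := hy.1
    refine (hb y hy0).trans ?_
    rw [Real.norm_of_nonneg (by positivity)]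
    gcongr
    calc y ^ e * (y ^ m)⁻¹ * Real.exp (-Real.pi * y) ≤ 1 * (y ^ m)⁻¹ * 1 := by
          gcongr
          · exact pow_le_one₀ hy0.le hy.2.le
          · rw [Real.exp_le_one_iff]
            nlinarith [Real.pi_pos]
      _ = _ := by ring

lemma isTame_termD (ha : ∀ i, 1 ≤ i → i ≤ n → PolyGrowth (a i)) (hl : 1 ≤ l) (hln : l ≤ n)
    (hν : ν ∈ nuTuples n l) (α : ℕ → ℕ) : IsTame (termD n ν a α) :=
  (IsTame.sum fun _ _ => (isTame_pow_mul_expSum hl (polyGrowth_idx ha hln hν) _ _ _).const_mul _)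
    |>.const_mul _

lemma bump_mem_nuTuples (hln : l ≤ n) (hν : ν ∈ nuTuples n l) : bump ν ∈ nuTuples (n + 1) l := by
  rw [mem_nuTuples, Fin.sum_univ_succ] at hν ⊢
  simp only [bump, Fin.cons_zero, Fin.cons_succ, Fin.tail]
  omega

/-- The expansion is the sum of its asymptotic expansion and a tame function. -/
lemma isTame_expandE_sub (ha : ∀ i, 1 ≤ i → i ≤ n + 1 → PolyGrowth (a i)) (α : ℕ → ℕ) :
    IsTame fun y => expandE n a α y -
      (∏ i ∈ Finset.Icc 2 (n + 1), a i 0) * coeffB (n + 1) n (fun r => (α r : ℂ)) *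
        (I * y) ^ (∑ r ∈ Finset.Icc 2 (n + 1), α r) := by
  simp only [expandE, add_sub_cancel_left]
  refine IsTame.sum fun l hl => IsTame.sum fun ν hν => IsTame.const_mul ?_ _
  rw [Finset.mem_Icc] at hl
  exact isTame_termD ha hl.1 (by omega) (bump_mem_nuTuples hl.2 hν) α

lemma isBigO_expandE (ha : ∀ i, 1 ≤ i → i ≤ n + 1 → PolyGrowth (a i)) (α : ℕ → ℕ) :
    ∃ m : ℕ, expandE n a α =O[𝓝[>] 0] fun y => (y ^ m)⁻¹ := by
  obtain ⟨-, m, h⟩ := isTame_expandE_sub ha α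
  refine ⟨m, ?_⟩
  have h2 : (fun y : ℝ => (∏ i ∈ Finset.Icc 2 (n + 1), a i 0) *
      coeffB (n + 1) n (fun r => (α r : ℂ)) * (I * y) ^ (∑ r ∈ Finset.Icc 2 (n + 1), α r))
      =O[𝓝[>] 0] fun y => (y ^ 0)⁻¹ := by
    refine IsBigO.const_mul_left (IsBigO.of_bound 1 ?_) _
    filter_upwards [Ioo_mem_nhdsGT (zero_lt_one' ℝ)] with y hy
    rw [norm_I_mul_pow hy.1]
    simpa using pow_le_one₀ hy.1.le hy.2.le
  exact ((h.add (h2.trans (isBigO_inv_pow_of_le (Nat.zero_le m)))).congr_left fun y => by ring)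

lemma expandE_zero (a : ℕ → ℕ → ℂ) (α : ℕ → ℕ) (y : ℝ) : expandE 0 a α y = 1 := by
  simp [expandE, coeffB]

/-! ### Mellin transforms of the expansion -/

/-- The filter `Re s → ∞`. -/
def reTop : Filter ℂ := comap Complex.re atTop

lemma eventually_reTop {p : ℂ → Prop} : (∀ᶠ s in reTop, p s) ↔ ∃ σ : ℝ, ∀ s : ℂ, σ < s.re → p s := by
  rw [reTop, eventually_comap, eventually_atTop]
  constructor
  · rintro ⟨σ, h⟩
    exact ⟨σ, fun s hs => h _ hs.le s rfl⟩
  · rintro ⟨σ, h⟩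
    exact ⟨σ + 1, fun x hx s hs => h s (by rw [hs]; linarith)⟩

lemma I_mul_ofReal_cpow {y : ℝ} (hy : 0 < y) (s : ℂ) : (I * y : ℂ) ^ s = I ^ s * (y : ℂ) ^ s := by
  have hy' : (y : ℂ) ≠ 0 := by exact_mod_cast hy.ne'
  rw [mul_comm, cpow_def_of_ne_zero (mul_ne_zero hy' I_ne_zero), log_ofReal_mul hy I_ne_zero,
    cpow_def_of_ne_zero I_ne_zero, cpow_def_of_ne_zero hy', ← Complex.exp_add, ofReal_log hy.le]
  ring_nf

lemma tailArg_add (α j : ℕ → ℕ) (s : ℂ) :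
    tailArg n ν α j + (s + powExp n (idx ν l) α j) = firstArg n ν s α j := by
  rw [tailArg, firstArg]
  ring

/-- The power of `z` carried by the term moves the Mellin variable from `s` to `s + e` with `e` the
exponent `powExp`; `tailArg` is normalised so that the resulting first argument is `firstArg`. -/
lemma eventually_mellin_innerW (ha : ∀ i, 1 ≤ i → i ≤ n → PolyGrowth (a i)) (hl : 1 ≤ l)
    (hln : l ≤ n) (hν : ν ∈ nuTuples n l) (α j : ℕ → ℕ) : ∀ᶠ s in reTop,
      Summable (multLTerm l (fun i => a (idx ν i))
        (consArg (firstArg n ν s α j) (otherArg n ν α j))) ∧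
      IntegrableOn (fun y : ℝ => (I * y) ^ s / y * innerW n ν a α j y) (Ioi 0) ∧
      ∫ y in Ioi (0 : ℝ), (I * y) ^ s / y * innerW n ν a α j y =
        Gamma (s + powExp n (idx ν l) α j) / powDen (idx ν l) j *
          multLSeries l (fun i => a (idx ν i))
            (consArg (firstArg n ν s α j) (otherArg n ν α j)) := by
  obtain ⟨σ, hσ⟩ := exists_mellin_expSum hl (a := fun i => a (idx ν i)) (polyGrowth_idx ha hln hν)
    (consArg (tailArg n ν α j) (otherArg n ν α j))
  refine eventually_reTop.mpr ⟨σ, fun s hs => ?_⟩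
  set e := powExp n (idx ν l) α j with he
  obtain ⟨h1, h2, h3⟩ := hσ (s + e) (by simp; linarith [(Nat.cast_nonneg e : (0 : ℝ) ≤ e)])
  have hc : ∀ i : Fin l, consArg (consArg (tailArg n ν α j) (otherArg n ν α j) 1 + (s + e))
      (consArg (tailArg n ν α j) (otherArg n ν α j)) (i + 1) =
        consArg (firstArg n ν s α j) (otherArg n ν α j) (i + 1) := fun i => by
    rw [consArg_one, tailArg_add]
    by_cases h : (i : ℕ) + 1 = 1
    · rw [h, consArg_one, consArg_one]
    · rw [consArg_of_ne _ _ h, consArg_of_ne _ _ h, consArg_of_ne _ _ h]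
  have hterm : multLTerm l (fun i => a (idx ν i)) (consArg (consArg (tailArg n ν α j)
      (otherArg n ν α j) 1 + (s + e)) (consArg (tailArg n ν α j) (otherArg n ν α j))) =
        multLTerm l (fun i => a (idx ν i)) (consArg (firstArg n ν s α j) (otherArg n ν α j)) := by
    ext m
    exact Finset.prod_congr rfl fun i _ => by rw [hc i]
  rw [hterm] at h1
  rw [multLSeries_congr (fun _ => rfl) hc] at h3
  have key : ∀ y ∈ Ioi (0 : ℝ), I ^ (s + e) / powDen (idx ν l) j *
      ((y : ℂ) ^ (s + e - 1) • expSum l (fun i => a (idx ν i))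
        (consArg (tailArg n ν α j) (otherArg n ν α j)) y) =
      (I * y) ^ s / y * innerW n ν a α j y := fun y hy => by
    have hy' : (y : ℂ) ≠ 0 := by exact_mod_cast (mem_Ioi.mp hy).ne'
    rw [innerW, ← he, ← cpow_natCast, I_mul_ofReal_cpow hy, I_mul_ofReal_cpow hy, cpow_sub _ _ hy',
      cpow_add _ _ hy', cpow_add _ _ I_ne_zero, cpow_one, smul_eq_mul]
    ring
  refine ⟨h1, IntegrableOn.congr_fun (h2.const_mul _) key measurableSet_Ioi, ?_⟩
  rw [← setIntegral_congr_fun measurableSet_Ioi key, integral_const_mul, div_mul_eq_mul_div,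
    div_mul_eq_mul_div, ← h3]
  rfl

/-- The right-hand side of the formula, with the `L`-series. -/
def seriesCombination (n : ℕ) (a : ℕ → ℕ → ℂ) (s : ℂ) (α : ℕ → ℕ) : ℂ :=
  ∑ l ∈ Finset.Icc 1 n, ∑ ν ∈ nuTuples n l,
    gammaFactor n (idx ν l) s α * constProd n a ν * coeffB n (ν (Fin.last l)) (args s α) *
      ∑ j ∈ jTuples n (idx ν l) α, binomFactor (idx ν l) s α j *
        multLSeries l (fun i => a (idx ν i)) (consArg (firstArg n ν s α j) (otherArg n ν α j))

/-- A finite sum of Mellin transforms, whose coefficients are matched by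
`gammaFactor_mul_binomFactor`. The minus sign is the downward orientation of the path. -/
theorem eventually_mellin_decayD (ha : ∀ i, 1 ≤ i → i ≤ n → PolyGrowth (a i)) (α : ℕ → ℕ) :
    ∀ᶠ s in reTop, IntegrableOn (fun y : ℝ => (I * y) ^ s / y * decayD n a α y) (Ioi 0) ∧
      -∫ y in Ioi (0 : ℝ), (I * y) ^ s / y * decayD n a α y = seriesCombination n a s α := by
  have h1 : ∀ᶠ s in reTop, ∀ l ∈ Finset.Icc 1 n, ∀ ν ∈ nuTuples n l,
      ∀ j ∈ jTuples n (idx ν l) α,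
      IntegrableOn (fun y : ℝ => (I * y) ^ s / y * innerW n ν a α j y) (Ioi 0) ∧
      ∫ y in Ioi (0 : ℝ), (I * y) ^ s / y * innerW n ν a α j y =
        Gamma (s + powExp n (idx ν l) α j) / powDen (idx ν l) j *
          multLSeries l (fun i => a (idx ν i))
            (consArg (firstArg n ν s α j) (otherArg n ν α j)) := by
    refine (Filter.eventually_all_finset _).mpr fun l hl => (Filter.eventually_all_finset _).mpr
      fun ν hν => (Filter.eventually_all_finset _).mpr fun j _ => ?_
    rw [Finset.mem_Icc] at hl
    exact (eventually_mellin_innerW ha hl.1 hl.2 hν α j).mono fun s h => h.2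
  have h2 : ∀ᶠ s in reTop, ∀ m : ℕ, s ≠ -(m : ℂ) := eventually_reTop.mpr ⟨0, fun s hs m h => by
    rw [h] at hs
    simp only [neg_re, natCast_re] at hs
    linarith [(Nat.cast_nonneg m : (0 : ℝ) ≤ m)]⟩
  filter_upwards [h1, h2] with s hs hs'
  have hexp : ∀ y : ℝ, (I * y) ^ s / y * decayD n a α y = ∑ l ∈ Finset.Icc 1 n,
      ∑ ν ∈ nuTuples n l, ∑ j ∈ jTuples n (idx ν l) α, constProd n a ν *
        coeffB n (ν (Fin.last l)) (fun r => (α r : ℂ)) * tailCoef n (idx ν l) α j *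
          ((I * y) ^ s / y * innerW n ν a α j y) := fun y => by
    simp only [decayD, termD, Finset.mul_sum]
    refine Finset.sum_congr rfl fun l _ => Finset.sum_congr rfl fun ν _ =>
      Finset.sum_congr rfl fun j _ => by ring
  simp only [hexp]
  constructor
  · exact integrable_finsetSum _ fun l hl => integrable_finsetSum _ fun ν hν =>
      integrable_finsetSum _ fun j hj => (hs l hl ν hν j hj).1.const_mul _
  · rw [integral_finsetSum _ fun l hl => integrable_finsetSum _ fun ν hν =>
      integrable_finsetSum _ fun j hj => (hs l hl ν hν j hj).1.const_mul _, seriesCombination,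
      ← Finset.sum_neg_distrib]
    refine Finset.sum_congr rfl fun l hl => ?_
    rw [integral_finsetSum _ fun ν hν =>
      integrable_finsetSum _ fun j hj => (hs l hl ν hν j hj).1.const_mul _,
      ← Finset.sum_neg_distrib]
    refine Finset.sum_congr rfl fun ν hν => ?_
    rw [integral_finsetSum _ fun j hj => (hs l hl ν hν j hj).1.const_mul _,
      ← Finset.sum_neg_distrib, Finset.mul_sum]
    refine Finset.sum_congr rfl fun j hj => ?_
    have hl' := Finset.mem_Icc.mp hl
    have hlast := last_add_idx hl'.2 hν
    have hle := le_idx ν l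
    have hB : coeffB n (ν (Fin.last l)) (args s α) =
        coeffB n (ν (Fin.last l)) (fun r => (α r : ℂ)) :=
      coeffB_congr fun r hr => args_of_two_le (by omega)
    have hG := gammaFactor_mul_binomFactor (α := α) (hl'.1.trans hle) (by omega : idx ν l ≤ n) hs'
      (fun h => (mem_jTuples.mp hj).1 2 (by omega))
    rw [integral_const_mul, (hs l hl ν hν j hj).2, hB]
    linear_combination (-(constProd n a ν * coeffB n (ν (Fin.last l)) (fun r => (α r : ℂ)) *
      multLSeries l (fun i => a (idx ν i)) (consArg (firstArg n ν s α j) (otherArg n ν α j)))) * hG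

end

/-! ### Regularised iterated integrals from infinity and to zero -/

section

variable {r : ℕ}

/-- The continuation of the iterated integral from `i∞` to `iy`. -/
def regE (r : ℕ) (φ : Fin r → ℝ → ℂ) (c w : Fin r → ℂ) (y : ℝ) : ℂ :=
  (-1) ^ r * (∏ i, I ^ w i) * (regNum r φ c w y / regDen r w)

lemma regE_zero (φ : Fin 0 → ℝ → ℂ) (c w : Fin 0 → ℂ) (y : ℝ) : regE 0 φ c w y = 1 := by
  simp [regE, regNum, regRem, regDen]

lemma hasDerivAt_regNum_div_regDen {φ : Fin (r + 1) → ℝ → ℂ} {c : Fin (r + 1) → ℂ}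
    (h : ∀ i, IsReg (φ i) (c i)) {w : Fin (r + 1) → ℂ} (hw : regDen (r + 1) w ≠ 0) {y : ℝ}
    (hy : 0 < y) :
    HasDerivAt (fun y => regNum (r + 1) φ c w y / regDen (r + 1) w)
      (-(φ 0 y * (y : ℂ) ^ (w 0 - 1) *
        (regNum r (fun i => φ i.succ) (fun i => c i.succ) (fun i => w i.succ) y /
          regDen r fun i => w i.succ))) y := by
  refine ((hasDerivAt_regNum h w hy).div_const _).congr_deriv ?_
  rw [regDen_succ] at hw ⊢
  have h1 := left_ne_zero_of_mul hw
  have h2 := right_ne_zero_of_mul hw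
  have h3 : ∑ i, w i ≠ 0 := fun h => h1 (by rw [h, neg_zero])
  field_simp

lemma I_mul_cpow_div {y : ℝ} (hy : 0 < y) (s : ℂ) :
    (I * y : ℂ) ^ s / y = I ^ s * (y : ℂ) ^ (s - 1) := by
  have hy' : (y : ℂ) ≠ 0 := by exact_mod_cast hy.ne'
  rw [I_mul_ofReal_cpow hy, cpow_sub _ _ hy', cpow_one, mul_div_assoc]

lemma hasDerivAt_regE {φ : Fin (r + 1) → ℝ → ℂ} {c : Fin (r + 1) → ℂ}
    (h : ∀ i, IsReg (φ i) (c i)) {w : Fin (r + 1) → ℂ} (hw : regDen (r + 1) w ≠ 0) {y : ℝ}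
    (hy : 0 < y) :
    HasDerivAt (regE (r + 1) φ c w) (φ 0 y * ((I * y) ^ w 0 / y) *
      regE r (fun i => φ i.succ) (fun i => c i.succ) (fun i => w i.succ) y) y := by
  refine ((hasDerivAt_regNum_div_regDen h hw hy).const_mul _).congr_deriv ?_
  rw [regE, I_mul_cpow_div hy, Fin.prod_univ_succ]
  ring

/-- The coefficient of the leading power of `y` in the asymptotic expansion. -/
def regConst (r : ℕ) (c w : Fin r → ℂ) : ℂ := (∏ i, c i) * ((-1) ^ r / regDen r w)

lemma prod_I_cpow (w : Fin r → ℂ) : ∏ i, I ^ w i = I ^ ∑ i, w i := by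
  rw [cpow_def_of_ne_zero I_ne_zero, Finset.mul_sum, Complex.exp_sum]
  exact Finset.prod_congr rfl fun i _ => cpow_def_of_ne_zero I_ne_zero _

/-- What is left after the leading power is a constant multiple of the exponentially small `regRem`.
Together with the derivative this asymptotic condition determines the regularised integral. -/
lemma tendsto_regE_sub {φ : Fin r → ℝ → ℂ} {c : Fin r → ℂ} (h : ∀ i, IsReg (φ i) (c i))
    (w : Fin r → ℂ) :
    Tendsto (fun y : ℝ => regE r φ c w y - regConst r c w * (I * y) ^ ∑ i, w i) atTop (𝓝 0) := by
  obtain ⟨ε, hε, C, δ, hC, hδ, hb⟩ := (regRemGood h).bound w 1 one_pos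
  have h1 : Tendsto (fun y : ℝ => C * Real.exp (-δ * y)) atTop (𝓝 0) := by
    have : Tendsto (fun y : ℝ => -δ * y) atTop atBot :=
      tendsto_id.const_mul_atTop_of_neg (neg_lt_zero.mpr hδ)
    simpa using (Real.tendsto_exp_atBot.comp this).const_mul C
  have h2 : Tendsto (fun y : ℝ => regRem r φ c w y) atTop (𝓝 0) := by
    refine squeeze_zero_norm' ?_ h1
    filter_upwards [eventually_ge_atTop 1] with y hy using hb w (Metric.mem_ball_self hε) y hy
  have h3 := h2.const_mul ((-1) ^ r * (∏ i, I ^ w i) / regDen r w)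
  rw [mul_zero] at h3
  refine h3.congr' ?_
  filter_upwards [eventually_gt_atTop 0] with y hy
  rw [regE, regNum, regConst, I_mul_ofReal_cpow hy, prod_I_cpow]
  ring

/-- The uniqueness principle that identifies regularised integrals with explicit expansions. -/
lemma eq_of_hasDerivAt_of_tendsto {f g : ℝ → ℂ} {f' : ℝ → ℂ}
    (hf : ∀ y, 0 < y → HasDerivAt f (f' y) y) (hg : ∀ y, 0 < y → HasDerivAt g (f' y) y)
    (h : Tendsto (fun y => f y - g y) atTop (𝓝 0)) {y : ℝ} (hy : 0 < y) : f y = g y := by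
  have hd : ∀ y, 0 < y → HasDerivAt (fun y => f y - g y) 0 y := fun y hy =>
    ((hf y hy).fun_sub (hg y hy)).congr_deriv (sub_self _)
  obtain ⟨c, hc⟩ := isOpen_Ioi.exists_is_const_of_deriv_eq_zero isPreconnected_Ioi
    (fun y hy => (hd y hy).differentiableAt.differentiableWithinAt) (fun y hy => (hd y hy).deriv)
  have h1 : c = 0 := by
    refine tendsto_nhds_unique (tendsto_const_nhds.congr' ?_) h
    filter_upwards [eventually_gt_atTop 0] with y hy using (hc y hy).symm
  exact sub_eq_zero.mp ((hc y hy).trans h1)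

lemma block_succ {X : Type} (x : ℕ → X) (p r : ℕ) :
    (fun i : Fin r => block x p (r + 1) i.succ) = block x (p + 1) r := by
  ext i
  simp only [block, Fin.val_succ]
  congr 1
  omega

lemma block_apply_zero {X : Type} (x : ℕ → X) (p r : ℕ) : block x p (r + 1) 0 = x (p + 1) := rfl

lemma sum_block (x : ℕ → ℂ) (p r : ℕ) :
    ∑ i, block x p r i = ∑ q ∈ Finset.Icc (p + 1) (p + r), x q := by
  rw [Finset.sum_bij (s := Finset.univ) (t := Finset.Icc (p + 1) (p + r)) (f := block x p r)
    (g := x) (i := fun i _ => p + 1 + i)]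
  · intro i _
    rw [Finset.mem_Icc]
    omega
  · intro i _ j _ h
    exact Fin.ext (by omega)
  · intro q hq
    rw [Finset.mem_Icc] at hq
    exact ⟨⟨q - (p + 1), by omega⟩, Finset.mem_univ _, by simp only []; omega⟩
  · intro i _
    rfl

lemma prod_block (x : ℕ → ℂ) (p r : ℕ) :
    ∏ i, block x p r i = ∏ q ∈ Finset.Icc (p + 1) (p + r), x q := by
  rw [Finset.prod_bij (s := Finset.univ) (t := Finset.Icc (p + 1) (p + r)) (f := block x p r)
    (g := x) (i := fun i _ => p + 1 + i)]
  · intro i _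
    rw [Finset.mem_Icc]
    omega
  · intro i _ j _ h
    exact Fin.ext (by omega)
  · intro q hq
    rw [Finset.mem_Icc] at hq
    exact ⟨⟨q - (p + 1), by omega⟩, Finset.mem_univ _, by simp only []; omega⟩
  · intro i _
    rfl

lemma regDen_block_succ (x : ℕ → ℂ) (p r : ℕ) :
    regDen (r + 1) (block x p (r + 1)) =
      -(∑ q ∈ Finset.Icc (p + 1) (p + (r + 1)), x q) * regDen r (block x (p + 1) r) := by
  rw [regDen_succ, sum_block, block_succ]

lemma regDen_block_ne_zero {x : ℕ → ℂ} {p r : ℕ}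
    (h : ∀ i, p < i → i ≤ p + r → ∑ q ∈ Finset.Icc i (p + r), x q ≠ 0) :
    regDen r (block x p r) ≠ 0 := by
  induction r generalizing p with
  | zero => simp [regDen]
  | succ r ih =>
    rw [regDen_block_succ]
    refine mul_ne_zero (neg_ne_zero.mpr (h (p + 1) (by omega) (by omega))) (ih fun i hi hi' => ?_)
    have := h i (by omega) (by omega)
    rwa [show p + 1 + r = p + (r + 1) by omega]

lemma coeffB_succ_self (n : ℕ) (x : ℕ → ℂ) :
    coeffB (n + 1) (n + 1) x = (∑ q ∈ Finset.Icc 1 (n + 1), x q)⁻¹ * coeffB n n fun i => x (i + 1) := by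
  rw [← coeffB_succ le_rfl, coeffB, Finset.prod_Icc_succ_top (by omega), mul_comm, coeffB,
    show n + 1 - (n + 1) + 1 = 1 by omega]

lemma neg_one_pow_div_regDen_block (x : ℕ → ℂ) (r : ℕ) :
    (-1) ^ r / regDen r (block x 0 r) = coeffB r r x := by
  induction r generalizing x with
  | zero => simp [regDen, coeffB]
  | succ r ih =>
    have h : block x 1 r = block (fun i => x (i + 1)) 0 r := by
      ext i
      simp only [block]
      congr 1
      omega
    rw [coeffB_succ_self, ← ih, regDen_block_succ, zero_add, zero_add, h, pow_succ]
    rw [neg_mul, mul_neg_one, neg_div_neg_eq, div_mul_eq_div_div_swap, div_eq_mul_inv _ (Finset.sum _ _),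
      mul_comm]

lemma regConst_block (c x : ℕ → ℂ) (r : ℕ) :
    regConst r (block c 0 r) (block x 0 r) =
      (∏ q ∈ Finset.Icc 1 r, c q) * coeffB r r x := by
  rw [regConst, prod_block, neg_one_pow_div_regDen_block, zero_add, zero_add]

end

/-! ### Inversion and iterated integrals to zero -/

lemma IsAxisForm.isReg {N : ℕ} {k : ℤ} {a : ℕ → ℂ} {F : ℝ → ℂ} (h : IsAxisForm N k a F) :
    IsReg F (a 0) := ⟨h.continuousOn, h.decay⟩

/-- The function `u ↦ F(1 / (N u)) u⁻ᵏ`. -/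
def invForm (N : ℕ) (k : ℤ) (F : ℝ → ℂ) (u : ℝ) : ℂ := F (1 / (N * u)) * (u : ℂ) ^ (-k)

lemma IsAxisForm.exists_isReg_invForm {N : ℕ} (hN : 0 < N) {k : ℤ} {a : ℕ → ℂ} {F : ℝ → ℂ}
    (h : IsAxisForm N k a F) : ∃ b, IsReg (invForm N k F) b := by
  obtain ⟨b, hb⟩ := h.decay_inv
  refine ⟨b, ContinuousOn.mul ?_ ?_, hb⟩
  · refine h.continuousOn.comp (ContinuousOn.div continuousOn_const (by fun_prop) fun u hu => ?_)
      fun u hu => ?_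
    · have := mem_Ioi.mp hu
      positivity
    · have := mem_Ioi.mp hu
      rw [mem_Ioi]
      positivity
  · exact ContinuousOn.zpow₀ (by fun_prop) _ fun u hu => Or.inl (by exact_mod_cast (mem_Ioi.mp hu).ne')

/-- The entries `x_j, x_{j-1}, …, x₁` of a sequence. -/
def revBlock {X : Type} (x : ℕ → X) (j : ℕ) : Fin j → X := fun i => x (j - i)

lemma revBlock_succ {X : Type} (x : ℕ → X) (j : ℕ) :
    (fun i : Fin j => revBlock x (j + 1) i.succ) = revBlock x j := by
  ext i
  simp only [revBlock, Fin.val_succ, Nat.add_sub_add_right]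

lemma sum_revBlock (x : ℕ → ℂ) (j : ℕ) : ∑ i, revBlock x j i = ∑ q ∈ Finset.Icc 1 j, x q := by
  induction j with
  | zero => simp
  | succ j ih =>
    rw [Fin.sum_univ_succ, Finset.sum_Icc_succ_top (by omega), ← ih, ← revBlock_succ x j, add_comm]
    rfl

/-- The continuation of the iterated integral from `ix` to `0`, of functions `F₁, …, F_j` with
`Φᵢ(u) = Fᵢ(1 / (N u)) u ^ (-kᵢ)`. -/
def regG (N j : ℕ) (Φ : ℕ → ℝ → ℂ) (b : ℕ → ℂ) (k : ℕ → ℤ) (s : ℕ → ℂ) (x : ℝ) : ℂ :=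
  (-1) ^ j * (∏ i, (I * ((N : ℝ)⁻¹ : ℝ)) ^ revBlock s j i) *
    (regNum j (revBlock Φ j) (revBlock b j) (revBlock (fun i => k i - s i) j) (1 / (N * x)) /
      regDen j (revBlock (fun i => k i - s i) j))

lemma regG_zero (N : ℕ) (Φ : ℕ → ℝ → ℂ) (b : ℕ → ℂ) (k : ℕ → ℤ) (s : ℕ → ℂ) (x : ℝ) :
    regG N 0 Φ b k s x = 1 := by
  simp [regG, regNum, regRem, regDen]

/-- The effect of the substitution `z ↦ -1 / (N z)` on the powers. -/
lemma cpow_inversion {N : ℕ} (hN : 0 < N) {u : ℝ} (hu : 0 < u) (k : ℤ) (s : ℂ) :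
    (I * ((N : ℝ)⁻¹ : ℝ) : ℂ) ^ s * (u : ℂ) ^ (-k) * (u : ℂ) ^ ((k : ℂ) - s - 1) *
      ((N * u ^ 2 : ℝ) : ℂ) = (I * ((1 / (N * u) : ℝ) : ℂ)) ^ s / ((1 / (N * u) : ℝ) : ℂ) := by
  have hN' : (0 : ℝ) < N := by exact_mod_cast hN
  have hu' : (u : ℂ) ≠ 0 := by exact_mod_cast hu.ne'
  have hx : 0 < 1 / (N * u) := by positivity
  set x : ℝ := 1 / (N * u) with hx_def
  have hNu : (N : ℝ)⁻¹ = u * x := by rw [hx_def]; field_simp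
  have hNu2 : (N * u ^ 2 : ℝ) = u / x := by rw [hx_def]; field_simp
  clear_value x
  have hx' : (x : ℂ) ≠ 0 := by exact_mod_cast hx.ne'
  have hus : (u : ℂ) ^ s ≠ 0 := by simp [cpow_eq_zero_iff, hu']
  rw [I_mul_ofReal_cpow (by positivity), hNu, hNu2, ofReal_mul, mul_cpow_ofReal_nonneg hu.le hx.le,
    cpow_sub _ _ hu', cpow_sub _ _ hu', cpow_one, cpow_intCast, zpow_neg, I_mul_ofReal_cpow hx,
    ofReal_div]
  have := zpow_ne_zero k hu'
  field_simp

/-- Inversion reverses the order of the forms, so differentiation removes the last one, whereas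
`regE` loses its first. This is what makes the sum over division points telescope. -/
lemma hasDerivAt_regG {N j : ℕ} (hN : 0 < N) {F : ℕ → ℝ → ℂ} {b : ℕ → ℂ} {k : ℕ → ℤ} {s : ℕ → ℂ}
    (h : ∀ i, 1 ≤ i → i ≤ j + 1 → IsReg (invForm N (k i) (F i)) (b i))
    (hw : regDen (j + 1) (revBlock (fun i => k i - s i) (j + 1)) ≠ 0) {x : ℝ} (hx : 0 < x) :
    HasDerivAt (regG N (j + 1) (fun i => invForm N (k i) (F i)) b k s)
      (-(F (j + 1) x * ((I * x) ^ s (j + 1) / x) *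
        regG N j (fun i => invForm N (k i) (F i)) b k s x)) x := by
  have hN' : (0 : ℝ) < N := by exact_mod_cast hN
  have hu : 0 < 1 / (N * x) := by positivity
  have hreg : ∀ i, IsReg (revBlock (fun i => invForm N (k i) (F i)) (j + 1) i) (revBlock b (j + 1) i) :=
    fun i => h _ (by omega) (by omega)
  have h1 := hasDerivAt_regNum_div_regDen hreg hw hu
  have h2 : HasDerivAt (fun x : ℝ => 1 / (N * x)) (-(1 / (N * x ^ 2))) x := by
    have := ((hasDerivAt_id x).const_mul (N : ℝ)).inv (by simp only [id_eq]; positivity)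
    simp only [one_div]
    refine this.congr_deriv ?_
    simp only [id_eq]
    field_simp
  have h3 := (h1.scomp x h2).const_mul
    ((-1) ^ (j + 1) * (∏ i, (I * ((N : ℝ)⁻¹ : ℝ)) ^ revBlock s (j + 1) i))
  refine h3.congr_deriv ?_
  rw [revBlock_succ, revBlock_succ, revBlock_succ, regG, I_mul_cpow_div hx, Fin.prod_univ_succ]
  have h4 : (fun i : Fin j => revBlock s (j + 1) i.succ) = revBlock s j := revBlock_succ _ _
  have h5 : ∏ i : Fin j, (I * ((N : ℝ)⁻¹ : ℝ) : ℂ) ^ revBlock s (j + 1) i.succ =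
      ∏ i : Fin j, (I * ((N : ℝ)⁻¹ : ℝ) : ℂ) ^ revBlock s j i :=
    Finset.prod_congr rfl fun i _ => by rw [← congrFun h4 i]
  have h6 := cpow_inversion hN hu (k (j + 1)) (s (j + 1))
  rw [show (1 : ℝ) / (N * (1 / (N * x))) = x by field_simp,
    show (N : ℝ) * (1 / (N * x)) ^ 2 = 1 / (N * x ^ 2) by field_simp, I_mul_cpow_div hx] at h6
  have h7 : revBlock (fun i => invForm N (k i) (F i)) (j + 1) 0 (1 / (N * x)) =
      F (j + 1) x * ((1 / (N * x) : ℝ) : ℂ) ^ (-k (j + 1)) := by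
    have : (1 : ℝ) / (N * (1 / (N * x))) = x := by field_simp
    simp only [revBlock, invForm, Fin.val_zero, Nat.sub_zero, this]
  have h8 : revBlock (fun i => (k i : ℂ) - s i) (j + 1) 0 = k (j + 1) - s (j + 1) := rfl
  have h9 : revBlock s (j + 1) 0 = s (j + 1) := rfl
  rw [h5, h7, h8, h9, ← h6, real_smul]
  push_cast
  ring

lemma exists_norm_regNum_div_le {r : ℕ} {φ : Fin r → ℝ → ℂ} {c : Fin r → ℂ}
    (h : ∀ i, IsReg (φ i) (c i)) {w : Fin r → ℂ} (hw : w ∈ domInfty r) (hd : regDen r w ≠ 0)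
    {x₀ : ℝ} (hx₀ : 0 < x₀) :
    ∃ C : ℝ, 0 ≤ C ∧ ∀ x, x₀ ≤ x → ‖regNum r φ c w x / regDen r w‖ ≤ C * x ^ (∑ i, w i).re := by
  obtain ⟨C, hC, hb⟩ := integrableOn_powIntegrand h hw hx₀
  refine ⟨C, hC, fun x hx => ?_⟩
  rw [regNum_eq_regDen_mul_integral h hw (hx₀.trans_le hx), mul_div_cancel_left₀ _ hd]
  exact (norm_integral_le_integral_norm _).trans (hb x hx).2

/-! ### The identity for large real part -/

lemma mem_domInfty_succ {r : ℕ} {w : Fin (r + 1) → ℂ} :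
    w ∈ domInfty (r + 1) ↔ (∑ i, w i).re < 0 ∧ (fun i => w i.succ : Fin r → ℂ) ∈ domInfty r := by
  refine ⟨fun h => ⟨sum_re_neg_of_mem_domInfty h, tail_mem_domInfty h⟩, fun h i => ?_⟩
  refine Fin.cases ?_ (fun i => ?_) i
  · rw [show Finset.Ici (0 : Fin (r + 1)) = Finset.univ from by ext; simp]
    exact h.1
  · rw [← Fin.map_succEmb_Ici, Finset.sum_map]
    exact h.2 i

lemma revBlock_mem_domInfty {w : ℕ → ℂ} {j : ℕ} :
    revBlock w j ∈ domInfty j ↔ ∀ q, 1 ≤ q → q ≤ j → (∑ t ∈ Finset.Icc 1 q, w t).re < 0 := by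
  induction j with
  | zero => exact ⟨fun _ q h1 h2 => by omega, fun _ i => i.elim0⟩
  | succ j ih =>
    rw [mem_domInfty_succ, sum_revBlock, revBlock_succ, ih]
    constructor
    · rintro ⟨h1, h2⟩ q hq hq'
      rcases Nat.lt_or_ge j q with h | h
      · rwa [show q = j + 1 by omega]
      · exact h2 q hq h
    · exact fun h => ⟨h _ (by omega) le_rfl, fun q hq hq' => h q hq (by omega)⟩

lemma regDen_revBlock_ne_zero {w : ℕ → ℂ} {j : ℕ}
    (h : ∀ q, 1 ≤ q → q ≤ j → ∑ t ∈ Finset.Icc 1 q, w t ≠ 0) : regDen j (revBlock w j) ≠ 0 := by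
  induction j with
  | zero => simp [regDen]
  | succ j ih =>
    rw [regDen_succ, sum_revBlock, revBlock_succ]
    exact mul_ne_zero (neg_ne_zero.mpr (h _ (by omega) le_rfl)) (ih fun q hq hq' => h q hq (by omega))

lemma sum_natCast_ne_zero {α : ℕ → ℕ} {i n : ℕ} (hin : i ≤ n) (hα : 0 < α i) :
    ∑ q ∈ Finset.Icc i n, (α q : ℂ) ≠ 0 := by
  have h : 0 < ∑ q ∈ Finset.Icc i n, α q :=
    hα.trans_le (Finset.single_le_sum (f := α) (fun _ _ => Nat.zero_le _) (Finset.left_mem_Icc.mpr hin))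
  exact_mod_cast h.ne'

lemma block_eq_block_zero {X : Type} (x : ℕ → X) (p r : ℕ) :
    block x p r = block (fun i => x (i + p)) 0 r := by
  ext i
  simp only [block]
  congr 1
  omega

section

variable {N n : ℕ} {F : ℕ → ℝ → ℂ} {a : ℕ → ℕ → ℂ} {k : ℕ → ℤ} {α : ℕ → ℕ}

/-- Inductively both sides have the same derivative, and both differ from the same power of `iy` by
a function tending to zero. The blocks start at index `p + 2`, which corresponds to the indices from
`2` on in `expandE` shifted by `p`. -/
lemma regE_eq_expandE (hF : ∀ i, 1 ≤ i → i ≤ n → IsAxisForm N (k i) (a i) (F i))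
    (hα : ∀ r, 2 ≤ r → r ≤ n → 0 < α r) {r p : ℕ} (hp : p + 1 + r ≤ n) {y : ℝ} (hy : 0 < y) :
    regE r (block F (p + 1) r) (block (fun i => a i 0) (p + 1) r)
        (block (fun i => (α i : ℂ)) (p + 1) r) y =
      expandE r (fun i => a (i + p)) (fun i => α (i + p)) y := by
  induction r generalizing p y with
  | zero => rw [regE_zero, expandE_zero]
  | succ r ih =>
    have hreg : ∀ i, IsReg (block F (p + 1) (r + 1) i) (block (fun i => a i 0) (p + 1) (r + 1) i) :=
      fun i => (hF _ (by omega) (by omega)).isReg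
    have hden : regDen (r + 1) (block (fun i => (α i : ℂ)) (p + 1) (r + 1)) ≠ 0 :=
      regDen_block_ne_zero fun i h1 h2 => sum_natCast_ne_zero h2 (hα i (by omega) (by omega))
    have hpg : ∀ i, 1 ≤ i → i ≤ r + 1 + 1 → PolyGrowth (a (i + p)) := fun i h1 h2 =>
      (hF (i + p) (by omega) (by omega)).polyGrowth
    refine eq_of_hasDerivAt_of_tendsto (fun y hy => hasDerivAt_regE hreg hden hy)
      (fun y hy => ?_) ?_ hy
    · refine (hasDerivAt_expandE_succ (fun i h1 h2 => hpg i (by omega) h2)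
        (hα (2 + p) (by omega) (by omega)) hy ((hF (2 + p) (by omega) (by omega)).hasSum y hy)).congr_deriv ?_
      rw [block_succ, block_succ, block_succ, ih (by omega) hy, block_apply_zero, block_apply_zero,
        cpow_natCast, show 2 + p = p + 1 + 1 by omega,
        show (fun i => a (i + 1 + p)) = fun i => a (i + (p + 1)) from funext fun i => by
          rw [show i + 1 + p = i + (p + 1) by omega],
        show (fun i => α (i + 1 + p)) = fun i => α (i + (p + 1)) from funext fun i => by
          rw [show i + 1 + p = i + (p + 1) by omega]]
      ring
    · have h1 := tendsto_regE_sub hreg (block (fun i => (α i : ℂ)) (p + 1) (r + 1))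
      have h2 := (isTame_expandE_sub hpg (fun i => α (i + p))).1
      have h3 := h1.sub h2
      rw [sub_zero] at h3
      refine h3.congr fun y => ?_
      have h4 : regConst (r + 1) (block (fun i => a i 0) (p + 1) (r + 1))
          (block (fun i => (α i : ℂ)) (p + 1) (r + 1)) =
            (∏ i ∈ Finset.Icc 2 (r + 1 + 1), a (i + p) 0) *
              coeffB (r + 1 + 1) (r + 1) (fun r => ((α (r + p) : ℕ) : ℂ)) := by
        rw [block_eq_block_zero _ (p + 1), block_eq_block_zero _ (p + 1), regConst_block,
          coeffB_succ le_rfl, show Finset.Icc 2 (r + 1 + 1) = Finset.Icc (1 + 1) (r + 1 + 1) from rfl,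
          prod_Icc_add_one (fun i => a (i + p) 0)]
        congr 1
        · refine Finset.prod_congr rfl fun i _ => ?_
          rw [show i + (p + 1) = i + 1 + p by omega]
        · refine coeffB_congr fun i _ => ?_
          rw [show i + (p + 1) = i + 1 + p by omega]
      have h5 : ∑ i, block (fun i => (α i : ℂ)) (p + 1) (r + 1) i =
          ((∑ i ∈ Finset.Icc 2 (r + 1 + 1), α (i + p) : ℕ) : ℂ) := by
        rw [block_eq_block_zero, sum_block, show Finset.Icc 2 (r + 1 + 1) =
          Finset.Icc (1 + 1) (r + 1 + 1) from rfl, sum_Icc_add_one, zero_add, zero_add]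
        push_cast
        refine Finset.sum_congr rfl fun i _ => ?_
        rw [show i + (p + 1) = i + 1 + p by omega]
      rw [h4, h5, cpow_natCast]
      ring

lemma block_args {p : ℕ} (hp : 1 ≤ p) (s : ℂ) (r : ℕ) :
    block (args s α) p r = block (fun i => (α i : ℂ)) p r :=
  funext fun _ => args_of_two_le (by omega)

lemma tendsto_Ioi_integral {f : ℝ → ℂ} (hf : IntegrableOn f (Ioi 0)) :
    Tendsto (fun x => ∫ y in Ioi x, f y) (𝓝[>] 0) (𝓝 (∫ y in Ioi 0, f y)) := by
  have h1 : AECover (volume.restrict (Ioi (0 : ℝ))) (𝓝[>] (0 : ℝ)) fun x => Ioi x :=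
    aecover_Ioi_of_Ioi (tendsto_id.mono_left nhdsWithin_le_nhds)
  refine (h1.integral_tendsto_of_countably_generated hf).congr' ?_
  filter_upwards [self_mem_nhdsWithin] with x hx
  rw [Measure.restrict_restrict measurableSet_Ioi, Ioi_inter_Ioi, max_eq_left (le_of_lt hx)]

lemma tendsto_I_mul_cpow {T : ℂ} (hT : 0 < T.re) :
    Tendsto (fun y : ℝ => (I * y : ℂ) ^ T) (𝓝[>] 0) (𝓝 0) := by
  have h1 : Tendsto (fun y : ℝ => y ^ T.re) (𝓝[>] 0) (𝓝 0) := by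
    have := (Real.continuousAt_rpow_const 0 T.re (Or.inr hT.le)).tendsto
    rw [Real.zero_rpow hT.ne'] at this
    exact this.mono_left nhdsWithin_le_nhds
  have h2 := h1.const_mul ‖(I ^ T : ℂ)‖
  rw [mul_zero] at h2
  refine squeeze_zero_norm' ?_ h2
  filter_upwards [self_mem_nhdsWithin] with y hy
  rw [I_mul_ofReal_cpow hy, norm_mul, norm_ofReal_cpow_Ioi hy]

/-- The limit at zero of the iterated integral from infinity. -/
lemma tendsto_regE_zero (hF : ∀ i, 1 ≤ i → i ≤ n + 1 → IsAxisForm N (k i) (a i) (F i))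
    (hα : ∀ r, 2 ≤ r → r ≤ n + 1 → 0 < α r) {s S : ℂ}
    (hs : 0 < (s + ∑ r ∈ Finset.Icc 2 (n + 1), (α r : ℂ)).re)
    (hden : regDen (n + 1) (block (args s α) 0 (n + 1)) ≠ 0)
    (hint : IntegrableOn (fun y : ℝ => (I * y) ^ s / y * decayD (n + 1) a α y) (Ioi 0))
    (hS : -∫ y in Ioi (0 : ℝ), (I * y) ^ s / y * decayD (n + 1) a α y = S) :
    Tendsto (regE (n + 1) (block F 0 (n + 1)) (block (fun i => a i 0) 0 (n + 1))
      (block (args s α) 0 (n + 1))) (𝓝[>] 0) (𝓝 S) := by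
  set T := s + ∑ r ∈ Finset.Icc 2 (n + 1), (α r : ℂ) with hT
  have hsum : ∑ i, block (args s α) 0 (n + 1) i = T := by
    rw [sum_block, zero_add, zero_add, sum_args_Icc_one (by omega)]
  have hT0 : T ≠ 0 := fun h => by simp [h] at hs
  set C₀ := regConst (n + 1) (block (fun i => a i 0) 0 (n + 1)) (block (args s α) 0 (n + 1)) with hC₀
  have hreg : ∀ i, IsReg (block F 0 (n + 1) i) (block (fun i => a i 0) 0 (n + 1) i) :=
    fun i => (hF _ (by omega) (by omega)).isReg
  have hCT : C₀ * T = (∏ i ∈ Finset.Icc 1 (n + 1), a i 0) *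
      coeffB (n + 1) n (fun r => (α r : ℂ)) := by
    rw [hC₀, regConst_block, coeffB_succ_self, sum_args_Icc_one (by omega), ← hT,
      coeffB_succ le_rfl, coeffB_congr (x := fun i => args s α (i + 1))
        (x' := fun r => (α (r + 1) : ℂ)) fun r hr => args_of_two_le (by omega)]
    field_simp
  -- Subtracting the leading power removes the non-decaying part of the integrand; by `hCT` the
  -- coefficients match exactly.
  have hd : ∀ y, 0 < y → HasDerivAt (fun y : ℝ => regE (n + 1) (block F 0 (n + 1))
      (block (fun i => a i 0) 0 (n + 1)) (block (args s α) 0 (n + 1)) y - C₀ * (I ^ T * (y : ℂ) ^ T))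
      ((I * y) ^ s / y * decayD (n + 1) a α y) y := fun y hy => by
    have hy' : (y : ℂ) ≠ 0 := by exact_mod_cast hy.ne'
    refine ((hasDerivAt_regE hreg hden hy).fun_sub
      (((hasDerivAt_ofReal_cpow' T hy).const_mul (I ^ T)).const_mul C₀)).congr_deriv ?_
    have h1 := regE_eq_expandE hF hα (p := 0) (r := n) (by omega) hy
    have h2 := mul_expandE (fun i h1 h2 => (hF i h1 h2).polyGrowth) α hy
      ((hF 1 le_rfl (by omega)).hasSum y hy)
    simp only [add_zero] at h1
    rw [block_succ, block_succ, block_succ, block_args le_rfl, h1, block_apply_zero,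
      block_apply_zero, zero_add, show args s α 1 = s from rfl]
    have h3 : (I * y : ℂ) ^ s / y * (I * y) ^ (∑ r ∈ Finset.Icc 2 (n + 1), α r) =
        I ^ T * (y : ℂ) ^ (T - 1) := by
      rw [← I_mul_cpow_div hy, hT, cpow_add _ _ (mul_ne_zero I_ne_zero hy'), ← cpow_natCast]
      push_cast
      ring
    linear_combination ((I * y : ℂ) ^ s / y) * h2 + C₀ * T * h3 -
      ((I * y : ℂ) ^ s / y * (I * y) ^ (∑ r ∈ Finset.Icc 2 (n + 1), α r)) * hCT
  have hlim := tendsto_regE_sub hreg (block (args s α) 0 (n + 1))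
  rw [hsum, ← hC₀] at hlim
  have hlim' : Tendsto (fun y : ℝ => regE (n + 1) (block F 0 (n + 1))
      (block (fun i => a i 0) 0 (n + 1)) (block (args s α) 0 (n + 1)) y -
        C₀ * (I ^ T * (y : ℂ) ^ T)) atTop (𝓝 0) := by
    refine hlim.congr' ?_
    filter_upwards [eventually_gt_atTop 0] with y hy
    rw [I_mul_ofReal_cpow hy]
  have h1 : ∀ x, 0 < x → regE (n + 1) (block F 0 (n + 1)) (block (fun i => a i 0) 0 (n + 1))
      (block (args s α) 0 (n + 1)) x =
        -(∫ y in Ioi x, (I * y) ^ s / y * decayD (n + 1) a α y) + C₀ * (I * x) ^ T := fun x hx => by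
    have := integral_Ioi_of_hasDerivAt_of_tendsto' (fun y hy => hd y (hx.trans_le hy))
      (hint.mono_set (Ioi_subset_Ioi hx.le)) hlim'
    rw [this, I_mul_ofReal_cpow hx]
    ring
  have h2 := (tendsto_Ioi_integral hint).neg.add ((tendsto_I_mul_cpow hs).const_mul C₀)
  rw [hS, mul_zero, add_zero] at h2
  refine h2.congr' ?_
  filter_upwards [self_mem_nhdsWithin] with x hx using (h1 x hx).symm


/-- Sums over the points where a path is divided have derivative zero. -/
lemma hasDerivAt_sum_mul_zero {e g : ℕ → ℝ → ℂ} {e' g' θ : ℕ → ℂ} {x : ℝ}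
    (he : ∀ j ≤ n, HasDerivAt (e j) (e' j) x) (hg : ∀ j ≤ n, HasDerivAt (g j) (g' j) x)
    (he' : ∀ j < n, e' j = θ (j + 1) * e (j + 1) x) (hen : e' n = 0)
    (hg' : ∀ j < n, g' (j + 1) = -(θ (j + 1) * g j x)) (hg0 : g' 0 = 0) :
    HasDerivAt (fun x => ∑ j ∈ Finset.range (n + 1), e j x * g j x) 0 x := by
  have h : ∀ j ∈ Finset.range (n + 1),
      HasDerivAt (fun x => e j x * g j x) (e' j * g j x + e j x * g' j) x := fun j hj => by
    rw [Finset.mem_range, Nat.lt_succ_iff] at hj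
    exact (he j hj).mul (hg j hj)
  refine (HasDerivAt.fun_sum h).congr_deriv ?_
  rw [Finset.sum_add_distrib, Finset.sum_range_succ, hen, Finset.sum_range_succ', hg0,
    zero_mul, mul_zero, add_zero, add_zero, ← Finset.sum_add_distrib]
  refine Finset.sum_eq_zero fun j hj => ?_
  rw [Finset.mem_range] at hj
  rw [he' j hj, hg' j hj]
  ring

/-- The points `s` at which the denominators of the continued integrals do not vanish. -/
def DenNeZero (n : ℕ) (k : ℕ → ℤ) (α : ℕ → ℕ) (s : ℂ) : Prop :=
  s + ∑ r ∈ Finset.Icc 2 n, (α r : ℂ) ≠ 0 ∧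
    ∀ j, 1 ≤ j → j ≤ n → s + ∑ r ∈ Finset.Icc 2 j, (α r : ℂ) ≠ ∑ r ∈ Finset.Icc 1 j, (k r : ℂ)

lemma DenNeZero.block {s : ℂ} (h : DenNeZero n k α s) (hα : ∀ r, 2 ≤ r → r ≤ n → 0 < α r)
    {j r : ℕ} (hj : j + r = n) : regDen r (block (args s α) j r) ≠ 0 := by
  refine regDen_block_ne_zero fun i h1 h2 => ?_
  rw [hj]
  rcases eq_or_ne i 1 with rfl | hi
  · rw [sum_args_Icc_one (by omega)]
    exact h.1
  · rw [Finset.sum_congr rfl fun q hq => args_of_two_le (by rw [Finset.mem_Icc] at hq; omega)]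
    exact sum_natCast_ne_zero (by omega) (hα i (by omega) (by omega))

lemma DenNeZero.revBlock {s : ℂ} (h : DenNeZero n k α s) {j : ℕ} (hj : j ≤ n) :
    regDen j (revBlock (fun i => k i - args s α i) j) ≠ 0 := by
  refine regDen_revBlock_ne_zero fun q h1 h2 => ?_
  rw [Finset.sum_sub_distrib, sum_args_Icc_one h1]
  exact sub_ne_zero.mpr (h.2 q h1 (by omega)).symm

lemma finite_not_denNeZero (n : ℕ) (k : ℕ → ℤ) (α : ℕ → ℕ) : {s | ¬ DenNeZero n k α s}.Finite := by
  refine ((Set.finite_singleton (-∑ r ∈ Finset.Icc 2 n, (α r : ℂ))).union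
    ((Finset.Icc 1 n).image fun j => ∑ r ∈ Finset.Icc 1 j, (k r : ℂ) -
      ∑ r ∈ Finset.Icc 2 j, (α r : ℂ)).finite_toSet).subset fun s hs => ?_
  simp only [DenNeZero, Set.mem_ofPred_eq, not_and_or, not_not, not_forall] at hs
  rcases hs with hs | ⟨j, h1, h2, h3⟩
  · exact Or.inl (eq_neg_of_add_eq_zero_left hs)
  · refine Or.inr (Finset.mem_coe.mpr (Finset.mem_image.mpr ⟨j, Finset.mem_Icc.mpr ⟨h1, h2⟩, ?_⟩))
    rw [← h3]
    ring

lemma eventually_denNeZero (n : ℕ) (k : ℕ → ℤ) (α : ℕ → ℕ) : ∀ᶠ s in reTop, DenNeZero n k α s := by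
  obtain ⟨σ, hσ⟩ := ((finite_not_denNeZero n k α).image Complex.re).bddAbove
  refine eventually_reTop.mpr ⟨σ, fun s hs => ?_⟩
  by_contra h
  exact absurd (hσ (Set.mem_image_of_mem _ h)) (not_le.mpr hs)

lemma eventually_revBlock_mem (n : ℕ) (k : ℕ → ℤ) (α : ℕ → ℕ) (c : ℝ) : ∀ᶠ s in reTop,
    ∀ j, 1 ≤ j → j ≤ n → (∑ i ∈ Finset.Icc 1 j, ((k i : ℂ) - args s α i)).re < c := by
  have h : ∀ᶠ s in reTop, ∀ j ∈ Finset.Icc 1 n,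
      (∑ i ∈ Finset.Icc 1 j, ((k i : ℂ) - args s α i)).re < c := by
    refine (Filter.eventually_all_finset _).mpr fun j hj => ?_
    rw [Finset.mem_Icc] at hj
    refine eventually_reTop.mpr ⟨(∑ i ∈ Finset.Icc 1 j, (k i : ℂ)).re - c, fun s hs => ?_⟩
    have h1 : 0 ≤ (∑ r ∈ Finset.Icc 2 j, (α r : ℂ)).re := by
      have : (0 : ℝ) ≤ (∑ r ∈ Finset.Icc 2 j, α r : ℕ) := Nat.cast_nonneg _
      rwa [← natCast_re, Nat.cast_sum] at this
    rw [Finset.sum_sub_distrib, sum_args_Icc_one hj.1, sub_re, add_re]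
    linarith
  exact h.mono fun s hs j h1 h2 => hs j (Finset.mem_Icc.mpr ⟨h1, h2⟩)

/-- The sum over the points where the path is divided, with base point `ix`. -/
def pathSum (N n : ℕ) (F : ℕ → ℝ → ℂ) (a : ℕ → ℕ → ℂ) (b : ℕ → ℂ) (k : ℕ → ℤ) (s : ℕ → ℂ)
    (x : ℝ) : ℂ :=
  ∑ j ∈ Finset.range (n + 1),
    regE (n - j) (block F j (n - j)) (block (fun i => a i 0) j (n - j)) (block s j (n - j)) x *
      regG N j (fun i => invForm N (k i) (F i)) b k s x

/-- Independence of the base point for the continued integrals, also where the original integrals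
diverge. The ends `j = n` and `j = 0` have a constant factor `1`, whose derivative contributes
nothing. -/
lemma hasDerivAt_pathSum {b : ℕ → ℂ} (hN : 0 < N)
    (hF : ∀ i, 1 ≤ i → i ≤ n → IsAxisForm N (k i) (a i) (F i))
    (hb : ∀ i, 1 ≤ i → i ≤ n → IsReg (invForm N (k i) (F i)) (b i))
    (hα : ∀ r, 2 ≤ r → r ≤ n → 0 < α r) {s : ℂ} (hs : DenNeZero n k α s) {x : ℝ} (hx : 0 < x) :
    HasDerivAt (pathSum N n F a b k (args s α)) 0 x := by
  refine hasDerivAt_sum_mul_zero (θ := fun j => F j x * ((I * x) ^ args s α j / x))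
    (e' := fun j => if j < n then F (j + 1) x * ((I * x) ^ args s α (j + 1) / x) *
      regE (n - (j + 1)) (block F (j + 1) (n - (j + 1))) (block (fun i => a i 0) (j + 1) (n - (j + 1)))
        (block (args s α) (j + 1) (n - (j + 1))) x else 0)
    (g' := fun j => Nat.casesOn j 0 fun j => -(F (j + 1) x * ((I * x) ^ args s α (j + 1) / x) *
      regG N j (fun i => invForm N (k i) (F i)) b k (args s α) x)) ?_ ?_ ?_ ?_ ?_ ?_
  · intro j hj
    rcases hj.lt_or_eq with h | h
    · obtain ⟨r, rfl⟩ := Nat.exists_eq_add_of_lt h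
      have h1 := hasDerivAt_regE (φ := block F j (r + 1)) (c := block (fun i => a i 0) j (r + 1))
        (fun i => (hF _ (by omega) (by omega)).isReg) (hs.block hα (j := j) (r := r + 1) (by omega)) hx
      simp only [if_pos h]
      rw [block_succ, block_succ, block_succ, block_apply_zero, block_apply_zero] at h1
      rwa [show j + r + 1 - j = r + 1 by omega, show j + r + 1 - (j + 1) = r by omega]
    · subst h
      have h1 : ∀ r, r = 0 → regE r (block F j r) (block (fun i => a i 0) j r)
          (block (args s α) j r) = fun _ => 1 := by
        rintro _ rfl
        exact funext fun x => regE_zero _ _ _ x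
      simp only [if_neg (lt_irrefl j)]
      rw [h1 _ (Nat.sub_self j)]
      exact hasDerivAt_const _ _
  · intro j hj
    rcases j with _ | j
    · rw [show regG N 0 (fun i => invForm N (k i) (F i)) b k (args s α) = fun _ => 1 from
        funext fun x => regG_zero _ _ _ _ _ _]
      exact hasDerivAt_const _ _
    · exact hasDerivAt_regG hN (fun i h1 h2 => hb i h1 (by omega)) (hs.revBlock hj) hx
  · intro j hj
    simp only [if_pos hj]
  · simp
  · intro j hj
    rfl
  · rfl

/-- After inversion the convergent integral from `1/(Nx)` is bounded by a power of `1/(Nx)` with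
exponent below `-(m + 1)`. -/
lemma isBigO_regG {b : ℕ → ℂ} {j m : ℕ} (hN : 0 < N)
    (hb : ∀ i, 1 ≤ i → i ≤ j → IsReg (invForm N (k i) (F i)) (b i)) {s : ℕ → ℂ}
    (hj : 1 ≤ j)
    (hs : ∀ q, 1 ≤ q → q ≤ j → (∑ i ∈ Finset.Icc 1 q, ((k i : ℂ) - s i)).re < -(m + 1)) :
    regG N j (fun i => invForm N (k i) (F i)) b k s =O[𝓝[>] 0] fun x => x ^ (m + 1) := by
  have hN' : (0 : ℝ) < N := by exact_mod_cast hN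
  have hmem : revBlock (fun i => (k i : ℂ) - s i) j ∈ domInfty j :=
    revBlock_mem_domInfty.mpr fun q h1 h2 => (hs q h1 h2).trans_le (by
      have : (0 : ℝ) ≤ m := Nat.cast_nonneg m
      linarith)
  have hden : regDen j (revBlock (fun i => (k i : ℂ) - s i) j) ≠ 0 :=
    regDen_revBlock_ne_zero fun q h1 h2 h => by
      have := hs q h1 h2
      rw [h, zero_re] at this
      have : (0 : ℝ) ≤ m := Nat.cast_nonneg m
      linarith
  obtain ⟨C, hC, hCb⟩ := exists_norm_regNum_div_le (φ := revBlock (fun i => invForm N (k i) (F i)) j)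
    (c := revBlock b j) (fun i => hb _ (by omega) (by omega)) hmem hden one_pos
  refine IsBigO.const_mul_left (IsBigO.of_bound (C * (N : ℝ) ^ (m + 1)) ?_) _
  filter_upwards [Ioo_mem_nhdsGT (show (0 : ℝ) < 1 / N by positivity)] with x hx
  have hx0 := hx.1
  have hx1 : 1 ≤ 1 / (N * x) := by
    rw [le_div_iff₀ (by positivity)]
    have := hx.2
    rw [lt_div_iff₀ hN'] at this
    linarith
  refine (hCb _ hx1).trans ?_
  rw [sum_revBlock, Real.norm_of_nonneg (by positivity), mul_assoc, ← mul_pow]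
  gcongr
  calc (1 / (N * x)) ^ (∑ i ∈ Finset.Icc 1 j, ((k i : ℂ) - s i)).re ≤
        (1 / (N * x)) ^ (-((m : ℝ) + 1)) :=
          Real.rpow_le_rpow_of_exponent_le hx1 (hs j hj le_rfl).le
    _ = (N * x) ^ (m + 1) := by
      rw [one_div, Real.inv_rpow (by positivity), Real.rpow_neg (by positivity), inv_inv,
        ← Nat.cast_add_one, Real.rpow_natCast]

lemma tendsto_mul_of_isBigO {e g : ℝ → ℂ} {m m' : ℕ} (hm : m ≤ m')
    (he : e =O[𝓝[>] 0] fun y => (y ^ m)⁻¹) (hg : g =O[𝓝[>] 0] fun y => y ^ (m' + 1)) :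
    Tendsto (fun y => e y * g y) (𝓝[>] 0) (𝓝 0) := by
  refine ((he.trans (isBigO_inv_pow_of_le hm)).mul hg).trans_tendsto ?_
  have h : Tendsto (fun y : ℝ => y) (𝓝[>] 0) (𝓝 0) := tendsto_id.mono_left nhdsWithin_le_nhds
  refine h.congr' ?_
  filter_upwards [self_mem_nhdsWithin] with y hy
  have : y ≠ 0 := (mem_Ioi.mp hy).ne'
  field_simp
  ring

/-- The identity holds if the real part of `s` is large. -/
theorem eventually_pathSum_eq {b : ℕ → ℂ} (hN : 0 < N) (hn : 0 < n)
    (hF : ∀ i, 1 ≤ i → i ≤ n → IsAxisForm N (k i) (a i) (F i))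
    (hb : ∀ i, 1 ≤ i → i ≤ n → IsReg (invForm N (k i) (F i)) (b i))
    (hα : ∀ r, 2 ≤ r → r ≤ n → 0 < α r) {x : ℝ} (hx : 0 < x) :
    ∀ᶠ s in reTop, pathSum N n F a b k (args s α) x = seriesCombination n a s α := by
  obtain ⟨n, rfl⟩ := Nat.exists_eq_add_of_le' hn
  have hpg : ∀ i, 1 ≤ i → i ≤ n + 1 → PolyGrowth (a i) := fun i h1 h2 => (hF i h1 h2).polyGrowth
  -- The growth orders at `0` are chosen before `s`: these expansions involve only the fixed
  -- exponents `α`. A half-plane on which the integrals to `0` win can then be fixed.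
  have hE : ∀ p : ℕ, ∃ m : ℕ, p ≤ n → expandE (n - p) (fun i => a (i + p)) (fun i => α (i + p))
      =O[𝓝[>] 0] fun y => (y ^ m)⁻¹ := fun p => by
    by_cases hp : p ≤ n
    · obtain ⟨m, hm⟩ := isBigO_expandE (n := n - p) (a := fun i => a (i + p))
        (fun i h1 h2 => hpg (i + p) (by omega) (by omega)) (fun i => α (i + p))
      exact ⟨m, fun _ => hm⟩
    · exact ⟨0, fun h => absurd h hp⟩
  choose m hm using hE
  set M := ∑ p ∈ Finset.range (n + 1), m p with hM
  have hmM : ∀ p, p ≤ n → m p ≤ M := fun p hp =>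
    Finset.single_le_sum (f := m) (fun _ _ => Nat.zero_le _) (by simp; omega)
  have hpos : ∀ᶠ s in reTop, 0 < (s + ∑ r ∈ Finset.Icc 2 (n + 1), (α r : ℂ)).re :=
    eventually_reTop.mpr ⟨-(∑ r ∈ Finset.Icc 2 (n + 1), (α r : ℂ)).re, fun s hs => by
      rw [add_re]; linarith⟩
  filter_upwards [eventually_mellin_decayD hpg α, eventually_denNeZero (n + 1) k α, hpos,
    eventually_revBlock_mem (n + 1) k α (-((M : ℝ) + 1))] with s hs hden hs0 hs1
  -- The path sum is a constant `c` in the base point; its limit at `0` will be computed from the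
  -- term `j = 0` alone.
  obtain ⟨c, hc⟩ := isOpen_Ioi.exists_is_const_of_deriv_eq_zero isPreconnected_Ioi
    (fun y hy => (hasDerivAt_pathSum hN hF hb hα hden hy).differentiableAt.differentiableWithinAt)
    (fun y hy => (hasDerivAt_pathSum hN hF hb hα hden hy).deriv)
  have h0 : Tendsto (fun x => regE (n + 1 - 0) (block F 0 (n + 1 - 0))
      (block (fun i => a i 0) 0 (n + 1 - 0)) (block (args s α) 0 (n + 1 - 0)) x *
        regG N 0 (fun i => invForm N (k i) (F i)) b k (args s α) x) (𝓝[>] 0)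
      (𝓝 (seriesCombination (n + 1) a s α)) := by
    simp only [regG_zero, mul_one]
    exact tendsto_regE_zero hF hα hs0 (hden.block hα (by omega)) hs.1 hs.2
  have hj : ∀ p ∈ Finset.range (n + 1), Tendsto (fun x => regE (n + 1 - (p + 1))
      (block F (p + 1) (n + 1 - (p + 1))) (block (fun i => a i 0) (p + 1) (n + 1 - (p + 1)))
        (block (args s α) (p + 1) (n + 1 - (p + 1))) x *
        regG N (p + 1) (fun i => invForm N (k i) (F i)) b k (args s α) x) (𝓝[>] 0) (𝓝 0) :=
    fun p hp => by
      rw [Finset.mem_range] at hp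
      refine (tendsto_mul_of_isBigO (hmM p (by omega)) (hm p (by omega)) (isBigO_regG hN
        (fun i h1 h2 => hb i h1 (by omega)) (by omega : 1 ≤ p + 1)
          fun q h1 h2 => hs1 q h1 (by omega))).congr' ?_
      filter_upwards [self_mem_nhdsWithin] with y hy
      rw [block_args (by omega), ← regE_eq_expandE hF hα (r := n - p) (by omega) hy,
        Nat.add_sub_add_right]
  have hlim : Tendsto (pathSum N (n + 1) F a b k (args s α)) (𝓝[>] 0)
      (𝓝 (seriesCombination (n + 1) a s α)) := by
    have := (tendsto_finsetSum _ hj).add h0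
    rw [Finset.sum_const_zero, zero_add] at this
    exact this.congr fun x => (Finset.sum_range_succ' _ _).symm
  have hlim' : Tendsto (pathSum N (n + 1) F a b k (args s α)) (𝓝[>] 0) (𝓝 c) := by
    refine tendsto_const_nhds.congr' ?_
    filter_upwards [self_mem_nhdsWithin] with y hy using (hc y hy).symm
  rw [hc x hx, tendsto_nhds_unique hlim' hlim]

end

/-! ### Meromorphic continuation of the iterated integrals -/

section

variable {r : ℕ}

/-- The reversal of the order of the variables. -/
def revEquiv (r : ℕ) : (Fin r → ℝ) ≃ᵐ (Fin r → ℝ) :=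
  MeasurableEquiv.piCongrLeft (fun _ => ℝ) Fin.revPerm

lemma revEquiv_apply (v : Fin r → ℝ) (i : Fin r) : revEquiv r v i = v i.rev := by
  have := MeasurableEquiv.piCongrLeft_apply_apply (β := fun _ : Fin r => ℝ) Fin.revPerm v i.rev
  rwa [Fin.revPerm_apply, Fin.rev_rev] at this

/-- The substitution `uᵢ ↦ 1 / (N uᵢ)`. -/
def invMap (N : ℕ) (u : Fin r → ℝ) (i : Fin r) : ℝ := 1 / (N * u i)

lemma one_div_mul_one_div_mul {N : ℕ} (hN : 0 < N) (u : ℝ) : (1 : ℝ) / (N * (1 / (N * u))) = u := by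
  have : (N : ℝ) ≠ 0 := by exact_mod_cast hN.ne'
  rcases eq_or_ne u 0 with rfl | h
  · simp
  · field_simp

lemma invMap_invMap {N : ℕ} (hN : 0 < N) (u : Fin r → ℝ) : invMap N (invMap N u) = u :=
  funext fun i => one_div_mul_one_div_mul hN (u i)

lemma one_div_mul_lt {N : ℕ} (hN : 0 < N) {u v : ℝ} (hu : 0 < u) (h : u < v) :
    (1 : ℝ) / (N * v) < 1 / (N * u) := by
  have : (0 : ℝ) < N := by exact_mod_cast hN
  gcongr

lemma revEquiv_preimage_simplex {N : ℕ} (hN : 0 < N) {x : ℝ} (hx : 0 < x) :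
    revEquiv r ⁻¹' simplex r (Ioo 0 x) = invMap N '' simplex r (Ioi (1 / (N * x))) := by
  have hN' : (0 : ℝ) < N := by exact_mod_cast hN
  have hNx : 0 < 1 / (N * x) := by positivity
  ext v
  constructor
  · rintro ⟨h1, h2⟩
    have h3 : ∀ i, v i ∈ Ioo 0 x := fun i => by
      have := h2 i.rev
      rwa [revEquiv_apply, Fin.rev_rev] at this
    refine ⟨invMap N v, ⟨fun i j hij => ?_, fun i => ?_⟩, invMap_invMap hN v⟩
    · have := h1 (Fin.rev_lt_rev.mpr hij)
      rw [revEquiv_apply, revEquiv_apply, Fin.rev_rev, Fin.rev_rev] at this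
      exact one_div_mul_lt hN (h3 j).1 this
    · exact one_div_mul_lt hN (h3 i).1 (h3 i).2
  · rintro ⟨u, ⟨h1, h2⟩, rfl⟩
    have h3 : ∀ i, 0 < u i := fun i => hNx.trans (h2 i)
    refine ⟨fun i j hij => ?_, fun i => ?_⟩
    · rw [revEquiv_apply, revEquiv_apply]
      exact one_div_mul_lt hN (h3 _) (h1 (Fin.rev_lt_rev.mpr hij))
    · rw [revEquiv_apply]
      have h4 := h3 i.rev
      refine ⟨by rw [invMap]; positivity, ?_⟩
      have := one_div_mul_lt hN hNx (h2 i.rev)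
      rwa [one_div_mul_one_div_mul hN] at this

lemma hasDerivAt_one_div_mul {N : ℕ} (hN : 0 < N) {u : ℝ} (hu : 0 < u) :
    HasDerivAt (fun u : ℝ => 1 / (N * u)) (-(1 / (N * u ^ 2))) u := by
  have hN' : (0 : ℝ) < N := by exact_mod_cast hN
  have := ((hasDerivAt_id u).const_mul (N : ℝ)).inv (by simp only [id_eq]; positivity)
  simp only [one_div]
  refine this.congr_deriv ?_
  simp only [id_eq]
  field_simp

/-- The substitution `yᵢ = 1 / (N u_{r+1-i})` in integrals over simplices. -/
lemma simplex_Ioo_substitution {N : ℕ} (hN : 0 < N) {x : ℝ} (hx : 0 < x) (g : (Fin r → ℝ) → ℂ) :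
    (IntegrableOn g (simplex r (Ioo 0 x)) ↔
      IntegrableOn (fun u : Fin r → ℝ => (∏ i, (1 / (N * u i ^ 2) : ℝ)) •
        g fun i => 1 / (N * u i.rev)) (simplex r (Ioi (1 / (N * x))))) ∧
    ∫ y in simplex r (Ioo 0 x), g y = ∫ u in simplex r (Ioi (1 / (N * x))),
      (∏ i, (1 / (N * u i ^ 2) : ℝ)) • g fun i => 1 / (N * u i.rev) := by
  have hN' : (0 : ℝ) < N := by exact_mod_cast hN
  have hNx : 0 < 1 / (N * x) := by positivity
  set S := simplex r (Ioi (1 / (N * x))) with hS_def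
  have hS : MeasurableSet S := (isOpen_simplex r isOpen_Ioi).measurableSet
  have hpos : ∀ u ∈ S, ∀ i, 0 < u i := fun u hu i => hNx.trans (hu.2 i)
  have hmp : MeasurePreserving (revEquiv r) := volume_measurePreserving_piCongrLeft _ _
  set D : (Fin r → ℝ) → (Fin r → ℝ) →L[ℝ] (Fin r → ℝ) := fun u => ContinuousLinearMap.pi fun i =>
    (ContinuousLinearMap.toSpanSingleton ℝ (-(1 / (N * u i ^ 2) : ℝ))).comp
      (ContinuousLinearMap.proj i) with hD
  have hderiv : ∀ u ∈ S, HasFDerivWithinAt (invMap N) (D u) S u := fun u hu => by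
    refine HasFDerivAt.hasFDerivWithinAt (hasFDerivAt_pi.mpr fun i => ?_)
    exact HasFDerivAt.comp (g := fun v : ℝ => 1 / (N * v)) (f := fun u : Fin r → ℝ => u i) u
      (hasDerivAt_one_div_mul hN (hpos u hu i)).hasFDerivAt
      (ContinuousLinearMap.proj (R := ℝ) (φ := fun _ : Fin r => ℝ) i).hasFDerivAt
  have hinj : InjOn (invMap N) S := fun u _ v _ h => by
    rw [← invMap_invMap hN u, h, invMap_invMap hN]
  have hdet : ∀ u ∈ S, |(D u).det| = ∏ i, (1 / (N * u i ^ 2) : ℝ) := fun u hu => by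
    rw [hD, ContinuousLinearMap.det_pi, Finset.abs_prod]
    refine Finset.prod_congr rfl fun i _ => ?_
    have := hpos u hu i
    rw [ContinuousLinearMap.det, ContinuousLinearMap.toLinearMap_toSpanSingleton, LinearMap.det_ring]
    simp only [LinearMap.toSpanSingleton_apply, one_smul, abs_neg]
    exact abs_of_pos (by positivity)
  have hcongr : EqOn (fun u => |(D u).det| • (g ∘ revEquiv r) (invMap N u))
      (fun u => (∏ i, (1 / (N * u i ^ 2) : ℝ)) • g fun i => 1 / (N * u i.rev)) S := fun u hu => by
    simp only [hdet u hu, Function.comp_apply]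
    congr 2
    ext i
    rw [revEquiv_apply, invMap]
  constructor
  · rw [← hmp.integrableOn_comp_preimage (revEquiv r).measurableEmbedding,
      revEquiv_preimage_simplex hN hx,
      integrableOn_image_iff_integrableOn_abs_det_fderiv_smul _ hS hderiv hinj,
      integrableOn_congr_fun hcongr hS]
  · rw [← hmp.setIntegral_preimage_emb (revEquiv r).measurableEmbedding,
      revEquiv_preimage_simplex hN hx]
    refine (integral_image_eq_integral_abs_det_fderiv_smul _ hS hderiv hinj (g ∘ revEquiv r)).trans ?_
    exact setIntegral_congr_fun hS hcongr

lemma integrand_eq (f : Fin r → ℍ → ℂ) (s : Fin r → ℂ) {y : Fin r → ℝ} (hy : ∀ i, 0 < y i) :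
    integrand f s y = (∏ i, I ^ s i) * powIntegrand (fun i => onAxis (f i)) s y := by
  rw [integrand, powIntegrand, ← Finset.prod_mul_distrib]
  refine Finset.prod_congr rfl fun i _ => ?_
  rw [mul_div_assoc, I_mul_cpow_div (hy i), onAxis]
  ring

lemma differentiable_prod_const_cpow {c : ℂ} (hc : c ≠ 0) (e : Fin r → Fin r) :
    Differentiable ℂ fun s : Fin r → ℂ => ∏ i, c ^ s (e i) := by
  simp only [cpow_def_of_ne_zero hc]
  fun_prop

lemma isContinuedValue_infty {f : Fin r → ℍ → ℂ} {c : Fin r → ℂ}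
    (h : ∀ i, IsReg (onAxis (f i)) (c i)) {x : ℝ} (hx : 0 < x) {p : Fin r → ℂ}
    (hp : regDen r p ≠ 0) :
    IsContinuedValue (Ioi x) (domInfty r) f p (regE r (fun i => onAxis (f i)) c p x) := by
  have hS : MeasurableSet (simplex r (Ioi x)) := (isOpen_simplex r isOpen_Ioi).measurableSet
  refine ⟨fun s => (-1) ^ r * (∏ i, I ^ s i) * regNum r (fun i => onAxis (f i)) c s x, regDen r,
    ?_, differentiable_regDen, fun s hs => ?_, hp, ?_⟩
  · refine Differentiable.mul (Differentiable.const_mul ?_ _) (differentiable_regNum h hx)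
    exact differentiable_prod_const_cpow I_ne_zero id
  · have hcongr : EqOn (fun y => (∏ i, I ^ s i) * powIntegrand (fun i => onAxis (f i)) s y)
        (integrand f s) (simplex r (Ioi x)) := fun y hy =>
      (integrand_eq f s fun i => hx.trans (hy.2 i)).symm
    obtain ⟨C, -, hC⟩ := integrableOn_powIntegrand h hs hx
    refine ⟨IntegrableOn.congr_fun ((hC x le_rfl).1.const_mul _) hcongr hS, ?_⟩
    rw [iterInt, ← setIntegral_congr_fun hS hcongr, integral_const_mul]
    simp only [regNum_eq_regDen_mul_integral h hs hx]
    ring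
  · rw [regE, mul_div_assoc]

/-- The exponents after the substitution `z ↦ -1 / (N z)`. -/
def revArg (k : Fin r → ℤ) (s : Fin r → ℂ) : Fin r → ℂ := fun i => k i.rev - s i.rev

/-- The substitution `z ↦ -1/(Nz)` reverses the order of integration and replaces the exponents `s`
by `k - s`; it carries the domain of convergence at `0` into the one at infinity, where the
continuation is known. -/
lemma isContinuedValue_zero {N : ℕ} (hN : 0 < N) {f : Fin r → ℍ → ℂ} {k : Fin r → ℤ}
    {b : Fin r → ℂ} (h : ∀ i, IsReg (invForm N (k i) (onAxis (f i))) (b i)) {x : ℝ} (hx : 0 < x)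
    {p : Fin r → ℂ} (hp : regDen r (revArg k p) ≠ 0) :
    IsContinuedValue (Ioo 0 x) (domZero k) f p
      ((-1) ^ r * (∏ i : Fin r, (I * ((N : ℝ)⁻¹ : ℝ)) ^ p i.rev) *
        (regNum r (fun i => invForm N (k i.rev) (onAxis (f i.rev))) (fun i => b i.rev)
          (revArg k p) (1 / (N * x)) / regDen r (revArg k p))) := by
  have hN' : (0 : ℝ) < N := by exact_mod_cast hN
  have hNx : 0 < 1 / (N * x) := by positivity
  have hS : MeasurableSet (simplex r (Ioi (1 / (N * x)))) :=
    (isOpen_simplex r isOpen_Ioi).measurableSet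
  have hrev : ∀ i : Fin r, IsReg (invForm N (k i.rev) (onAxis (f i.rev))) (b i.rev) := fun i => h _
  have hrevArg : Differentiable ℂ (revArg k) := by
    unfold revArg; fun_prop
  refine ⟨fun s => (-1) ^ r * (∏ i : Fin r, (I * ((N : ℝ)⁻¹ : ℝ)) ^ s i.rev) *
    regNum r (fun i => invForm N (k i.rev) (onAxis (f i.rev))) (fun i => b i.rev)
      (revArg k s) (1 / (N * x)), fun s => regDen r (revArg k s), ?_,
    differentiable_regDen.comp hrevArg, fun s hs => ?_, hp, ?_⟩
  · refine Differentiable.mul (Differentiable.const_mul ?_ _)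
      ((differentiable_regNum hrev hNx).comp hrevArg)
    refine differentiable_prod_const_cpow ?_ Fin.rev
    exact mul_ne_zero I_ne_zero (by exact_mod_cast (inv_pos.mpr hN').ne')
  · have hmem : revArg k s ∈ domInfty r := fun i => by
      have := hs i.rev
      rw [← Fin.map_revPerm_Ici, Finset.sum_map, Finset.sum_map] at this
      simp only [Equiv.coe_toEmbedding, Fin.revPerm_apply] at this
      simp only [revArg, Finset.sum_sub_distrib, sub_re, re_sum, intCast_re] at this ⊢
      linarith
    have hcongr : EqOn (fun u => (∏ i : Fin r, (I * ((N : ℝ)⁻¹ : ℝ)) ^ s i.rev) *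
        powIntegrand (fun i => invForm N (k i.rev) (onAxis (f i.rev))) (revArg k s) u)
        (fun u : Fin r → ℝ => (∏ i, (1 / (N * u i ^ 2) : ℝ)) •
          integrand f s fun i => 1 / (N * u i.rev)) (simplex r (Ioi (1 / (N * x)))) := fun u hu => by
      simp only
      rw [integrand, real_smul, ofReal_prod, powIntegrand, ← Finset.prod_mul_distrib,
        ← Equiv.prod_comp Fin.revPerm fun i => f i (ofComplex (I * ((1 / (N * u i.rev) : ℝ) : ℂ))) *
          (I * ((1 / (N * u i.rev) : ℝ) : ℂ)) ^ s i / ((1 / (N * u i.rev) : ℝ) : ℂ),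
        ← Finset.prod_mul_distrib]
      refine Finset.prod_congr rfl fun i _ => ?_
      have hu0 : 0 < u i := hNx.trans (hu.2 i)
      have h1 := cpow_inversion hN hu0 (k i.rev) (s i.rev)
      have h2 : ((1 / (N * u i ^ 2) : ℝ) : ℂ) * ((N * u i ^ 2 : ℝ) : ℂ) = 1 := by
        rw [← ofReal_mul, ← ofReal_one]
        congr 1
        field_simp
      rw [Fin.revPerm_apply, Fin.rev_rev, invForm, onAxis, revArg, mul_div_assoc, ← h1]
      linear_combination (-(f i.rev (ofComplex (I * ((1 / (N * u i) : ℝ) : ℂ))) *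
        ((I * ((N : ℝ)⁻¹ : ℝ) : ℂ) ^ s i.rev * (u i : ℂ) ^ (-k i.rev) *
          (u i : ℂ) ^ ((k i.rev : ℂ) - s i.rev - 1)))) * h2
    obtain ⟨C, -, hC⟩ := integrableOn_powIntegrand hrev hmem hNx
    obtain ⟨h1, h2⟩ := simplex_Ioo_substitution hN hx (integrand f s)
    refine ⟨h1.mpr (IntegrableOn.congr_fun ((hC _ le_rfl).1.const_mul _) hcongr hS), ?_⟩
    rw [iterInt, h2, ← setIntegral_congr_fun hS hcongr, integral_const_mul]
    simp only [regNum_eq_regDen_mul_integral hrev hmem hNx]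
    ring
  · rw [mul_div_assoc]

/-- Continued values are unique. -/
lemma IsContinuedValue.unique {S : Set ℝ} {D : Set (Fin r → ℂ)} (hD : IsOpen D) (hne : D.Nonempty)
    {f : Fin r → ℍ → ℂ} {p : Fin r → ℂ} {v v' : ℂ} (h : IsContinuedValue S D f p v)
    (h' : IsContinuedValue S D f p v') : v = v' := by
  obtain ⟨P, Q, hP, hQ, hPQ, hp, rfl⟩ := h
  obtain ⟨P', Q', hP', hQ', hPQ', hp', rfl⟩ := h'
  obtain ⟨d, hd⟩ := hne
  -- On the complex line from a point `d` of the domain to `p`, the function `P Q' - P' Q` vanishes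
  -- near `d`; the one-variable identity theorem carries this to `p`.
  set line : ℂ → Fin r → ℂ := fun z => d + z • (p - d) with hline
  have hl : Differentiable ℂ line := by
    rw [hline]; fun_prop
  set G : ℂ → ℂ := fun z => P (line z) * Q' (line z) - P' (line z) * Q (line z) with hG
  have hGd : Differentiable ℂ G :=
    ((hP.comp hl).mul (hQ'.comp hl)).sub ((hP'.comp hl).mul (hQ.comp hl))
  have hG0 : G =ᶠ[𝓝 0] 0 := by
    have h0 : line 0 ∈ D := by simpa [hline] using hd
    filter_upwards [hl.continuous.continuousAt.preimage_mem_nhds (hD.mem_nhds h0)] with z hz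
    simp only [hG, Pi.zero_apply, (hPQ _ hz).2, (hPQ' _ hz).2]
    ring
  have hG1 : G = 0 := AnalyticOnNhd.eq_of_eventuallyEq (z₀ := 0)
    (fun z _ => hGd.analyticAt z) (fun z _ => analyticAt_const) hG0
  have h1 := congrFun hG1 1
  simp only [hG, hline, one_smul, add_sub_cancel, Pi.zero_apply] at h1
  rw [div_eq_div_iff hp hp']
  linear_combination h1

lemma continuedInt_eq {S : Set ℝ} {D : Set (Fin r → ℂ)} (hD : IsOpen D) (hne : D.Nonempty)
    {f : Fin r → ℍ → ℂ} {p : Fin r → ℂ} {v : ℂ} (h : IsContinuedValue S D f p v) :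
    continuedInt S D f p = v := by
  have hex : ∃ v, IsContinuedValue S D f p v := ⟨v, h⟩
  rw [continuedInt, dif_pos hex]
  exact hex.choose_spec.unique hD hne h

/-- The same quotient `P / Q` serves at all nearby points. Any quotient is allowed, so this also
covers regular points at which `regDen` happens to vanish. -/
lemma continuousAt_continuedInt {S : Set ℝ} {D : Set (Fin r → ℂ)} (hD : IsOpen D)
    (hne : D.Nonempty) {f : Fin r → ℍ → ℂ} {p : Fin r → ℂ}
    (h : ∃ v, IsContinuedValue S D f p v) : ContinuousAt (continuedInt S D f) p := by
  obtain ⟨v, P, Q, hP, hQ, hPQ, hp, rfl⟩ := h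
  refine ContinuousAt.congr (hP.continuous.continuousAt.div hQ.continuous.continuousAt hp) ?_
  filter_upwards [hQ.continuous.continuousAt.eventually_ne hp] with q hq
  exact (continuedInt_eq hD hne ⟨P, Q, hP, hQ, hPQ, hq, rfl⟩).symm

lemma isOpen_domInfty (r : ℕ) : IsOpen (domInfty r) := by
  have : domInfty r = ⋂ i : Fin r, {s | (∑ t ∈ Finset.Ici i, s t).re < 0} := by
    ext s; simp [domInfty]
  rw [this]
  exact isOpen_iInter_of_finite fun i => isOpen_lt (by fun_prop) continuous_const

lemma domInfty_nonempty (r : ℕ) : (domInfty r).Nonempty := by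
  refine ⟨fun _ => -1, fun i => ?_⟩
  simp

lemma isOpen_domZero (k : Fin r → ℤ) : IsOpen (domZero k) := by
  have : domZero k = ⋂ i : Fin r, {s | (∑ t ∈ Finset.Iic i, (k t : ℝ)) <
      (∑ t ∈ Finset.Iic i, s t).re} := by
    ext s; simp [domZero]
  rw [this]
  exact isOpen_iInter_of_finite fun i => isOpen_lt continuous_const (by fun_prop)

lemma domZero_nonempty (k : Fin r → ℤ) : (domZero k).Nonempty := by
  refine ⟨fun i => k i + 1, fun i => ?_⟩
  rw [Finset.sum_add_distrib, add_re, re_sum]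
  simp
  positivity

end

/-! ### Meromorphic functions on the plane -/

lemma tendsto_add_const_reTop (c : ℂ) : Tendsto (fun s => s + c) reTop reTop := by
  refine tendsto_comap_iff.mpr ?_
  exact (tendsto_comap.atTop_add tendsto_const_nhds : Tendsto (fun s : ℂ => s.re + c.re) reTop atTop)

lemma meromorphic_of_differentiable {f : ℂ → ℂ} (hf : Differentiable ℂ f) : Meromorphic f :=
  fun z => (hf.analyticAt z).meromorphicAt

/-- Meromorphic functions that agree on a half-plane agree in the whole plane, up to isolated
points. -/
lemma eventuallyEq_nhdsNE_of_meromorphic {f g : ℂ → ℂ} (hf : Meromorphic f) (hg : Meromorphic g)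
    (h : f =ᶠ[reTop] g) (z : ℂ) : f =ᶠ[𝓝[≠] z] g := by
  obtain ⟨σ, hσ⟩ := eventually_reTop.mp h
  have hw : meromorphicOrderAt (f - g) (σ + 1 : ℂ) = ⊤ := by
    refine meromorphicOrderAt_eq_top_iff.mpr (Filter.Eventually.filter_mono nhdsWithin_le_nhds ?_)
    filter_upwards [continuous_re.continuousAt.eventually_const_lt
      (show σ < (σ + 1 : ℂ).re by simp)] with s hs
    rw [Pi.sub_apply, hσ s hs, sub_self]
  have hz : meromorphicOrderAt (f - g) z = ⊤ := by
    by_contra hz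
    exact (hf.sub hg).meromorphicOn.meromorphicOrderAt_ne_top_of_isPreconnected
      isPreconnected_univ (mem_univ z) (mem_univ _) hz hw
  filter_upwards [meromorphicOrderAt_eq_top_iff.mp hz] with s hs
  exact sub_eq_zero.mp hs

lemma eq_of_meromorphicNFOn {f g : ℂ → ℂ} (hf : MeromorphicNFOn f univ)
    (hg : MeromorphicNFOn g univ) (h : f =ᶠ[reTop] g) : f = g := by
  ext z
  exact ((MeromorphicNFAt.eventuallyEq_nhdsNE_iff_eventuallyEq_nhds (hf (mem_univ z))
    (hg (mem_univ z))).mp (eventuallyEq_nhdsNE_of_meromorphic (meromorphicOn_univ.mp hf.meromorphicOn)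
      (meromorphicOn_univ.mp hg.meromorphicOn) h z)).eq_of_nhds

section

variable {l : ℕ} {a : ℕ → ℕ → ℂ} {β : ℕ → ℂ} {g : ℂ → ℂ}

lemma IsContinuedL.eventuallyEq (h : IsContinuedL l a β g) :
    ∀ᶠ z in reTop, g z = multLSeries l a (consArg z β) := by
  obtain ⟨-, σ, hσ⟩ := h
  exact eventually_reTop.mpr ⟨σ, fun z hz => (hσ z hz).2⟩

lemma multL_eq (h : IsContinuedL l a β g) : multL l a β = g := by
  have hex : ∃ g, IsContinuedL l a β g := ⟨g, h⟩
  have h' := hex.choose_spec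
  have : hex.choose = g := eq_of_meromorphicNFOn h'.1 h.1 <| by
    filter_upwards [h'.eventuallyEq, h.eventuallyEq] with z h1 h2
    rw [h1, h2]
  ext z
  rw [multL, dif_pos hex, this]

lemma meromorphic_multL (h : ∃ g, IsContinuedL l a β g) : Meromorphic (multL l a β) := by
  obtain ⟨g, h⟩ := h
  rw [multL_eq h]
  exact meromorphicOn_univ.mp h.1.meromorphicOn

lemma eventually_multL_eq (h : ∃ g, IsContinuedL l a β g) :
    ∀ᶠ z in reTop, multL l a β z = multLSeries l a (consArg z β) := by
  obtain ⟨g, h⟩ := h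
  rw [multL_eq h]
  exact h.eventuallyEq

lemma continuousAt_multL {z : ℂ} (h : IsRegularL l a β z) : ContinuousAt (multL l a β) z := by
  obtain ⟨g, h, hz⟩ := h
  rw [multL_eq h]
  exact hz.continuousAt

end

/-! ### The arguments of the `L`-functions -/

section

variable {n l : ℕ} {ν : Fin (l + 1) → ℕ} {α : ℕ → ℕ} {j : ℕ →₀ ℕ}

lemma le_sum_add_of_mem_jSet {M : ℕ} {b : ℕ → ℕ} (hj : j ∈ jSet M b) {q p : ℕ} (hq : 2 ≤ q)
    (hqp : q ≤ p) (hp : p ≤ M) : j q ≤ ∑ r ∈ Finset.Icc q p, b r + j (p + 1) := by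
  induction p, hqp using Nat.le_induction with
  | base =>
    have := hj.2 q hq hp
    simpa using this.le
  | succ p hqp ih =>
    have h1 := ih (by omega)
    have h2 := hj.2 (p + 1) (by omega) hp
    rw [Finset.sum_Icc_succ_top (by omega)]
    omega

lemma sum_alphaTail_of_lt {M q p : ℕ} (hp : p < M) :
    ∑ r ∈ Finset.Icc q p, alphaTail n M α r = ∑ r ∈ Finset.Icc q p, α r :=
  Finset.sum_congr rfl fun r hr => by
    rw [Finset.mem_Icc] at hr
    rw [alphaTail, if_neg (by omega)]

lemma sum_alphaTail {M q : ℕ} (hq : 1 ≤ q) (hqM : q ≤ M) (hMn : M ≤ n) :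
    ∑ r ∈ Finset.Icc q M, alphaTail n M α r = ∑ r ∈ Finset.Icc q n, α r := by
  obtain ⟨M, rfl⟩ := Nat.exists_eq_add_of_le' (hq.trans hqM)
  rw [Finset.sum_Icc_succ_top hqM, sum_alphaTail_of_lt (Nat.lt_succ_self M), alphaTail,
    if_pos rfl]
  have hI : ∀ x y, Finset.Icc x y = Finset.Ico x (y + 1) := fun x y => by ext; simp
  rw [hI, hI, hI, Finset.sum_Ico_consecutive _ hqM (by omega)]

/-- Chaining the constraints `j_r < b_r + j_{r+1}` between two selected indices shows that the
subtracted entry never exceeds what it is subtracted from. The continuation of the `L`-functions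
relies on this. -/
lemma otherArg_eq_natCast (hln : l ≤ n) (hν : ν ∈ nuTuples n l) (hj : j ∈ jTuples n (idx ν l) α)
    {i : ℕ} (hi : 2 ≤ i) (hil : i ≤ l) : ∃ m : ℕ, otherArg n ν α j i = m := by
  have hj' := mem_jTuples.mp hj
  have hM := idx_le_of_mem hln hν
  have hlt : idx ν (i - 1) < idx ν i := idx_strictMono ν (by omega)
  have hle : idx ν i ≤ idx ν l := (idx_strictMono ν).monotone hil
  have hpos := le_idx ν (i - 1)
  have key : j (idx ν (i - 1) + 1) ≤
      ∑ r ∈ Finset.Icc (idx ν (i - 1) + 1) (upper n ν i), α r + j (idx ν i + 1) := by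
    have h := le_sum_add_of_mem_jSet (j := j) hj' (by omega : 2 ≤ idx ν (i - 1) + 1) hlt hle
    rw [upper]
    split_ifs with hi'
    · subst hi'
      rwa [sum_alphaTail (by omega) hlt hM] at h
    · rwa [sum_alphaTail_of_lt (idx_strictMono ν (by omega))] at h
  refine ⟨∑ r ∈ Finset.Icc (idx ν (i - 1) + 1) (upper n ν i), α r + j (idx ν i + 1) -
    j (idx ν (i - 1) + 1), ?_⟩
  rw [otherArg, Nat.cast_sub key]
  push_cast
  ring

lemma exists_isContinuedL_subCoeff {N : ℕ} (hN : 0 < N) {k : ℕ → ℤ} {f : ℕ → ℍ → ℂ}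
    (hf : ∀ i, 1 ≤ i → i ≤ n → IsAxisForm N (k i) (qCoeff (f i)) (onAxis (f i)))
    (hl : 1 ≤ l) (hln : l ≤ n) (hν : ν ∈ nuTuples n l) (hj : j ∈ jTuples n (idx ν l) α) :
    ∃ g, IsContinuedL l (subCoeff f ν) (otherArg n ν α j) g := by
  refine exists_isContinuedL hN hl (fun i => ⟨k (idx ν (i + 1)), onAxis (f (idx ν (i + 1))), ?_⟩)
    fun i h1 h2 => otherArg_eq_natCast hln hν hj h1 h2
  refine hf _ ((Nat.succ_pos _).trans_le (le_idx ν (i + 1)))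
    (((idx_strictMono ν).monotone i.isLt).trans (idx_le_of_mem hln hν))

end

/-! ### Both sides as functions of `s` -/

lemma differentiable_args (α : ℕ → ℕ) (r : ℕ) : Differentiable ℂ fun s => args s α r := by
  unfold args consArg
  split_ifs <;> fun_prop

lemma differentiable_choose (m : ℕ) : Differentiable ℂ fun s : ℂ => Ring.choose (s + m - 1) m := by
  have h : ∀ s : ℂ, Ring.choose (s + m - 1) m =
      (m.factorial : ℂ)⁻¹ * (ascPochhammer ℂ m).eval s := fun s => by
    rw [← Polynomial.ascPochhammer_smeval_eq_eval, ← Ring.factorial_nsmul_multichoose_eq_ascPochhammer,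
      Ring.multichoose_eq, nsmul_eq_mul, inv_mul_cancel_left₀]
    exact_mod_cast m.factorial_ne_zero
  simp only [h]
  exact (Polynomial.differentiable _).const_mul _

lemma firstArg_eq (n : ℕ) {l : ℕ} (ν : Fin (l + 1) → ℕ) (s : ℂ) (α j : ℕ → ℕ) :
    firstArg n ν s α j =
      s + ((∑ r ∈ Finset.Icc 2 (upper n ν 1), (α r : ℂ)) + (j (idx ν 1 + 1) : ℂ)) :=
  add_assoc _ _ _

lemma differentiable_binomFactor (M : ℕ) (α j : ℕ → ℕ) :
    Differentiable ℂ fun s => binomFactor M s α j :=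
  (differentiable_choose (j 2)).mul_const _

lemma meromorphic_gammaHead (n M : ℕ) (α : ℕ → ℕ) : Meromorphic fun s => gammaHead n M s α := by
  unfold gammaHead
  split_ifs
  · exact Meromorphic.meromorphic_fun_comp_add_const_iff_meromorphic.mpr Meromorphic.Gamma
  · exact Meromorphic.Gamma

lemma continuousAt_gammaHead (n M : ℕ) (α : ℕ → ℕ) {s : ℂ} (hs : ∀ m : ℕ, s ≠ -(m : ℂ)) :
    ContinuousAt (fun s => gammaHead n M s α) s := by
  unfold gammaHead
  split_ifs
  · refine ContinuousAt.comp (f := fun s : ℂ => s + ∑ r ∈ Finset.Icc 2 n, (α r : ℂ))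
      (differentiableAt_Gamma _ fun m hm => hs (m + ∑ r ∈ Finset.Icc 2 n, α r) ?_).continuousAt
      (by fun_prop)
    push_cast
    linear_combination hm
  · exact (differentiableAt_Gamma s hs).continuousAt

section

variable {n : ℕ} {f : ℕ → ℍ → ℂ} {α : ℕ → ℕ}

/-- The terms of the linear combination. -/
lemma lCombination_eq (n : ℕ) (f : ℕ → ℍ → ℂ) (s : ℂ) (α : ℕ → ℕ) :
    lCombination n f s α = ∑ l ∈ Finset.Icc 1 n, ∑ ν ∈ nuTuples n l,
      (gammaHead n (idx ν l) s α * (-gammaTail n (idx ν l) α * coeffA n f ν *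
        coeffB n (ν (Fin.last l)) (args 0 α)) *
      ∑ j ∈ jTuples n (idx ν l) α, binomFactor (idx ν l) s α j *
        multL l (subCoeff f ν) (otherArg n ν α j) (firstArg n ν s α j)) := by
  refine Finset.sum_congr rfl fun l hl => Finset.sum_congr rfl fun ν hν => ?_
  rw [Finset.mem_Icc] at hl
  have h1 := le_idx ν l
  have h2 := last_add_idx hl.2 hν
  -- Only entries beyond the last selected index enter `coeffB`, so `s` may be replaced by `0` there
  -- and the factor is constant in `s`.
  rw [gammaFactor_eq (by omega) (by omega), coeffB_congr (x' := args 0 α) fun r hr => by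
    rw [args_of_two_le (by omega), args_of_two_le (by omega)]]
  ring

lemma meromorphic_lCombination
    (h : ∀ l, 1 ≤ l → l ≤ n → ∀ ν ∈ nuTuples n l, ∀ j ∈ jTuples n (idx ν l) α,
      ∃ g, IsContinuedL l (subCoeff f ν) (otherArg n ν α j) g) :
    Meromorphic fun s => lCombination n f s α := by
  simp only [lCombination_eq]
  refine Meromorphic.fun_sum fun l hl => Meromorphic.fun_sum fun ν hν =>
    ((meromorphic_gammaHead _ _ _).fun_mul (.const _)).fun_mul (Meromorphic.fun_sum fun j hj => ?_)
  rw [Finset.mem_Icc] at hl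
  refine (meromorphic_of_differentiable (differentiable_binomFactor _ _ _)).fun_mul ?_
  simp only [firstArg_eq]
  exact Meromorphic.meromorphic_fun_comp_add_const_iff_meromorphic.mpr (meromorphic_multL (h l hl.1 hl.2 ν hν j hj))

lemma continuousAt_lCombination {s : ℂ} (hs : ∀ m : ℕ, s ≠ -(m : ℂ))
    (h : ∀ l, 1 ≤ l → l ≤ n → ∀ ν ∈ nuTuples n l, ∀ j ∈ jTuples n (idx ν l) α,
      IsRegularL l (subCoeff f ν) (otherArg n ν α j) (firstArg n ν s α j)) :
    ContinuousAt (fun s => lCombination n f s α) s := by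
  simp only [lCombination_eq]
  refine tendsto_finsetSum _ fun l hl => tendsto_finsetSum _ fun ν hν =>
    ((continuousAt_gammaHead _ _ _ hs).mul continuousAt_const).mul (tendsto_finsetSum _ fun j hj => ?_)
  rw [Finset.mem_Icc] at hl
  refine ((differentiable_binomFactor _ _ _).continuous.continuousAt).mul ?_
  refine ContinuousAt.comp (f := fun s => firstArg n ν s α j)
    (continuousAt_multL (h l hl.1 hl.2 ν hν j hj)) ?_
  simp only [firstArg_eq]
  fun_prop

lemma eventually_lCombination_eq
    (h : ∀ l, 1 ≤ l → l ≤ n → ∀ ν ∈ nuTuples n l, ∀ j ∈ jTuples n (idx ν l) α,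
      ∃ g, IsContinuedL l (subCoeff f ν) (otherArg n ν α j) g) :
    ∀ᶠ s in reTop, lCombination n f s α = seriesCombination n (fun i => qCoeff (f i)) s α := by
  have key : ∀ᶠ s in reTop, ∀ l ∈ Finset.Icc 1 n, ∀ ν ∈ nuTuples n l,
      ∀ j ∈ jTuples n (idx ν l) α,
        multL l (subCoeff f ν) (otherArg n ν α j) (firstArg n ν s α j) =
          multLSeries l (subCoeff f ν) (consArg (firstArg n ν s α j) (otherArg n ν α j)) := by
    refine (Finset.eventually_all _).mpr fun l hl => (Finset.eventually_all _).mpr fun ν hν =>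
      (Finset.eventually_all _).mpr fun j hj => ?_
    rw [Finset.mem_Icc] at hl
    simp only [firstArg_eq]
    exact (tendsto_add_const_reTop _).eventually (eventually_multL_eq (h l hl.1 hl.2 ν hν j hj))
  filter_upwards [key] with s hs
  refine Finset.sum_congr rfl fun l hl => Finset.sum_congr rfl fun ν hν => ?_
  refine congrArg₂ _ rfl (Finset.sum_congr rfl fun j hj => ?_)
  rw [hs l hl ν hν j hj]
  rfl

lemma differentiable_block (α : ℕ → ℕ) (p r : ℕ) :
    Differentiable ℂ fun s => block (args s α) p r :=
  differentiable_pi.mpr fun _ => differentiable_args α _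

end

section

variable {N n : ℕ} {k : ℕ → ℤ} {a : ℕ → ℕ → ℂ} {F : ℕ → ℝ → ℂ} {b : ℕ → ℂ} {α : ℕ → ℕ}

lemma meromorphic_regNum_div_regDen {r : ℕ} {φ : Fin r → ℝ → ℂ} {c : Fin r → ℂ}
    (h : ∀ i, IsReg (φ i) (c i)) {y : ℝ} (hy : 0 < y) {w : ℂ → Fin r → ℂ}
    (hw : Differentiable ℂ w) : Meromorphic fun s => regNum r φ c (w s) y / regDen r (w s) :=
  fun z => ((meromorphic_of_differentiable ((differentiable_regNum h hy).comp hw)) z).fun_div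
    ((meromorphic_of_differentiable (differentiable_regDen.comp hw)) z)

lemma meromorphic_pathSum (hN : 0 < N)
    (hF : ∀ i, 1 ≤ i → i ≤ n → IsAxisForm N (k i) (a i) (F i))
    (hb : ∀ i, 1 ≤ i → i ≤ n → IsReg (invForm N (k i) (F i)) (b i)) {x : ℝ} (hx : 0 < x) :
    Meromorphic fun s => pathSum N n F a b k (args s α) x := by
  have hN' : (0 : ℝ) < N := by exact_mod_cast hN
  refine Meromorphic.fun_sum fun j hj => ?_
  rw [Finset.mem_range] at hj
  refine Meromorphic.fun_mul ?_ ?_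
  · refine Meromorphic.fun_mul ?_ (meromorphic_regNum_div_regDen (fun i =>
      (hF _ (by omega) (by omega)).isReg) hx (differentiable_block α _ _))
    exact meromorphic_of_differentiable (((differentiable_prod_const_cpow I_ne_zero id).comp
      (differentiable_block α j (n - j))).const_mul _)
  · have h1 : Differentiable ℂ fun s => revBlock (args s α) j :=
      differentiable_pi.mpr fun _ => differentiable_args α _
    refine Meromorphic.fun_mul ?_ (meromorphic_regNum_div_regDen (fun i =>
      hb _ (by omega) (by omega)) (by positivity) (differentiable_pi.mpr fun _ =>
        (differentiable_args α _).const_sub _))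
    have hc : (I * ((N : ℝ)⁻¹ : ℝ) : ℂ) ≠ 0 :=
      mul_ne_zero I_ne_zero (by exact_mod_cast (inv_pos.mpr hN').ne')
    exact meromorphic_of_differentiable
      (((differentiable_prod_const_cpow hc id).comp h1).const_mul _)

end

section

variable {N n : ℕ} {k : ℕ → ℤ} {f : ℕ → ℍ → ℂ} {b : ℕ → ℂ} {α : ℕ → ℕ} {s : ℂ}

lemma block_zero_rev {X : Type} (x : ℕ → X) (j : ℕ) (i : Fin j) :
    block x 0 j i.rev = revBlock x j i := by
  rw [block, revBlock, Fin.val_rev]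
  congr 1
  omega

lemma basePt_pos (hN : 0 < N) : 0 < basePt N :=
  one_div_pos.mpr (Real.sqrt_pos.mpr (by exact_mod_cast hN))

lemma isContinuedValue_block_infty (hN : 0 < N)
    (hf : ∀ i, 1 ≤ i → i ≤ n → IsAxisForm N (k i) (qCoeff (f i)) (onAxis (f i)))
    (hα : ∀ r, 2 ≤ r → r ≤ n → 0 < α r) (h : DenNeZero n k α s) {j : ℕ} (hj : j ≤ n) :
    IsContinuedValue (Ioi (basePt N)) (domInfty (n - j)) (block f j (n - j))
      (block (args s α) j (n - j))
      (regE (n - j) (block (fun i => onAxis (f i)) j (n - j))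
        (block (fun i => qCoeff (f i) 0) j (n - j)) (block (args s α) j (n - j)) (basePt N)) :=
  isContinuedValue_infty (fun i => (hf _ (by omega) (by omega)).isReg) (basePt_pos hN)
    (h.block hα (by omega))

lemma isContinuedValue_block_zero (hN : 0 < N)
    (hb : ∀ i, 1 ≤ i → i ≤ n → IsReg (invForm N (k i) (onAxis (f i))) (b i))
    (h : DenNeZero n k α s) {j : ℕ} (hj : j ≤ n) :
    IsContinuedValue (Ioo 0 (basePt N)) (domZero (block k 0 j)) (block f 0 j)
      (block (args s α) 0 j)
      (regG N j (fun i => invForm N (k i) (onAxis (f i))) b k (args s α) (basePt N)) := by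
  have hrev : revArg (block k 0 j) (block (args s α) 0 j) =
      revBlock (fun i => k i - args s α i) j := by
    ext i
    rw [revArg, block_zero_rev, block_zero_rev]
    rfl
  have := isContinuedValue_zero (f := block f 0 j) (k := block k 0 j) (b := block b 0 j) hN
    (fun i => hb _ (by omega) (by omega)) (basePt_pos hN) (p := block (args s α) 0 j)
    (by rw [hrev]; exact h.revBlock hj)
  rw [hrev] at this
  simp only [block_zero_rev] at this
  exact this

lemma DenNeZero.isRegularAt (hN : 0 < N)
    (hf : ∀ i, 1 ≤ i → i ≤ n → IsAxisForm N (k i) (qCoeff (f i)) (onAxis (f i)))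
    (hb : ∀ i, 1 ≤ i → i ≤ n → IsReg (invForm N (k i) (onAxis (f i))) (b i))
    (hα : ∀ r, 2 ≤ r → r ≤ n → 0 < α r) (h : DenNeZero n k α s) :
    IsRegularAt N n k f (args s α) := fun _ hj =>
  ⟨⟨_, isContinuedValue_block_infty hN hf hα h hj⟩, ⟨_, isContinuedValue_block_zero hN hb h hj⟩⟩

lemma DenNeZero.modIterInt_eq (hN : 0 < N)
    (hf : ∀ i, 1 ≤ i → i ≤ n → IsAxisForm N (k i) (qCoeff (f i)) (onAxis (f i)))
    (hb : ∀ i, 1 ≤ i → i ≤ n → IsReg (invForm N (k i) (onAxis (f i))) (b i))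
    (hα : ∀ r, 2 ≤ r → r ≤ n → 0 < α r) (h : DenNeZero n k α s) :
    modIterInt N n k f (args s α) =
      pathSum N n (fun i => onAxis (f i)) (fun i => qCoeff (f i)) b k (args s α) (basePt N) :=
  Finset.sum_congr rfl fun j hj => by
    have hj' : j ≤ n := by rw [Finset.mem_range] at hj; omega
    rw [continuedInt_eq (isOpen_domInfty _) (domInfty_nonempty _)
      (isContinuedValue_block_infty hN hf hα h hj'), continuedInt_eq (isOpen_domZero _)
      (domZero_nonempty _) (isContinuedValue_block_zero hN hb h hj')]

lemma IsRegularAt.continuousAt (h : IsRegularAt N n k f (args s α)) :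
    ContinuousAt (fun s => modIterInt N n k f (args s α)) s := by
  refine tendsto_finsetSum _ fun j hj => ?_
  obtain ⟨h1, h2⟩ := h j (by rw [Finset.mem_range] at hj; omega)
  exact (ContinuousAt.comp (f := fun s => block (args s α) j (n - j))
    (continuousAt_continuedInt (isOpen_domInfty _) (domInfty_nonempty _) h1)
    (differentiable_block α _ _).continuous.continuousAt).mul
    (ContinuousAt.comp (f := fun s => block (args s α) 0 j)
    (continuousAt_continuedInt (isOpen_domZero _) (domZero_nonempty _) h2)
    (differentiable_block α _ _).continuous.continuousAt)

/-- Both sides are continuous at `s` by the regularity assumptions, and they agree on a punctured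
neighbourhood by the identity theorem. -/
lemma modIterInt_eq_lCombination (hN : 0 < N) (hn : 0 < n)
    (hf : ∀ i, 1 ≤ i → i ≤ n → IsAxisForm N (k i) (qCoeff (f i)) (onAxis (f i)))
    (hb : ∀ i, 1 ≤ i → i ≤ n → IsReg (invForm N (k i) (onAxis (f i))) (b i))
    (hα : ∀ r, 2 ≤ r → r ≤ n → 0 < α r) (hs : ∀ m : ℕ, s ≠ -(m : ℂ))
    (hreg : IsRegularAt N n k f (args s α))
    (hL : ∀ l, 1 ≤ l → l ≤ n → ∀ ν ∈ nuTuples n l, ∀ j ∈ jTuples n (idx ν l) α,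
      IsRegularL l (subCoeff f ν) (otherArg n ν α j) (firstArg n ν s α j)) :
    modIterInt N n k f (args s α) = lCombination n f s α := by
  have hcont : ∀ l, 1 ≤ l → l ≤ n → ∀ ν ∈ nuTuples n l, ∀ j ∈ jTuples n (idx ν l) α,
      ∃ g, IsContinuedL l (subCoeff f ν) (otherArg n ν α j) g :=
    fun l h1 h2 ν hν j hj => exists_isContinuedL_subCoeff hN hf h1 h2 hν hj
  have hpath : (fun s => pathSum N n (fun i => onAxis (f i)) (fun i => qCoeff (f i)) b k
      (args s α) (basePt N)) =ᶠ[reTop] fun s => lCombination n f s α := by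
    filter_upwards [eventually_pathSum_eq hN hn hf hb hα (basePt_pos hN),
      eventually_lCombination_eq hcont] with z h1 h2
    rw [h1, h2]
  have heq := eventuallyEq_nhdsNE_of_meromorphic (meromorphic_pathSum hN hf hb (basePt_pos hN))
    (meromorphic_lCombination hcont) hpath s
  -- The point `s` itself may be a zero of the denominators; it suffices that the other zeros,
  -- finite in number, stay away from it.
  have hfin : ∀ᶠ z in 𝓝[≠] s, DenNeZero n k α z := by
    have := ((finite_not_denNeZero n k α).sdiff (t := {s})).isClosed.isOpen_compl.mem_nhds
      (x := s) (by simp)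
    filter_upwards [nhdsWithin_le_nhds this, self_mem_nhdsWithin] with z h1 h2
    by_contra h
    exact h1 ⟨h, h2⟩
  refine tendsto_nhds_unique_of_eventuallyEq
    (hreg.continuousAt.tendsto.mono_left nhdsWithin_le_nhds)
    ((continuousAt_lCombination hs hL).tendsto.mono_left (nhdsWithin_le_nhds (s := {s}ᶜ))) ?_
  filter_upwards [heq, hfin] with z h1 h2
  rw [h2.modIterInt_eq hN hf hb hα]
  exact h1

end

end ModIter

end

/-! ### The main theorem -/

theorem mainTheorem1 (N : ℕ) (hN : 0 < N) (n : ℕ) (hn : 0 < n)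
    (k : ℕ → ℤ) (χ : ℕ → DirichletCharacter ℂ N) (f : ℕ → ℍ → ℂ)
    (hf : ∀ i, 1 ≤ i → i ≤ n → ModIter.IsModularForm N (k i) (χ i) (f i))
    (α : ℕ → ℕ) (hα : ∀ r, 2 ≤ r → r ≤ n → 0 < α r) :
    {s : ℂ | ¬ ModIter.IsRegularAt N n k f (ModIter.args s α)}.Finite ∧
    (∀ l, 1 ≤ l → l ≤ n → ∀ ν ∈ ModIter.nuTuples n l,
      ∀ j ∈ ModIter.jTuples n (ModIter.idx ν l) α,
        ∃ g, ModIter.IsContinuedL l (ModIter.subCoeff f ν) (ModIter.otherArg n ν α j) g) ∧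
    ∀ s : ℂ, (∀ m : ℕ, s ≠ -(m : ℂ)) →
      ModIter.IsRegularAt N n k f (ModIter.args s α) →
      (∀ l, 1 ≤ l → l ≤ n → ∀ ν ∈ ModIter.nuTuples n l,
        ∀ j ∈ ModIter.jTuples n (ModIter.idx ν l) α,
          ModIter.IsRegularL l (ModIter.subCoeff f ν) (ModIter.otherArg n ν α j)
            (ModIter.firstArg n ν s α j)) →
      ModIter.modIterInt N n k f (ModIter.args s α) = ModIter.lCombination n f s α := by
  have hform : ∀ i, 1 ≤ i → i ≤ n →
      ModIter.IsAxisForm N (k i) (ModIter.qCoeff (f i)) (ModIter.onAxis (f i)) :=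
    fun i h1 h2 => (hf i h1 h2).isAxisForm hN
  -- The limits `b i` of the inverted forms describe the behaviour at the cusp `0`; outside `1, …,
  -- n` the value is a dummy.
  have hex : ∀ i, ∃ b, 1 ≤ i → i ≤ n →
      ModIter.IsReg (ModIter.invForm N (k i) (ModIter.onAxis (f i))) b := fun i => by
    by_cases h : 1 ≤ i ∧ i ≤ n
    · obtain ⟨b, hb⟩ := (hform i h.1 h.2).exists_isReg_invForm hN
      exact ⟨b, fun _ _ => hb⟩
    · exact ⟨0, fun h1 h2 => absurd ⟨h1, h2⟩ h⟩
  choose b hb using hex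
  exact ⟨(ModIter.finite_not_denNeZero n k α).subset fun s hs hden =>
      hs (hden.isRegularAt hN hform hb hα),
    fun l h1 h2 ν hν j hj => ModIter.exists_isContinuedL_subCoeff hN hform h1 h2 hν hj,
    fun s hs hreg hL => ModIter.modIterInt_eq_lCombination hN hn hform hb hα hs hreg hL⟩
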